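/- **Definitions.** Let $k\in\mathbb N$. A $k$-labeled graph is a finite simple graph $G$ with a labeling $\mathrm{lab}\colon V(G)\to[k]$. Consider the following operations. - *Introduce* $v\langle i\rangle$: a single vertex $v$ (its *title*) with label $i$. - *Union* $\oplus$: the disjoint union of two vertex-disjoint labeled graphs. - *Join* $\eta_{i,j}$ ($i\ne j$): add all edges between vertices of label $i$ and vertices of label $j$. - *Relabel* $\rho_{i\to j}$ ($i\neq j$): give label $j$ to every vertex of label $i$. - *Fuse* $\theta_i$ (if some vertex has label $i$): replace all vertices of label $i$ by one vertex of label $i$ whose neighbors are the remaining vertices that had a neighbor of label $i$. - *Glue* $\sqcup$: takes two labeled graphs $G_1,G_2$ that may share vertices, provided that every shared vertex (*glue-vertex*) has the same label in $G_1$ and $G_2$ and is the only vertex with this label in each of them; the result has vertex set $V(G_1)\cup V(G_2)$, edge set $E(G_1)\cup E(G_2)$, and the inherited labels. A *fuse-$k$-expression* is a well-formed expression in introduce, union, join, relabel and fuse; the titles in its introduce-nodes are assumed to be pairwise distinct. A *glue-$k$-expression* is a well-formed expression in introduce, glue, join and relabel. For a node $t$ of an expression, $G_t$ is the labeled graph created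 by the sub-expression rooted at $t$. An expression is *an expression of a graph $H$* if the graph it creates is, up to isomorphism and after forgetting the labels, $H$. The size $|\varphi|$ of a fuse-$k$-expression $\varphi$ is the number of nodes of its parse tree plus the total length of its titles written in binary. A glue-$k$-expression is *reduced* if: - (0) it has no useless nodes: each join-node creates at least one new edge, and each relabel-node $\rho_{i\to j}$ is applied to a graph with at least one vertex of label $i$; - (1) for each join-node $\eta_{i,j}$ with child $t'$, the graph $G_{t'}$ has no edge between a vertex of label $i$ and a vertex of label $j$; - (2) for each glue-node with children $t_1,t_2$, the graphs $G_{t_1}$ and $G_{t_2}$ are edge-disjoint; - (3) for each glue-node with children $t_1,t_2$, every glue-vertex has an incident edge in $G_{t_1}$ and an incident edge in $G_{t_2}$. **Theorem.** There are an algorithm, a polynomial $p$ and a constant $C$ such that the following holds. Let $k\in\mathbb N$ and let $\varphi$ be a fuse-$k$-expression of a graph $H$ with $n$ vertices and $m$ edges. Given $k$ and $\varphi$, the algorithm computes in time at most $p(|\varphi|+k)$ a reduced glue-$k$-expression $\zeta$ of $H$ whose parse tree has at most $C\,k^2(m+n)$ nodes. Moreover, $\zeta$ creates the same labeled graph as $\varphi$,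 up to label-preserving isomorphism. -/

import Mathlib

/-! ## Labeled graphs and the operations on them -/

/-- A `k`-labeled graph whose vertices are titles, taken from `ℕ`: a simple graph on a set of titles
(a subgraph of the complete graph on `ℕ`) with a label for each vertex. Only the values of `lab`
on the vertices of the graph are meaningful. -/
structure LGraph (k : ℕ) where
  graph : (⊤ : SimpleGraph ℕ).Subgraph
  lab : ℕ → Fin k

namespace LGraph

variable {k : ℕ}

/-- The vertices of `G` that have label `i`. -/
def labelClass (G : LGraph k) (i : Fin k) : Set ℕ :=
  {v | v ∈ G.graph.verts ∧ G.lab v = i}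

/-- A single vertex `v` with label `i`. -/
def single (v : ℕ) (i : Fin k) : LGraph k where
  graph := (⊤ : SimpleGraph ℕ).singletonSubgraph v
  lab := fun _ => i

open Classical in
/-- The union of two labeled graphs, which may share vertices. It interprets both the union-nodes
(on vertex-disjoint graphs) and the glue-nodes (on glueable graphs). -/
noncomputable def union (G₁ G₂ : LGraph k) : LGraph k where
  graph := G₁.graph ⊔ G₂.graph
  lab := fun v => if v ∈ G₁.graph.verts then G₁.lab v else G₂.lab v

/-- Add all edges between the vertices with label `i` and the vertices with label `j`. -/
def join (i j : Fin k) (G : LGraph k) : LGraph k where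
  graph :=
    { verts := G.graph.verts
      Adj := fun u v => G.graph.Adj u v ∨
        (u ≠ v ∧ ((u ∈ G.labelClass i ∧ v ∈ G.labelClass j) ∨
          (u ∈ G.labelClass j ∧ v ∈ G.labelClass i)))
      adj_sub := by
        rintro u v (h | ⟨h, -⟩)
        · exact G.graph.adj_sub h
        · exact h
      edge_vert := by
        rintro u v (h | ⟨-, ⟨h, -⟩ | ⟨h, -⟩⟩)
        · exact G.graph.edge_vert h
        · exact h.1
        · exact h.1
      symm := ⟨by
        rintro u v (h | ⟨h, ⟨h₁, h₂⟩ | ⟨h₁, h₂⟩⟩)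
        · exact Or.inl h.symm
        · exact Or.inr ⟨h.symm, Or.inr ⟨h₂, h₁⟩⟩
        · exact Or.inr ⟨h.symm, Or.inl ⟨h₂, h₁⟩⟩⟩ }
  lab := G.lab

/-- Replace the label `i` by the label `j`. -/
def relabel (i j : Fin k) (G : LGraph k) : LGraph k where
  graph := G.graph
  lab := fun v => if G.lab v = i then j else G.lab v

open Classical in
/-- The map that sends all vertices with label `i` to the vertex they are fused into. The name of
that vertex is immaterial; the least title among the fused vertices serves. -/
noncomputable def fuseMap (i : Fin k) (G : LGraph k) (v : ℕ) : ℕ :=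
  if v ∈ G.labelClass i then sInf (G.labelClass i) else v

/-- Fuse all vertices with label `i` into one vertex with label `i`, which becomes adjacent to
all outside neighbors of the fused vertices. -/
noncomputable def fuse (i : Fin k) (G : LGraph k) : LGraph k where
  graph :=
    { verts := G.fuseMap i '' G.graph.verts
      Adj := fun x y => x ≠ y ∧ ∃ u v, G.graph.Adj u v ∧ G.fuseMap i u = x ∧ G.fuseMap i v = y
      adj_sub := fun h => h.1
      edge_vert := by
        rintro x y ⟨-, u, v, h, hu, -⟩
        exact ⟨u, G.graph.edge_vert h, hu⟩
      symm := ⟨by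
        rintro x y ⟨hne, u, v, h, hu, hv⟩
        exact ⟨hne.symm, v, u, h.symm, hv, hu⟩⟩ }
  lab := G.lab

/-- Two labeled graphs are glueable if every shared vertex has the same label in both and is, in
each of them, the only vertex with that label. -/
def Glueable (G₁ G₂ : LGraph k) : Prop :=
  ∀ v ∈ G₁.graph.verts ∩ G₂.graph.verts,
    G₁.lab v = G₂.lab v ∧
    G₁.labelClass (G₁.lab v) = {v} ∧
    G₂.labelClass (G₂.lab v) = {v}

/-- Label-preserving isomorphism. -/
def Equivalent (G₁ G₂ : LGraph k) : Prop :=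
  ∃ e : G₁.graph.coe ≃g G₂.graph.coe, ∀ v, G₂.lab (e v) = G₁.lab v

end LGraph

/-! ## Fuse-expressions -/

/-- Parse trees of fuse-`k`-expressions; `intro v i` is the introduce-node with title `v` and
label `i`. -/
inductive FuseExpr (k : ℕ) : Type
  | intro (v : ℕ) (i : Fin k)
  | union (φ ψ : FuseExpr k)
  | join (i j : Fin k) (φ : FuseExpr k)
  | relabel (i j : Fin k) (φ : FuseExpr k)
  | fuse (i : Fin k) (φ : FuseExpr k)

namespace FuseExpr

variable {k : ℕ}

/-- The labeled graph arising in a fuse-expression. -/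
noncomputable def eval : FuseExpr k → LGraph k
  | intro v i => LGraph.single v i
  | union φ ψ => φ.eval.union ψ.eval
  | join i j φ => φ.eval.join i j
  | relabel i j φ => φ.eval.relabel i j
  | fuse i φ => φ.eval.fuse i

/-- Every operation is applied to arguments to which it may be applied. -/
def WellFormed : FuseExpr k → Prop
  | intro _ _ => True
  | union φ ψ => φ.WellFormed ∧ ψ.WellFormed ∧
      Disjoint φ.eval.graph.verts ψ.eval.graph.verts
  | join i j φ => φ.WellFormed ∧ i ≠ j
  | relabel i j φ => φ.WellFormed ∧ i ≠ j
  | fuse i φ => φ.WellFormed ∧ (φ.eval.labelClass i).Nonempty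

/-- The titles used in the introduce-nodes, with multiplicity. -/
def titles : FuseExpr k → List ℕ
  | intro v _ => [v]
  | union φ ψ => φ.titles ++ ψ.titles
  | join _ _ φ => φ.titles
  | relabel _ _ φ => φ.titles
  | fuse _ φ => φ.titles

/-- The size of a fuse-expression: the number of nodes of the parse tree plus the total length
of the titles in binary. -/
def size : FuseExpr k → ℕ
  | intro v _ => 1 + v.size
  | union φ ψ => 1 + φ.size + ψ.size
  | join _ _ φ => 1 + φ.size
  | relabel _ _ φ => 1 + φ.size
  | fuse _ φ => 1 + φ.size

/-- `φ` is a fuse-`k`-expression of the graph `H`. -/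
def IsExprOf {V : Type*} (φ : FuseExpr k) (H : SimpleGraph V) : Prop :=
  φ.WellFormed ∧ Nonempty (φ.eval.graph.coe ≃g H)

end FuseExpr

/-! ## Glue-expressions -/

/-- Parse trees of glue-`k`-expressions. -/
inductive GlueExpr (k : ℕ) : Type
  | intro (v : ℕ) (i : Fin k)
  | glue (ξ χ : GlueExpr k)
  | join (i j : Fin k) (ξ : GlueExpr k)
  | relabel (i j : Fin k) (ξ : GlueExpr k)

namespace GlueExpr

variable {k : ℕ}

/-- The labeled graph arising in a glue-expression. -/
noncomputable def eval : GlueExpr k → LGraph k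
  | intro v i => LGraph.single v i
  | glue ξ χ => ξ.eval.union χ.eval
  | join i j ξ => ξ.eval.join i j
  | relabel i j ξ => ξ.eval.relabel i j

/-- Every operation is applied to arguments to which it may be applied. -/
def WellFormed : GlueExpr k → Prop
  | intro _ _ => True
  | glue ξ χ => ξ.WellFormed ∧ χ.WellFormed ∧ ξ.eval.Glueable χ.eval
  | join i j ξ => ξ.WellFormed ∧ i ≠ j
  | relabel i j ξ => ξ.WellFormed ∧ i ≠ j

/-- No useless nodes: every join-node creates a new edge, and every relabel-node changes the label
of some vertex. -/
def NoUseless : GlueExpr k → Prop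
  | intro _ _ => True
  | glue ξ χ => ξ.NoUseless ∧ χ.NoUseless
  | join i j ξ => ξ.NoUseless ∧
      ∃ v ∈ ξ.eval.labelClass i, ∃ w ∈ ξ.eval.labelClass j, v ≠ w ∧ ¬ ξ.eval.graph.Adj v w
  | relabel i j ξ => ξ.NoUseless ∧ i ≠ j ∧ (ξ.eval.labelClass i).Nonempty

/-- A join-node is never applied to a graph with an edge between the two joined label classes. -/
def JoinsNew : GlueExpr k → Prop
  | intro _ _ => True
  | glue ξ χ => ξ.JoinsNew ∧ χ.JoinsNew
  | join i j ξ => ξ.JoinsNew ∧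
      ∀ v w, ξ.eval.graph.Adj v w → ¬ (ξ.eval.lab v = i ∧ ξ.eval.lab w = j)
  | relabel _ _ ξ => ξ.JoinsNew

/-- At every glue-node, the two glued graphs are edge-disjoint. -/
def GluesEdgeDisjoint : GlueExpr k → Prop
  | intro _ _ => True
  | glue ξ χ => ξ.GluesEdgeDisjoint ∧ χ.GluesEdgeDisjoint ∧
      Disjoint ξ.eval.graph.edgeSet χ.eval.graph.edgeSet
  | join _ _ ξ => ξ.GluesEdgeDisjoint
  | relabel _ _ ξ => ξ.GluesEdgeDisjoint

/-- At every glue-node, every glue-vertex has an incident edge in each of the two glued graphs. -/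
def GlueVerticesIncident : GlueExpr k → Prop
  | intro _ _ => True
  | glue ξ χ => ξ.GlueVerticesIncident ∧ χ.GlueVerticesIncident ∧
      ∀ v ∈ ξ.eval.graph.verts ∩ χ.eval.graph.verts,
        (∃ w, ξ.eval.graph.Adj v w) ∧ ∃ w, χ.eval.graph.Adj v w
  | join _ _ ξ => ξ.GlueVerticesIncident
  | relabel _ _ ξ => ξ.GlueVerticesIncident

/-- Reduced glue-expressions. -/
def Reduced (ξ : GlueExpr k) : Prop :=
  ξ.NoUseless ∧ ξ.JoinsNew ∧ ξ.GluesEdgeDisjoint ∧ ξ.GlueVerticesIncident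

/-- The number of nodes of the parse tree. -/
def nodes : GlueExpr k → ℕ
  | intro _ _ => 1
  | glue ξ χ => 1 + ξ.nodes + χ.nodes
  | join _ _ ξ => 1 + ξ.nodes
  | relabel _ _ ξ => 1 + ξ.nodes

/-- `ξ` is a glue-`k`-expression of the graph `H`. -/
def IsExprOf {V : Type*} (ξ : GlueExpr k) (H : SimpleGraph V) : Prop :=
  ξ.WellFormed ∧ Nonempty (ξ.eval.graph.coe ≃g H)

end GlueExpr

/-! ## The model of computation

Programs of the WHILE-language over binary trees, in its one-variable form. Every execution of a
construct costs one plus the size of the tree it is applied to, so that also copying is paid for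
and no tree larger than the time spent can be produced. A computation of cost `T` is simulated by a
Turing machine in time polynomial in `T` and conversely, so that polynomial time in this model
is polynomial time in the usual sense. -/

/-- Binary trees. -/
inductive BinTree : Type
  | nil
  | node (l r : BinTree)

namespace BinTree

/-- The number of nodes, including the leaves. -/
def size : BinTree → ℕ
  | nil => 1
  | node l r => 1 + l.size + r.size

/-- The left subtree (`nil` for `nil`). -/
def left : BinTree → BinTree
  | nil => nil
  | node l _ => l

/-- The right subtree (`nil` for `nil`). -/
def right : BinTree → BinTree
  | nil => nil
  | node _ r => r

/-- Unary encoding of natural numbers. -/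
def unary : ℕ → BinTree
  | 0 => nil
  | n + 1 => node nil (unary n)

/-- Encoding of words over `{0, 1}`. -/
def ofBits : List Bool → BinTree
  | [] => nil
  | b :: l => node (if b then node nil nil else nil) (ofBits l)

/-- Binary encoding of natural numbers, the least significant digit first. -/
def binary (n : ℕ) : BinTree := ofBits n.bits

end BinTree

/-- Programs; each denotes a partial function from trees to trees. -/
inductive Program : Type
  /-- `x ↦ x` -/
  | skip
  /-- `x ↦ nil` -/
  | nil
  /-- the left subtree -/
  | left
  /-- the right subtree -/
  | right
  /-- `x ↦ node (P x) (Q x)` -/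
  | pair (P Q : Program)
  /-- first `P`, then `Q` -/
  | seq (P Q : Program)
  /-- if `C x` is not `nil` then `P x` else `Q x` -/
  | cond (C P Q : Program)
  /-- while `C x` is not `nil`, replace `x` by `P x` -/
  | loop (C P : Program)

/-- `P.Runs x y t`: started on `x`, the program `P` halts with output `y`, at cost `t`. -/
inductive Program.Runs : Program → BinTree → BinTree → ℕ → Prop
  | skip (x : BinTree) : Runs .skip x x (1 + x.size)
  | nil (x : BinTree) : Runs .nil x .nil (1 + x.size)
  | left (x : BinTree) : Runs .left x x.left (1 + x.size)
  | right (x : BinTree) : Runs .right x x.right (1 + x.size)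
  | pair {P Q : Program} {x y z : BinTree} {s t : ℕ} :
      Runs P x y s → Runs Q x z t → Runs (.pair P Q) x (.node y z) (1 + x.size + s + t)
  | seq {P Q : Program} {x y z : BinTree} {s t : ℕ} :
      Runs P x y s → Runs Q y z t → Runs (.seq P Q) x z (1 + x.size + s + t)
  | cond_true {C P Q : Program} {x a b y : BinTree} {s t : ℕ} :
      Runs C x (.node a b) s → Runs P x y t → Runs (.cond C P Q) x y (1 + x.size + s + t)
  | cond_false {C P Q : Program} {x y : BinTree} {s t : ℕ} :
      Runs C x .nil s → Runs Q x y t → Runs (.cond C P Q) x y (1 + x.size + s + t)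
  | loop_stop {C P : Program} {x : BinTree} {s : ℕ} :
      Runs C x .nil s → Runs (.loop C P) x x (1 + x.size + s)
  | loop_step {C P : Program} {x a b y z : BinTree} {s t u : ℕ} :
      Runs C x (.node a b) s → Runs P x y t → Runs (.loop C P) y z u →
      Runs (.loop C P) x z (1 + x.size + s + t + u)

/-! ## Expressions as inputs and outputs of programs

A node is encoded as the pair of its kind and its data; titles are written in binary, labels and
`k` in unary. -/

/-- Encoding of fuse-expressions. -/
def FuseExpr.encode {k : ℕ} : FuseExpr k → BinTree
  | .intro v i => .node (.unary 0) (.node (.binary v) (.unary i))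
  | .union φ ψ => .node (.unary 1) (.node φ.encode ψ.encode)
  | .join i j φ => .node (.unary 2) (.node (.node (.unary i) (.unary j)) φ.encode)
  | .relabel i j φ => .node (.unary 3) (.node (.node (.unary i) (.unary j)) φ.encode)
  | .fuse i φ => .node (.unary 4) (.node (.unary i) φ.encode)

/-- Encoding of glue-expressions. -/
def GlueExpr.encode {k : ℕ} : GlueExpr k → BinTree
  | .intro v i => .node (.unary 0) (.node (.binary v) (.unary i))
  | .glue ξ χ => .node (.unary 1) (.node ξ.encode χ.encode)
  | .join i j ξ => .node (.unary 2) (.node (.node (.unary i) (.unary j)) ξ.encode)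
  | .relabel i j ξ => .node (.unary 3) (.node (.node (.unary i) (.unary j)) ξ.encode)

/-! ## Polynomial-time functions on trees -/

namespace BinTree

/-! Give every introduce-node the title of the vertex of the final graph into which it is eventually
fused. Copies of one vertex then have equal titles, fuse-nodes have nothing left to do, and labels
and edges of the final graph can be read off the expression as unions over its nodes
(`hasLab_rename`, `edge_rename`). Repeated titles are under control because copies can only be
identified by fusing a whole label class further up: a vertex that occurs on both sides of a union
shares its labels there with no other vertex, and a vertex carrying both labels of a relabel-node is
alone in both classes. This is `Good`, proved in `good_rename` from the distinctness of the original
titles.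

The reduced expression is then built from the root downwards. Each node receives a demand: the
vertices `X` and the edges `W` to be created below it, and a renaming `m` of the labels. At a union,
an edge available on both sides is demanded on the right only, and a vertex available on both sides
is demanded on both only if it has demanded edges on both; so the glued graphs are edge-disjoint and
glue-vertices have incident edges in each. At a join, the demanded edges that it can create are
removed from the demand below, and the join is dropped if there are none. A relabel-node survives
only if it merges two nonempty classes without a common vertex; otherwise its effect is absorbed by
`m`.

The invariant is `Part`. Saturation says that if `W` contains an edge between two label classes, it
contains all edges of the expression between them, so a surviving join creates exactly what is
demanded. The label conditions say that `m` gives each demanded vertex one label and that different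
vertices receive the same label only through the same original label. The cases are
`Realizes.join_of_exists`, `Realizes.relabel_merge` and `Realizes.glue`; `eval_reduceScheme`
assembles them.

The size bound needs no factor `k ^ 2`. Joins are at most `m`, since each creates a new edge and
glues are edge-disjoint. A vertex of degree `d` has at most `max 1 d` introduce-nodes, so there are
at most `n + 2 * m` leaves. Each surviving relabel lowers the number of labels in use, so relabels
are no more numerous than leaves. Altogether there are at most `7 * (m + n)` nodes.

Polynomial time comes from one simulation result, `Scheme.Efficient.polyTime`: a recursion with two
self-calls, polynomially many calls in all, and polynomially large arguments and results is executed
by a stack machine in polynomial time. The list operations and both phases of the construction are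
such recursions. -/

theorem size_pos (x : BinTree) : 1 ≤ x.size := by
  cases x <;> simp only [size] <;> omega

theorem size_left_le (x : BinTree) : x.left.size ≤ x.size := by
  cases x <;> simp only [size, left] <;> omega

theorem size_right_le (x : BinTree) : x.right.size ≤ x.size := by
  cases x <;> simp only [size, right] <;> omega

@[simp] theorem left_node (a b : BinTree) : (node a b).left = a := rfl
@[simp] theorem right_node (a b : BinTree) : (node a b).right = b := rfl
@[simp] theorem left_nil : nil.left = nil := rfl
@[simp] theorem right_nil : nil.right = nil := rfl
@[simp] theorem size_nil : nil.size = 1 := rfl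
@[simp] theorem size_node (a b : BinTree) : (node a b).size = 1 + a.size + b.size := rfl

/-- The conditional expression: `b` if `c` is `nil`, and `a` otherwise. -/
def ite (c a b : BinTree) : BinTree :=
  match c with
  | nil => b
  | node _ _ => a

@[simp] theorem ite_nil (a b : BinTree) : ite nil a b = b := rfl
@[simp] theorem ite_node (u v a b : BinTree) : ite (node u v) a b = a := rfl

theorem ite_of_ne {c : BinTree} (h : c ≠ nil) (a b : BinTree) : ite c a b = a := by
  cases c
  · exact absurd rfl h
  · rfl

end BinTree

open BinTree

theorem Polynomial.monotone_eval_nat (p : Polynomial ℕ) : Monotone fun n : ℕ => p.eval n := by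
  induction p using Polynomial.induction_on' with
  | add p q hp hq =>
    intro a b h
    simpa using Nat.add_le_add (hp h) (hq h)
  | monomial n c =>
    intro a b h
    simpa using Nat.mul_le_mul_left c (Nat.pow_le_pow_left h n)

namespace Program

/-- `P` maps `x` to `y` at cost at most `B`. -/
def RunsIn (P : Program) (x y : BinTree) (B : ℕ) : Prop :=
  ∃ t ≤ B, P.Runs x y t

/-- Every step is charged for the size of the tree it acts on, so time bounds are also output size
bounds. This is what makes polynomial bounds compose. -/
theorem Runs.size_le {P : Program} {x y : BinTree} {t : ℕ} (h : P.Runs x y t) : y.size ≤ t := by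
  induction h with
  | skip x => omega
  | nil x => simp only [size_nil]; omega
  | left x => have := x.size_left_le; omega
  | right x => have := x.size_right_le; omega
  | pair _ _ h₁ h₂ => simp only [size_node]; omega
  | seq _ _ h₁ h₂ => omega
  | cond_true _ _ h₁ h₂ => omega
  | cond_false _ _ h₁ h₂ => omega
  | loop_stop _ h => omega
  | loop_step _ _ _ h₁ h₂ h₃ => omega

theorem RunsIn.size_le {P : Program} {x y : BinTree} {B : ℕ} (h : P.RunsIn x y B) :
    y.size ≤ B := by
  obtain ⟨t, ht, h⟩ := h
  exact h.size_le.trans ht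

theorem RunsIn.mono {P : Program} {x y : BinTree} {B B' : ℕ} (h : P.RunsIn x y B) (hB : B ≤ B') :
    P.RunsIn x y B' := by
  obtain ⟨t, ht, h⟩ := h
  exact ⟨t, ht.trans hB, h⟩

theorem RunsIn.seq {P Q : Program} {x y z : BinTree} {s t : ℕ} (h₁ : P.RunsIn x y s)
    (h₂ : Q.RunsIn y z t) : (Program.seq P Q).RunsIn x z (1 + x.size + s + t) := by
  obtain ⟨a, ha, h₁⟩ := h₁
  obtain ⟨b, hb, h₂⟩ := h₂
  exact ⟨_, by omega, h₁.seq h₂⟩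

end Program

/-- `f` is computed by a program in polynomial time. -/
@[fun_prop] def PolyTime (f : BinTree → BinTree) : Prop :=
  ∃ (P : Program) (p : Polynomial ℕ), ∀ x, P.RunsIn x (f x) (p.eval x.size)

namespace PolyTime

theorem of_linear {f : BinTree → BinTree} (P : Program) (h : ∀ x, P.Runs x (f x) (1 + x.size)) :
    PolyTime f :=
  ⟨P, 1 + Polynomial.X, fun x => ⟨_, by simp, h x⟩⟩

@[fun_prop] theorem id : PolyTime fun x => x := of_linear .skip .skip

@[fun_prop] theorem comp {f g : BinTree → BinTree} (hf : PolyTime f) (hg : PolyTime g) :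
    PolyTime fun x => f (g x) := by
  obtain ⟨P, p, hP⟩ := hf
  obtain ⟨Q, q, hQ⟩ := hg
  refine ⟨.seq Q P, 1 + Polynomial.X + q + p.comp q, fun x => ?_⟩
  refine ((hQ x).seq (hP (g x))).mono ?_
  have := p.monotone_eval_nat (hQ x).size_le
  simp only [Polynomial.eval_add, Polynomial.eval_one, Polynomial.eval_X, Polynomial.eval_comp]
  simp only at this
  omega

@[fun_prop] theorem node {f g : BinTree → BinTree} (hf : PolyTime f) (hg : PolyTime g) :
    PolyTime fun x => BinTree.node (f x) (g x) := by
  obtain ⟨P, p, hP⟩ := hf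
  obtain ⟨Q, q, hQ⟩ := hg
  refine ⟨.pair P Q, 1 + Polynomial.X + p + q, fun x => ?_⟩
  obtain ⟨a, ha, h₁⟩ := hP x
  obtain ⟨b, hb, h₂⟩ := hQ x
  refine ⟨_, ?_, h₁.pair h₂⟩
  simp only [Polynomial.eval_add, Polynomial.eval_one, Polynomial.eval_X]
  omega

@[fun_prop] theorem const (c : BinTree) : PolyTime fun _ => c := by
  induction c with
  | nil => exact of_linear .nil .nil
  | node l r hl hr => exact hl.node hr

@[fun_prop] theorem left {f : BinTree → BinTree} (hf : PolyTime f) : PolyTime fun x => (f x).left :=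
  comp (of_linear .left .left) hf

@[fun_prop] theorem right {f : BinTree → BinTree} (hf : PolyTime f) :
    PolyTime fun x => (f x).right :=
  comp (of_linear .right .right) hf

@[fun_prop] theorem ite {c f g : BinTree → BinTree} (hc : PolyTime c) (hf : PolyTime f)
    (hg : PolyTime g) : PolyTime fun x => BinTree.ite (c x) (f x) (g x) := by
  obtain ⟨R, r, hR⟩ := hc
  obtain ⟨P, p, hP⟩ := hf
  obtain ⟨Q, q, hQ⟩ := hg
  refine ⟨.cond R P Q, 1 + Polynomial.X + r + p + q, fun x => ?_⟩
  obtain ⟨a, ha, h₀⟩ := hR x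
  obtain ⟨b, hb, h₁⟩ := hP x
  obtain ⟨d, hd, h₂⟩ := hQ x
  simp only [Polynomial.eval_add, Polynomial.eval_one, Polynomial.eval_X]
  cases hx : c x with
  | nil =>
    rw [hx] at h₀
    exact ⟨_, by omega, h₀.cond_false h₂⟩
  | node u v =>
    rw [hx] at h₀
    exact ⟨_, by omega, h₀.cond_true h₁⟩

/-- A function of two arguments is applied to two polynomial-time functions. -/
theorem comp₂ {h : BinTree → BinTree → BinTree} {f g : BinTree → BinTree}
    (hh : PolyTime fun x => h x.left x.right) (hf : PolyTime f) (hg : PolyTime g) :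
    PolyTime fun x => h (f x) (g x) :=
  comp hh (hf.node hg)

theorem comp₃ {h : BinTree → BinTree → BinTree → BinTree} {f g e : BinTree → BinTree}
    (hh : PolyTime fun x => h x.left x.right.left x.right.right) (hf : PolyTime f)
    (hg : PolyTime g) (he : PolyTime e) : PolyTime fun x => h (f x) (g x) (e x) :=
  comp hh (hf.node (hg.node he))

end PolyTime


/-! ## Recursion -/

/-- A recursion scheme: on arguments on which `halt` is `nil`, the function calls itself on `fst`
and on `snd` and combines the results; on other arguments it returns `val`. -/
structure Scheme where
  halt : BinTree → BinTree
  val : BinTree → BinTree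
  fst : BinTree → BinTree
  snd : BinTree → BinTree
  comb : BinTree → BinTree → BinTree → BinTree

namespace Scheme

/-- `A.Eval M x r n`: the recursion started on `x` returns `r` after `n` calls; all arguments
and all results have size at most `M`. -/
inductive Eval (A : Scheme) (M : ℕ) : BinTree → BinTree → ℕ → Prop
  | halt {x : BinTree} : A.halt x ≠ nil → x.size ≤ M → (A.val x).size ≤ M → Eval A M x (A.val x) 1
  | call {x r₁ r₂ : BinTree} {n₁ n₂ : ℕ} : A.halt x = nil → x.size ≤ M →
      Eval A M (A.fst x) r₁ n₁ → Eval A M (A.snd x) r₂ n₂ → (A.comb x r₁ r₂).size ≤ M →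
      Eval A M x (A.comb x r₁ r₂) (1 + n₁ + n₂)

theorem Eval.bounds {A : Scheme} {M : ℕ} {x r : BinTree} {n : ℕ} (h : A.Eval M x r n) :
    x.size ≤ M ∧ r.size ≤ M := by
  cases h <;> constructor <;> assumption

/-- The functions of the scheme are computable in polynomial time. -/
structure Efficient (A : Scheme) : Prop where
  halt : PolyTime A.halt
  val : PolyTime A.val
  fst : PolyTime A.fst
  snd : PolyTime A.snd
  comb : PolyTime fun x => A.comb x.left x.right.left x.right.right

/-- One step of the stack machine that executes the recursion. A state is a pair of a stack of
tasks (calls, and combinations of results) and a stack of results. -/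
def step (A : Scheme) (s : BinTree) : BinTree :=
  BinTree.ite s.left.left.left
    (node s.left.right
      (node (A.comb s.left.left.right s.right.right.left s.right.left) s.right.right.right))
    (BinTree.ite (A.halt s.left.left.right)
      (node s.left.right (node (A.val s.left.left.right) s.right))
      (node (node (node nil (A.fst s.left.left.right))
        (node (node nil (A.snd s.left.left.right))
          (node (node (node nil nil) s.left.left.right) s.left.right))) s.right))

theorem Efficient.step {A : Scheme} (hA : A.Efficient) : PolyTime A.step := by
  have h₁ := hA.halt
  have h₂ := hA.val
  have h₃ := hA.fst
  have h₄ := hA.snd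
  have h₅ : PolyTime fun s : BinTree =>
      A.comb s.left.left.right s.right.right.left s.right.left :=
    PolyTime.comp₃ hA.comb (by fun_prop) (by fun_prop) (by fun_prop)
  unfold Scheme.step
  fun_prop

/-- The `step` function is iterated until the task stack is empty. The bound depends only on the
number of calls and on the sizes met, so it also serves for inputs on which the recursion is
analysed only under extra hypotheses. -/
theorem Efficient.runs {A : Scheme} (hA : A.Efficient) :
    ∃ (P : Program) (q : Polynomial ℕ), ∀ M x r n, A.Eval M x r n →
      P.RunsIn x r (q.eval (M + n)) := by
  obtain ⟨S, p, hS⟩ := hA.step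
  obtain ⟨I, pI, hI⟩ : PolyTime fun x => node (node (node nil x) nil) nil := by fun_prop
  obtain ⟨O, pO, hO⟩ : PolyTime fun x => x.right.left := by fun_prop
  set L := Program.loop .left S with hL
  -- Cost of one iteration on a state of size at most `s`: the loop itself, the test `.left`, and
  -- one `step`.
  let q : ℕ → ℕ := fun s => 2 + 2 * s + p.eval s
  have hstep : ∀ (a T V z : BinTree) (B u : ℕ), (node (node a T) V).size ≤ B →
      L.RunsIn (A.step (node (node a T) V)) z u →
      L.RunsIn (node (node a T) V) z (u + q B) := by
    intro a T V z B u hB ⟨t, ht, h⟩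
    obtain ⟨t', ht', h'⟩ := hS (node (node a T) V)
    refine ⟨_, ?_, Program.Runs.loop_step (Program.Runs.left _) h' h⟩
    have := p.monotone_eval_nat hB
    simp only [q] at this ⊢
    omega
  -- Continuation form: if the machine finishes once `r` is on the result stack, it also finishes
  -- from the state with the call of `x` still pending. Each call costs at most two iterations
  -- (expanding and combining), and `3 * M + 15` leaves room for the three tasks it pushes.
  have key : ∀ M x r n, A.Eval M x r n → ∀ (T V z : BinTree) (B u : ℕ),
      T.size + V.size + n * (3 * M + 15) ≤ B → L.RunsIn (node T (node r V)) z u →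
      L.RunsIn (node (node (node nil x) T) V) z (u + 2 * n * q B) := by
    intro M x r n h
    induction h with
    | @halt x h₁ h₂ h₃ =>
      intro T V z B u hB hu
      refine (hstep (node nil x) T V z B u ?_ ?_).mono (by nlinarith)
      · simp only [size_node, size_nil]; omega
      · simpa only [Scheme.step, left_node, right_node, ite_nil, ite_of_ne h₁] using hu
    | @call x r₁ r₂ n₁ n₂ h₁ h₂ e₁ e₂ h₃ ih₁ ih₂ =>
      intro T V z B u hB hu
      have b₁ := e₁.bounds
      have b₂ := e₂.bounds
      have hM : (1 + n₁ + n₂) * (3 * M + 15) =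
        (3 * M + 15) + n₁ * (3 * M + 15) + n₂ * (3 * M + 15) := by ring
      -- The execution is assembled backwards: the combination, then the second call, then the
      -- first. Hence `r₂` lies above `r₁` on the result stack.
      have c₁ : L.RunsIn (node (node (node (node nil nil) x) T) (node r₂ (node r₁ V))) z
          (u + q B) := by
        refine hstep (node (node nil nil) x) T _ z B u ?_ ?_
        · simp only [size_node, size_nil]; omega
        · simpa only [Scheme.step, left_node, right_node, ite_node] using hu
      have c₂ := ih₂ (node (node (node nil nil) x) T) (node r₁ V) z B _
        (by simp only [size_node, size_nil]; omega) c₁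
      have c₃ := ih₁ (node (node nil (A.snd x)) (node (node (node nil nil) x) T)) V z B _
        (by simp only [size_node, size_nil]; omega) c₂
      refine (hstep (node nil x) T V z B (u + q B + 2 * n₂ * q B + 2 * n₁ * q B) ?_ ?_).mono ?_
      · simp only [size_node, size_nil]; omega
      · simpa only [Scheme.step, left_node, right_node, ite_nil, h₁] using c₃
      · nlinarith
  let bd : Polynomial ℕ := 2 + Polynomial.X * (3 * Polynomial.X + 15)
  let Q : Polynomial ℕ := 2 + 2 * Polynomial.X + p
  refine ⟨.seq I (.seq L O), 20 + 20 * Polynomial.X + pI + pO.comp (10 + Polynomial.X) +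
    2 * Polynomial.X * Q.comp bd, fun M x r n h => ?_⟩
  have b := h.bounds
  have hfin : L.RunsIn (node nil (node r nil)) (node nil (node r nil))
      (2 + 2 * (4 + M)) := by
    refine ⟨_, ?_, Program.Runs.loop_stop (Program.Runs.left _)⟩
    simp only [size_node, size_nil]
    omega
  have hB : nil.size + nil.size + n * (3 * M + 15) ≤ bd.eval (M + n) := by
    simp only [bd, size_nil, Polynomial.eval_add, Polynomial.eval_mul, Polynomial.eval_X,
      Polynomial.eval_ofNat]
    nlinarith
  have hrun := key M x r n h nil nil _ (bd.eval (M + n)) _ hB hfin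
  refine ((hI x).seq (hrun.seq (hO _))).mono ?_
  have m₁ := pI.monotone_eval_nat (show x.size ≤ M + n by omega)
  have m₂ := pO.monotone_eval_nat
    (show (node nil (node r nil)).size ≤ 10 + (M + n) by simp only [size_node, size_nil]; omega)
  have m₃ : 2 * n * q (bd.eval (M + n)) ≤ 2 * (M + n) * q (bd.eval (M + n)) := by
    gcongr; omega
  have hQ : (Q.comp bd).eval (M + n) = q (bd.eval (M + n)) := by
    simp only [Q, q, Polynomial.eval_comp, Polynomial.eval_add, Polynomial.eval_mul,
      Polynomial.eval_X, Polynomial.eval_ofNat]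
  simp only [Polynomial.eval_add, Polynomial.eval_mul, hQ, Polynomial.eval_X,
    Polynomial.eval_ofNat, size_node, size_nil] at m₁ m₂ m₃ ⊢
  rw [Polynomial.eval_comp]
  simp only [Polynomial.eval_add, Polynomial.eval_X, Polynomial.eval_ofNat] at m₂ ⊢
  omega

/-- A function given by a recursion with polynomially many calls on arguments of polynomial
size is computable in polynomial time. -/
theorem Efficient.polyTime {A : Scheme} (hA : A.Efficient) {f : BinTree → BinTree}
    (M N : Polynomial ℕ)
    (h : ∀ x, ∃ n ≤ N.eval x.size, A.Eval (M.eval x.size) x (f x) n) : PolyTime f := by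
  obtain ⟨P, q, hP⟩ := hA.runs
  refine ⟨P, q.comp (M + N), fun x => ?_⟩
  obtain ⟨n, hn, hx⟩ := h x
  refine (hP _ _ _ _ hx).mono ?_
  rw [Polynomial.eval_comp, Polynomial.eval_add]
  exact q.monotone_eval_nat (by omega)

end Scheme

/-! ### Recursions with two arguments -/

namespace Scheme

/-- The input is first replaced by the pair of its halves, because the recursion is only analysed on
arguments of the form `node a b`; the input `nil` thereby becomes `node nil nil`. -/
theorem Efficient.polyTime₂ {A : Scheme} (hA : A.Efficient) {f : BinTree → BinTree → BinTree}
    (M N : Polynomial ℕ)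
    (h : ∀ a b : BinTree, ∃ n ≤ N.eval (a.size + b.size),
      A.Eval (M.eval (a.size + b.size)) (node a b) (f a b) n) :
    PolyTime fun x => f x.left x.right := by
  obtain ⟨P, q, hP⟩ := hA.runs
  have hf : PolyTime fun x => node x.left x.right := by fun_prop
  obtain ⟨Q, r, hQ⟩ := hf
  let S : Polynomial ℕ := 2 * Polynomial.X
  refine ⟨.seq Q P, 1 + Polynomial.X + r + q.comp ((M + N).comp S), fun x => ?_⟩
  obtain ⟨n, hn, hx⟩ := h x.left x.right
  refine ((hQ x).seq (hP _ _ _ _ hx)).mono ?_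
  have hs : x.left.size + x.right.size ≤ 2 * x.size := by
    have := x.size_left_le
    have := x.size_right_le
    omega
  have m₁ := M.monotone_eval_nat hs
  have m₂ := N.monotone_eval_nat hs
  have m₃ := q.monotone_eval_nat (show M.eval (x.left.size + x.right.size) + n ≤
    M.eval (2 * x.size) + N.eval (2 * x.size) by simp only at m₁ m₂; omega)
  simp only [S, Polynomial.eval_comp, Polynomial.eval_add, Polynomial.eval_mul,
    Polynomial.eval_X, Polynomial.eval_one, Polynomial.eval_ofNat] at m₃ ⊢
  omega

theorem Eval.halt_eq {A : Scheme} {M : ℕ} {x r : BinTree} (h : A.halt x ≠ nil) (hr : A.val x = r)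
    (hx : x.size ≤ M) (hs : r.size ≤ M) : A.Eval M x r 1 := by
  subst hr
  exact .halt h hx hs

theorem Eval.call_eq {A : Scheme} {M : ℕ} {x y₁ y₂ r₁ r₂ r : BinTree} {n₁ n₂ : ℕ}
    (h : A.halt x = nil) (h₁ : A.fst x = y₁) (h₂ : A.snd x = y₂) (hr : A.comb x r₁ r₂ = r)
    (hx : x.size ≤ M) (hs : r.size ≤ M) (e₁ : A.Eval M y₁ r₁ n₁) (e₂ : A.Eval M y₂ r₂ n₂) :
    A.Eval M x r (1 + n₁ + n₂) := by
  subst hr h₁ h₂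
  exact .call h hx e₁ e₂ hs

end Scheme

theorem PolyTime.size_le {f : BinTree → BinTree} (hf : PolyTime f) :
    ∃ p : Polynomial ℕ, ∀ x, (f x).size ≤ p.eval x.size := by
  obtain ⟨P, p, hP⟩ := hf
  exact ⟨p, fun x => (hP x).size_le⟩

/-! ## Lists and tests -/

namespace BinTree

/-- The entries of a list, which is encoded along the right spine. -/
def toList : BinTree → List BinTree
  | nil => []
  | node a l => a :: l.toList

/-- The encoding of a list. -/
def ofList : List BinTree → BinTree
  | [] => nil
  | a :: l => node a (ofList l)

@[simp] theorem toList_nil : toList nil = [] := rfl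
@[simp] theorem toList_node (a l : BinTree) : toList (node a l) = a :: l.toList := rfl

@[simp] theorem toList_ofList (l : List BinTree) : (ofList l).toList = l := by
  induction l with
  | nil => rfl
  | cons a l ih => simp [ofList, ih]

@[simp] theorem ofList_toList (t : BinTree) : ofList t.toList = t := by
  induction t with
  | nil => rfl
  | node a l _ ih => simp [ofList, ih]

theorem toList_injective : Function.Injective toList :=
  Function.LeftInverse.injective ofList_toList

theorem size_ofList (l : List BinTree) : (ofList l).size = 1 + (l.map fun a => 1 + a.size).sum := by
  induction l with
  | nil => rfl
  | cons a l ih => simp only [ofList, size_node, ih, List.map_cons, List.sum_cons]; omega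

theorem size_ofList_le {l : List BinTree} {K : ℕ} (h : ∀ a ∈ l, a.size ≤ K) :
    (ofList l).size ≤ 1 + l.length * (1 + K) := by
  rw [size_ofList]
  have := List.sum_le_card_nsmul (l.map fun a => 1 + a.size) (1 + K) (by
    simp only [List.mem_map, forall_exists_index, and_imp, forall_apply_eq_imp_iff₂]
    intro a ha
    have := h a ha
    omega)
  simpa using this

theorem size_le_of_mem {a t : BinTree} (h : a ∈ t.toList) : a.size ≤ t.size := by
  induction t with
  | nil => simp at h
  | node b l _ ih =>
    simp only [toList_node, List.mem_cons] at h
    simp only [size_node]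
    rcases h with rfl | h
    · omega
    · have := ih h; omega

/-- The truth value "true"; the truth value "false" is `nil`. -/
def tru : BinTree := node nil nil

@[simp] theorem tru_ne_nil : tru ≠ nil := by simp [tru]

@[simp] theorem size_tru : tru.size = 3 := rfl

theorem ite_eq_of_iff {c : BinTree} {p : Prop} [Decidable p] (h : c ≠ nil ↔ p) (a b : BinTree) :
    ite c a b = if p then a else b := by
  split_ifs with hp
  · exact ite_of_ne (h.2 hp) a b
  · rw [not_ne_iff.1 (mt h.1 hp), ite_nil]

/-- Negation. -/
def testNot (a : BinTree) : BinTree := ite a nil tru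

/-- Conjunction. -/
def testAnd (a b : BinTree) : BinTree := ite a b nil

/-- Disjunction. -/
def testOr (a b : BinTree) : BinTree := ite a tru b

/-- Equality of trees. -/
def testEq : BinTree → BinTree → BinTree
  | nil, b => ite b nil tru
  | node a₁ a₂, b => ite b (testAnd (testEq a₁ b.left) (testEq a₂ b.right)) nil

@[simp] theorem testNot_ne {a : BinTree} : testNot a ≠ nil ↔ a = nil := by
  cases a <;> simp [testNot]

@[simp] theorem testNot_eq {a : BinTree} : testNot a = nil ↔ a ≠ nil := by
  cases a <;> simp [testNot]

@[simp] theorem testAnd_ne {a b : BinTree} : testAnd a b ≠ nil ↔ a ≠ nil ∧ b ≠ nil := by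
  cases a <;> simp [testAnd]

@[simp] theorem testAnd_eq {a b : BinTree} : testAnd a b = nil ↔ (a ≠ nil → b = nil) := by
  cases a <;> simp [testAnd]

@[simp] theorem testOr_ne {a b : BinTree} : testOr a b ≠ nil ↔ a ≠ nil ∨ b ≠ nil := by
  cases a <;> simp [testOr]

@[simp] theorem testEq_ne {a b : BinTree} : testEq a b ≠ nil ↔ a = b := by
  induction a generalizing b with
  | nil => cases b <;> simp [testEq]
  | node a₁ a₂ h₁ h₂ => cases b <;> simp [testEq, h₁, h₂]

@[simp] theorem testEq_eq {a b : BinTree} : testEq a b = nil ↔ a ≠ b := by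
  rw [← not_iff_not, not_ne_iff]
  exact testEq_ne

theorem size_testEq_le (a b : BinTree) : (testEq a b).size ≤ 3 := by
  induction a generalizing b with
  | nil => cases b <;> simp [testEq]
  | node a₁ a₂ h₁ h₂ =>
    cases b with
    | nil => simp [testEq]
    | node b₁ b₂ =>
      simp only [testEq, ite_node, left_node, right_node, testAnd]
      cases testEq a₁ b₁ with
      | nil => simp
      | node u v => exact h₂ b₂

/-- Concatenation of lists. -/
def append : BinTree → BinTree → BinTree
  | nil, m => m
  | node a l, m => node a (append l m)

/-- The concatenation of the lists `h a` for the entries `a` of a list. -/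
def flatMap (h : BinTree → BinTree) : BinTree → BinTree
  | nil => nil
  | node a l => append (h a) (flatMap h l)

/-- The image of a list. -/
def map (h : BinTree → BinTree) (l : BinTree) : BinTree := flatMap (fun a => node (h a) nil) l

/-- The entries of a list that pass a test. -/
def filter (h : BinTree → BinTree) (l : BinTree) : BinTree :=
  flatMap (fun a => ite (h a) (node a nil) nil) l

/-- Membership in a list. -/
def testMem (a l : BinTree) : BinTree := filter (fun b => testEq a b) l

@[simp] theorem toList_append (l m : BinTree) : (append l m).toList = l.toList ++ m.toList := by
  induction l with
  | nil => rfl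
  | node a l _ ih => simp [append, ih]

@[simp] theorem toList_flatMap (h : BinTree → BinTree) (l : BinTree) :
    (flatMap h l).toList = l.toList.flatMap fun a => (h a).toList := by
  induction l with
  | nil => rfl
  | node a l _ ih => simp [flatMap, ih]

@[simp] theorem toList_map (h : BinTree → BinTree) (l : BinTree) :
    (map h l).toList = l.toList.map h := by
  simp only [map, toList_flatMap, toList_node, toList_nil]
  induction l.toList <;> simp_all

@[simp] theorem mem_filter {h : BinTree → BinTree} {a l : BinTree} :
    a ∈ (filter h l).toList ↔ a ∈ l.toList ∧ h a ≠ nil := by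
  simp only [filter, toList_flatMap, List.mem_flatMap]
  constructor
  · rintro ⟨b, hb, hab⟩
    cases hh : h b with
    | nil => simp [hh] at hab
    | node u v => simp only [hh, ite_node, toList_node, toList_nil, List.mem_singleton] at hab
                  subst hab; simp [hb, hh]
  · rintro ⟨ha, hh⟩
    exact ⟨a, ha, by simp [ite_of_ne hh]⟩

theorem eq_nil_iff {l : BinTree} : l = nil ↔ ∀ a, a ∉ l.toList := by
  cases l with
  | nil => simp
  | node a l => simp only [reduceCtorEq, toList_node, List.mem_cons, false_iff]; push Not
                exact ⟨a, Or.inl rfl⟩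

theorem ne_nil_iff {l : BinTree} : l ≠ nil ↔ ∃ a, a ∈ l.toList := by
  rw [Ne, eq_nil_iff]; push Not; rfl

theorem filter_ne {h : BinTree → BinTree} {l : BinTree} :
    filter h l ≠ nil ↔ ∃ a ∈ l.toList, h a ≠ nil := by
  simp [ne_nil_iff]

theorem filter_eq {h : BinTree → BinTree} {l : BinTree} :
    filter h l = nil ↔ ∀ a ∈ l.toList, h a = nil := by
  simp [eq_nil_iff]

@[simp] theorem testMem_ne {a l : BinTree} : testMem a l ≠ nil ↔ a ∈ l.toList := by
  simp [testMem, filter_ne]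

@[simp] theorem testMem_eq {a l : BinTree} : testMem a l = nil ↔ a ∉ l.toList := by
  rw [← not_iff_not, not_not]
  exact testMem_ne

theorem left_mem_toList {l : BinTree} (h : l ≠ nil) : l.left ∈ l.toList := by
  cases l with
  | nil => exact absurd rfl h
  | node a l => simp

theorem size_append_le (l m : BinTree) : (append l m).size ≤ l.size + m.size := by
  induction l with
  | nil => simp [append]
  | node a l _ ih => simp only [append, size_node]; omega

theorem size_filter_le (h : BinTree → BinTree) (l : BinTree) : (filter h l).size ≤ l.size := by
  induction l with
  | nil => simp [filter, flatMap]
  | node a l _ ih =>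
    simp only [filter, flatMap, size_node] at ih ⊢
    cases h a with
    | nil => simp only [ite_nil, append]; omega
    | node u v => simp only [ite_node, append, size_node]; omega

theorem size_flatMap_le {h : BinTree → BinTree} {l : BinTree} {K : ℕ}
    (hK : ∀ a ∈ l.toList, (h a).size ≤ K) : (flatMap h l).size ≤ 1 + l.size * K := by
  induction l with
  | nil => simp [flatMap]
  | node a l _ ih =>
    simp only [toList_node, List.mem_cons, forall_eq_or_imp] at hK
    have h₁ := size_append_le (h a) (flatMap h l)
    have h₂ := ih hK.2
    have h₃ := hK.1
    simp only [flatMap, size_node]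
    nlinarith

end BinTree

namespace PolyTime

@[fun_prop] theorem testNot {f : BinTree → BinTree} (hf : PolyTime f) :
    PolyTime fun x => BinTree.testNot (f x) := by
  unfold BinTree.testNot
  fun_prop

@[fun_prop] theorem testAnd {f g : BinTree → BinTree} (hf : PolyTime f) (hg : PolyTime g) :
    PolyTime fun x => BinTree.testAnd (f x) (g x) := by
  unfold BinTree.testAnd
  fun_prop

@[fun_prop] theorem testOr {f g : BinTree → BinTree} (hf : PolyTime f) (hg : PolyTime g) :
    PolyTime fun x => BinTree.testOr (f x) (g x) := by
  unfold BinTree.testOr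
  fun_prop

@[fun_prop] theorem testEq {f g : BinTree → BinTree} (hf : PolyTime f) (hg : PolyTime g) :
    PolyTime fun x => BinTree.testEq (f x) (g x) := by
  refine comp₂ ?_ hf hg
  let A : Scheme :=
    { halt := fun x => BinTree.ite x.left (BinTree.ite x.right nil tru) tru
      val := fun x => BinTree.ite x.left nil (BinTree.ite x.right nil tru)
      fst := fun x => .node x.left.left x.right.left
      snd := fun x => .node x.left.right x.right.right
      comb := fun _ r₁ r₂ => BinTree.testAnd r₁ r₂ }
  have hA : A.Efficient := by constructor <;> simp only [A] <;> fun_prop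
  refine hA.polyTime₂ (3 + Polynomial.X) Polynomial.X fun a b => ?_
  simp only [Polynomial.eval_add, Polynomial.eval_X, Polynomial.eval_ofNat]
  suffices ∀ M, 3 + (a.size + b.size) ≤ M → ∃ n ≤ a.size,
      A.Eval M (.node a b) (BinTree.testEq a b) n by
    obtain ⟨n, hn, h⟩ := this _ le_rfl
    exact ⟨n, by omega, h⟩
  intro M hM
  induction a generalizing b with
  | nil =>
    refine ⟨1, size_pos _, .halt_eq (by simp [A]) (by simp [A, BinTree.testEq]) ?_ ?_⟩
    · simp only [size_node]; omega
    · have := size_testEq_le .nil b; omega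
  | node a₁ a₂ h₁ h₂ =>
    cases b with
    | nil =>
      refine ⟨1, size_pos _, .halt_eq (by simp [A]) (by simp [A, BinTree.testEq]) ?_ ?_⟩
      · simp only [size_node, size_nil] at hM ⊢; omega
      · have := size_testEq_le (.node a₁ a₂) .nil; omega
    | node b₁ b₂ =>
      simp only [size_node] at hM
      obtain ⟨n₁, l₁, e₁⟩ := h₁ b₁ (by omega)
      obtain ⟨n₂, l₂, e₂⟩ := h₂ b₂ (by omega)
      refine ⟨1 + n₁ + n₂, by simp only [size_node]; omega,
        .call_eq (by simp [A]) rfl rfl (by simp [A, BinTree.testEq]) ?_ ?_ e₁ e₂⟩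
      · simp only [size_node]; omega
      · have := size_testEq_le (.node a₁ a₂) (.node b₁ b₂); omega

@[fun_prop] theorem append {f g : BinTree → BinTree} (hf : PolyTime f) (hg : PolyTime g) :
    PolyTime fun x => BinTree.append (f x) (g x) := by
  refine comp₂ ?_ hf hg
  let A : Scheme :=
    { halt := fun x => BinTree.ite x.left .nil tru
      val := fun x => x.right
      fst := fun _ => .nil
      snd := fun x => .node x.left.right x.right
      comb := fun x _ r₂ => .node x.left.left r₂ }
  have hA : A.Efficient := by constructor <;> simp only [A] <;> fun_prop
  refine hA.polyTime₂ (1 + Polynomial.X) (2 * Polynomial.X) fun a b => ?_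
  simp only [Polynomial.eval_add, Polynomial.eval_X, Polynomial.eval_ofNat, Polynomial.eval_mul,
    Polynomial.eval_one]
  suffices ∀ M, 1 + (a.size + b.size) ≤ M → ∃ n ≤ 2 * a.size,
      A.Eval M (.node a b) (BinTree.append a b) n by
    obtain ⟨n, hn, h⟩ := this _ le_rfl
    exact ⟨n, by omega, h⟩
  intro M hM
  induction a with
  | nil =>
    refine ⟨1, by simp, .halt_eq (by simp [A]) (by simp [A, BinTree.append]) ?_ ?_⟩
    · simp only [size_node]; omega
    · simp only [BinTree.append]; omega
  | node u a _ ih =>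
    have hs := size_append_le (.node u a) b
    simp only [size_node] at hM hs
    obtain ⟨n, l, e⟩ := ih (by omega)
    have e₀ : A.Eval M .nil .nil 1 :=
      .halt_eq (by simp [A]) (by simp [A]) (by simp; omega) (by simp; omega)
    refine ⟨1 + 1 + n, by simp only [size_node]; have := size_pos u; omega,
      .call_eq (by simp [A]) rfl rfl (by simp [A, BinTree.append]) ?_ (by omega) e₀ e⟩
    simp only [size_node]; omega

-- The function applied to the entries may depend on the whole input `x`. The recursion therefore
-- carries a context `c` unchanged along the list.
@[fun_prop] theorem flatMap {h : BinTree → BinTree → BinTree} {l : BinTree → BinTree}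
    (hh : PolyTime fun p => h p.left p.right) (hl : PolyTime l) :
    PolyTime fun x => BinTree.flatMap (fun a => h x a) (l x) := by
  refine comp₂ (h := fun c l => BinTree.flatMap (fun a => h c a) l) ?_ id hl
  let A : Scheme :=
    { halt := fun x => BinTree.ite x.right .nil tru
      val := fun _ => .nil
      fst := fun _ => .nil
      snd := fun x => .node x.left x.right.right
      comb := fun x _ r₂ => BinTree.append (h x.left x.right.left) r₂ }
  have hh' : PolyTime fun x : BinTree => h x.left.left x.left.right.left :=
    comp₂ hh (by fun_prop) (by fun_prop)
  have hA : A.Efficient :=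
    ⟨by simp only [A]; fun_prop, const _, const _, by simp only [A]; fun_prop,
      hh'.append (by fun_prop)⟩
  obtain ⟨p, hp⟩ := hh.size_le
  refine hA.polyTime₂ (f := fun c l => BinTree.flatMap (fun a => h c a) l)
    (2 + Polynomial.X + Polynomial.X * p.comp (1 + Polynomial.X))
    (2 * Polynomial.X) fun c l => ?_
  simp only [Polynomial.eval_add, Polynomial.eval_X, Polynomial.eval_ofNat, Polynomial.eval_mul,
    Polynomial.eval_one, Polynomial.eval_comp]
  have hK : ∀ a ∈ l.toList, (h c a).size ≤ p.eval (1 + (c.size + l.size)) := fun a ha => by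
    refine (hp (.node c a)).trans (p.monotone_eval_nat ?_)
    have := size_le_of_mem ha
    simp only [size_node]
    omega
  -- The bound for the entries is frozen at the full list, so that it survives the induction over
  -- the tails.
  generalize p.eval (1 + (c.size + l.size)) = K at hK
  suffices ∀ M, 2 + (c.size + l.size) + (c.size + l.size) * K ≤ M → ∃ n ≤ 2 * l.size,
      A.Eval M (.node c l) (BinTree.flatMap (fun a => h c a) l) n by
    obtain ⟨n, hn, h⟩ := this _ le_rfl
    exact ⟨n, by omega, h⟩
  intro M hM
  induction l with
  | nil =>
    refine ⟨1, by simp, .halt_eq (by simp [A]) (by simp [A, BinTree.flatMap]) ?_ ?_⟩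
    · simp only [size_node]; omega
    · simp only [BinTree.flatMap, size_nil]; omega
  | node u a _ ih =>
    have hs := size_flatMap_le (h := fun a => h c a) hK
    have hcK : (BinTree.node u a).size * K ≤ (c.size + (BinTree.node u a).size) * K := by gcongr; omega
    simp only [size_node] at hM hs hcK
    simp only [toList_node, List.mem_cons, forall_eq_or_imp] at hK
    obtain ⟨n, l, e⟩ := ih hK.2 (by nlinarith)
    have e₀ : A.Eval M .nil .nil 1 :=
      .halt_eq (by simp [A]) (by simp [A]) (by simp; omega) (by simp; omega)
    refine ⟨1 + 1 + n, by simp only [size_node]; have := size_pos u; omega,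
      .call_eq (by simp [A]) rfl rfl (by simp [A, BinTree.flatMap]) ?_ (by omega) e₀ e⟩
    simp only [size_node]; omega

@[fun_prop] theorem map {h : BinTree → BinTree → BinTree} {l : BinTree → BinTree}
    (hh : PolyTime fun p => h p.left p.right) (hl : PolyTime l) :
    PolyTime fun x => BinTree.map (fun a => h x a) (l x) := by
  exact flatMap (h := fun x a => .node (h x a) .nil) (hh.node (const _)) hl

@[fun_prop] theorem filter {h : BinTree → BinTree → BinTree} {l : BinTree → BinTree}
    (hh : PolyTime fun p => h p.left p.right) (hl : PolyTime l) :
    PolyTime fun x => BinTree.filter (fun a => h x a) (l x) := by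
  exact flatMap (h := fun x a => BinTree.ite (h x a) (.node a .nil) .nil)
    (hh.ite (by fun_prop) (const _)) hl

@[fun_prop] theorem testMem {f g : BinTree → BinTree} (hf : PolyTime f) (hg : PolyTime g) :
    PolyTime fun x => BinTree.testMem (f x) (g x) := by
  unfold BinTree.testMem
  fun_prop

end PolyTime

/-! ## Numbers -/

namespace BinTree

theorem unary_injective : Function.Injective unary := by
  intro a b h
  induction a generalizing b with
  | zero => cases b with
    | zero => rfl
    | succ b => simp [unary] at h
  | succ a ih => cases b with
    | zero => simp [unary] at h
    | succ b => simp only [unary, node.injEq, true_and] at h; rw [ih h]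

@[simp] theorem unary_inj {a b : ℕ} : unary a = unary b ↔ a = b := unary_injective.eq_iff

@[simp] theorem size_unary (n : ℕ) : (unary n).size = 2 * n + 1 := by
  induction n with
  | zero => rfl
  | succ n ih => simp only [unary, size_node, size_nil, ih]; omega

theorem size_ofBits_le (l : List Bool) : (ofBits l).size ≤ 4 * l.length + 1 := by
  induction l with
  | nil => rfl
  | cons b l ih => cases b <;> simp only [ofBits, size_node, List.length_cons] <;> simp <;> omega

theorem size_binary_le (n : ℕ) : (binary n).size ≤ 4 * n.size + 1 := by
  rw [← Nat.size_eq_bits_len]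
  exact size_ofBits_le _

/-- Comparison of two numbers in binary, the least significant digit first; `acc` is the answer for
the digits that have been read. -/
def testLeAcc : BinTree → BinTree → BinTree → BinTree
  | nil, b, acc => ite b tru acc
  | node u a, b, acc =>
    ite b (testLeAcc a b.right (ite u (ite b.left acc nil) (ite b.left tru acc))) nil

/-- Comparison of two numbers in binary. -/
def testLe (a b : BinTree) : BinTree := testLeAcc a b tru

/-- Later digits are more significant, so a difference there overrides the accumulated answer. When
one number runs out of digits the other is larger, because the remaining part of a binary expansion
is never zero; this is why the induction is `Nat.binaryRec'`. -/
theorem testLeAcc_binary (a b : ℕ) (acc : BinTree) :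
    testLeAcc (binary a) (binary b) acc ≠ nil ↔ a < b ∨ a = b ∧ acc ≠ nil := by
  unfold binary
  induction a using Nat.binaryRec' generalizing b acc with
  | zero =>
    induction b using Nat.binaryRec' with
    | zero => simp [ofBits, testLeAcc]
    | bit y b hb _ =>
      rw [Nat.bits_append_bit b y hb]
      have : Nat.bit y b ≠ 0 := by cases y <;> simp [Nat.bit]; tauto
      simp [ofBits, testLeAcc]; omega
  | bit x a ha ih =>
    rw [Nat.bits_append_bit a x ha]
    have hx : Nat.bit x a ≠ 0 := by cases x <;> simp [Nat.bit]; tauto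
    induction b using Nat.binaryRec' with
    | zero => simp [ofBits, testLeAcc, hx]
    | bit y b hb _ =>
      rw [Nat.bits_append_bit b y hb]
      simp only [ofBits, testLeAcc, ite_node, left_node, right_node, ih]
      cases x <;> cases y <;> simp [Nat.bit] <;> omega

@[simp] theorem testLe_binary (a b : ℕ) : testLe (binary a) (binary b) ≠ nil ↔ a ≤ b := by
  rw [testLe, testLeAcc_binary]
  simp [le_iff_lt_or_eq]

theorem binary_injective : Function.Injective binary := fun a b h => by
  have h' := (testLe_binary a a).2 le_rfl
  exact le_antisymm ((testLe_binary a b).1 (h ▸ h')) ((testLe_binary b a).1 (h ▸ h'))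

@[simp] theorem binary_inj {a b : ℕ} : binary a = binary b ↔ a = b := binary_injective.eq_iff

/-- The list of all numbers below a number, in unary. -/
def numbersBelow : BinTree → BinTree
  | nil => nil
  | node _ l => append (numbersBelow l) (node l nil)

theorem toList_numbersBelow_unary (n : ℕ) : (numbersBelow (unary n)).toList = (List.range n).map unary := by
  induction n with
  | zero => rfl
  | succ n ih => simp [unary, numbersBelow, ih, List.range_succ]

theorem size_numbersBelow_le (x : BinTree) :
    (numbersBelow x).size ≤ 1 + x.size * x.size := by
  induction x with
  | nil => simp [numbersBelow]
  | node u l _ ih =>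
    have := size_append_le (numbersBelow l) (node l nil)
    have := size_pos u
    simp only [numbersBelow, size_node, size_nil] at *
    nlinarith

end BinTree

namespace PolyTime

@[fun_prop] theorem testLe {f g : BinTree → BinTree} (hf : PolyTime f) (hg : PolyTime g) :
    PolyTime fun x => BinTree.testLe (f x) (g x) := by
  let A : Scheme :=
    { halt := fun x => BinTree.ite x.left (BinTree.ite x.right.left .nil tru) tru
      val := fun x => BinTree.ite x.left .nil (BinTree.ite x.right.left tru x.right.right)
      fst := fun _ => .nil
      snd := fun x => .node x.left.right (.node x.right.left.right
        (BinTree.ite x.left.left (BinTree.ite x.right.left.left x.right.right .nil)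
          (BinTree.ite x.right.left.left tru x.right.right)))
      comb := fun _ _ r₂ => r₂ }
  have hA : A.Efficient := by constructor <;> simp only [A] <;> fun_prop
  have key : PolyTime fun x => BinTree.testLeAcc x.left x.right.left x.right.right := by
    refine hA.polyTime₂ (f := fun a b => BinTree.testLeAcc a b.left b.right)
      (10 + 3 * Polynomial.X) (2 * Polynomial.X) fun a b => ?_
    simp only [Polynomial.eval_add, Polynomial.eval_X, Polynomial.eval_ofNat, Polynomial.eval_mul]
    -- The accumulator is always its initial value, `tru` or `nil`, so its size stays below any `K`
    -- that bounds the initial value and `3`, the size of `tru`.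
    have gen : ∀ (a b acc : BinTree) (K M : ℕ), acc.size ≤ K → 3 ≤ K →
        2 + a.size + b.size + K ≤ M →
        (BinTree.testLeAcc a b acc).size ≤ K ∧ ∃ n ≤ 2 * a.size,
          A.Eval M (.node a (.node b acc)) (BinTree.testLeAcc a b acc) n := by
      intro a
      induction a with
      | nil =>
        intro b acc K M h₁ h₂ h₃
        have hs : (BinTree.testLeAcc .nil b acc).size ≤ K := by
          cases b <;> simp [BinTree.testLeAcc] <;> omega
        refine ⟨hs, 1, by simp, .halt_eq (by simp [A]) (by simp [A, BinTree.testLeAcc]) ?_ ?_⟩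
        · simp only [size_node]; omega
        · omega
      | node u a _ ih =>
        intro b acc K M h₁ h₂ h₃
        simp only [size_node] at h₃
        cases b with
        | nil =>
          refine ⟨by simp [BinTree.testLeAcc]; omega, 1, by simp only [size_node]; omega,
            .halt_eq (by simp [A]) (by simp [A, BinTree.testLeAcc]) ?_ ?_⟩
          · simp only [size_node]; omega
          · simp [BinTree.testLeAcc]; omega
        | node v b =>
          simp only [size_node] at h₃
          obtain ⟨hs, n, hn, e⟩ := ih b (BinTree.ite u (BinTree.ite v acc .nil)
            (BinTree.ite v tru acc)) K M (by cases u <;> cases v <;> simp <;> omega) h₂ (by omega)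
          have e₀ : A.Eval M .nil .nil 1 :=
            .halt_eq (by simp [A]) (by simp [A]) (by simp; omega) (by simp; omega)
          refine ⟨hs, 1 + 1 + n, by simp only [size_node]; have := size_pos u; omega,
            .call_eq (by simp [A]) rfl rfl (by simp [A, BinTree.testLeAcc]) ?_ ?_ e₀ e⟩
          · simp only [size_node]; omega
          · simp only [BinTree.testLeAcc, ite_node, left_node, right_node]; omega
    cases b with
    | nil =>
      refine ⟨1, by have := size_pos a; omega, .halt_eq (by cases a <;> simp [A])
        (by cases a <;> simp [A, BinTree.testLeAcc]) ?_ ?_⟩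
      · simp only [size_node, size_nil]; omega
      · cases a <;> simp [BinTree.testLeAcc]; omega
    | node b acc =>
      obtain ⟨_, n, hn, e⟩ := gen a b acc (3 + acc.size) (10 + 3 * (a.size + (BinTree.node b acc).size))
        (by omega) (by omega) (by simp only [size_node]; omega)
      exact ⟨n, by omega, e⟩
  unfold BinTree.testLe
  exact key.comp₃ hf hg (const _)

@[fun_prop] theorem numbersBelow : PolyTime BinTree.numbersBelow := by
  let A : Scheme :=
    { halt := fun x => BinTree.ite x .nil tru
      val := fun _ => .nil
      fst := fun _ => .nil
      snd := fun x => x.right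
      comb := fun x _ r₂ => BinTree.append r₂ (.node x.right .nil) }
  have hA : A.Efficient := by constructor <;> simp only [A] <;> fun_prop
  refine hA.polyTime (1 + Polynomial.X * Polynomial.X) (2 * Polynomial.X) fun x => ?_
  simp only [Polynomial.eval_add, Polynomial.eval_X, Polynomial.eval_ofNat, Polynomial.eval_mul,
    Polynomial.eval_one]
  suffices ∀ M, 1 + x.size * x.size ≤ M → ∃ n ≤ 2 * x.size,
    A.Eval M x (BinTree.numbersBelow x) n from this _ le_rfl
  intro M hM
  have hs := size_numbersBelow_le x
  induction x with
  | nil => exact ⟨1, by simp, .halt_eq (by simp [A]) rfl (by simp at hM ⊢; omega)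
      (by simp [BinTree.numbersBelow] at hM ⊢; omega)⟩
  | node u l _ ih =>
    simp only [size_node] at hM
    obtain ⟨n, hn, e⟩ := ih (by nlinarith) (size_numbersBelow_le l)
    have e₀ : A.Eval M .nil .nil 1 :=
      .halt_eq (by simp [A]) (by simp [A]) (by simp; omega) (by simp; omega)
    refine ⟨1 + 1 + n, by simp only [size_node]; have := size_pos u; omega,
      .call_eq (by simp [A]) rfl rfl (by simp [A, BinTree.numbersBelow]) ?_ ?_ e₀ e⟩
    · simp only [size_node]; nlinarith
    · simp only [size_node] at hs; omega

/-- Functions given by a recursion along the parse tree of an expression, of polynomially bounded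
size, are computable in polynomial time. -/
theorem exprRec {f val : BinTree → BinTree} {comb : BinTree → BinTree → BinTree → BinTree}
    (hval : PolyTime val) (hcomb : PolyTime fun x => comb x.left x.right.left x.right.right)
    (f_nil : f .nil = val .nil) (f_node_nil : ∀ t, f (.node t .nil) = val (.node t .nil))
    (f_leaf : ∀ a b, f (.node .nil (.node a b)) = val (.node .nil (.node a b)))
    (f_node : ∀ t a b, t ≠ .nil → f (.node t (.node a b)) = comb (.node t (.node a b))
      (f (BinTree.ite (BinTree.testEq t (unary 1)) a .nil)) (f b))
    (p : Polynomial ℕ) (hp : ∀ x, (f x).size ≤ p.eval x.size) : PolyTime f := by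
  let A : Scheme :=
    { halt := fun x => BinTree.ite x.left (BinTree.ite x.right .nil tru) tru
      val := val
      -- Only nodes of kind 1 have two subexpressions. At other kinds this component holds labels,
      -- and the first call is a dummy on `nil`.
      fst := fun x => BinTree.ite (BinTree.testEq x.left (unary 1)) x.right.left .nil
      snd := fun x => x.right.right
      comb := comb }
  have hA : A.Efficient :=
    ⟨by simp only [A]; fun_prop, hval, by simp only [A]; fun_prop, by simp only [A]; fun_prop, hcomb⟩
  refine hA.polyTime (Polynomial.X + p) Polynomial.X fun x => ?_
  simp only [Polynomial.eval_add, Polynomial.eval_X]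
  have hK : ∀ y : BinTree, y.size ≤ x.size → (f y).size ≤ x.size + p.eval x.size := fun y hy =>
    (hp y).trans ((p.monotone_eval_nat hy).trans (by simp))
  have hM : x.size ≤ x.size + p.eval x.size := by omega
  generalize x.size + p.eval x.size = M at hK hM
  suffices ∀ s (x : BinTree), x.size ≤ s → x.size ≤ M → (∀ y : BinTree, y.size ≤ x.size →
    (f y).size ≤ M) → ∃ n ≤ x.size, A.Eval M x (f x) n from this _ x le_rfl hM hK
  intro s
  induction s with
  | zero => intro x hx; have := size_pos x; omega
  | succ s ih =>
    intro x hx hM hK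
    match x with
    | .nil => exact ⟨1, by simp, .halt_eq (by simp [A]) f_nil.symm hM (hK _ le_rfl)⟩
    | .node t .nil =>
      exact ⟨1, size_pos _, .halt_eq (by cases t <;> simp [A]) (f_node_nil t).symm hM (hK _ le_rfl)⟩
    | .node .nil (.node a b) =>
      exact ⟨1, size_pos _, .halt_eq (by simp [A]) (f_leaf a b).symm hM (hK _ le_rfl)⟩
    | .node (.node t₁ t₂) (.node a b) =>
      set t := BinTree.node t₁ t₂ with ht
      set a' := BinTree.ite (BinTree.testEq t (unary 1)) a .nil with ha'
      have ha : a'.size ≤ a.size := by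
        rw [ha']
        cases BinTree.testEq t (unary 1)
        · simpa using size_pos a
        · simp
      simp only [size_node] at hx hM hK ⊢
      obtain ⟨n₁, l₁, e₁⟩ := ih a' (by omega) (by omega) fun y hy => hK y (by omega)
      obtain ⟨n₂, l₂, e₂⟩ := ih b (by omega) (by omega) fun y hy => hK y (by omega)
      refine ⟨1 + n₁ + n₂, by omega, .call_eq (by simp [A, ht]) rfl rfl
        (f_node t a b (by simp [ht])).symm (by simpa using hM) (hK _ le_rfl) e₁ e₂⟩

end PolyTime

/-! ## Labels and edges of an expression whose titles may repeat

A vertex may have several labels here. Fuse-nodes have no effect. -/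

namespace FuseExpr

variable {k : ℕ}

/-- Some introduce-node with title `v` has label `c` at the root. -/
def HasLab : FuseExpr k → ℕ → Fin k → Prop
  | intro u i, v, c => v = u ∧ c = i
  | union φ ψ, v, c => φ.HasLab v c ∨ ψ.HasLab v c
  | join _ _ φ, v, c => φ.HasLab v c
  | relabel i j φ, v, c => ∃ d, φ.HasLab v d ∧ c = if d = i then j else d
  | fuse _ φ, v, c => φ.HasLab v c

/-- `v` is the title of an introduce-node. -/
def HasVert (φ : FuseExpr k) (v : ℕ) : Prop := ∃ c, φ.HasLab v c

/-- `u` has label `i` and `w` has label `j`, or vice versa. -/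
def Crosses (φ : FuseExpr k) (i j : Fin k) (u w : ℕ) : Prop :=
  φ.HasLab u i ∧ φ.HasLab w j ∨ φ.HasLab u j ∧ φ.HasLab w i

/-- Some join-node makes `u` and `w` adjacent. -/
def Edge : FuseExpr k → ℕ → ℕ → Prop
  | intro _ _, _, _ => False
  | union φ ψ, u, w => φ.Edge u w ∨ ψ.Edge u w
  | join i j φ, u, w => φ.Edge u w ∨ u ≠ w ∧ φ.Crosses i j u w
  | relabel _ _ φ, u, w => φ.Edge u w
  | fuse _ φ, u, w => φ.Edge u w

end FuseExpr

namespace BinTree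

/-- The pairs of a title and a label in an encoded expression. -/
def labs : BinTree → BinTree
  | nil => nil
  | node _ nil => nil
  | node t (node a b) =>
    ite t
      (ite (testEq t (unary 1)) (append (labs a) (labs b))
        (ite (testEq t (unary 3))
          (map (fun p => node p.left (ite (testEq p.right a.left) a.right p.right)) (labs b))
          (labs b)))
      (node (node a b) nil)

/-- All pairs, in both orders, of distinct vertices of which one has label `i` and the other has
label `j`, given the list `l` of pairs of a title and a label. -/
def crossPairs (l i j : BinTree) : BinTree :=
  flatMap (fun p => flatMap (fun q =>
    ite (testAnd (testAnd (testEq p.right i) (testEq q.right j)) (testNot (testEq p.left q.left)))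
      (node (node p.left q.left) (node (node q.left p.left) nil)) nil) l) l

/-- The adjacent pairs in an encoded expression. -/
def edges : BinTree → BinTree
  | nil => nil
  | node _ nil => nil
  | node t (node a b) =>
    ite t
      (ite (testEq t (unary 1)) (append (edges a) (edges b))
        (ite (testEq t (unary 2)) (append (crossPairs (labs b) a.left a.right) (edges b))
          (edges b)))
      nil

/-- Each leaf contributes one entry, and a relabel-node replaces part of an entry by a label written
in that node. The bound must hold for arbitrary trees, as polynomial time is claimed on all inputs,
hence the induction on size. -/
theorem labs_bounds (x : BinTree) :
    x.labs.toList.length ≤ x.size ∧ ∀ e ∈ x.labs.toList, e.size ≤ x.size := by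
  suffices ∀ s (x : BinTree), x.size ≤ s →
    x.labs.toList.length ≤ x.size ∧ ∀ e ∈ x.labs.toList, e.size ≤ x.size from this _ x le_rfl
  intro s
  induction s with
  | zero => intro x hx; have := size_pos x; omega
  | succ s ih =>
    intro x hx
    match x with
    | nil => simp [labs]
    | node t nil => simp [labs]
    | node t (node a b) =>
      simp only [size_node] at hx
      obtain ⟨la, ea⟩ := ih a (by omega)
      obtain ⟨lb, eb⟩ := ih b (by omega)
      have := size_pos t
      simp only [labs, size_node]
      cases t with
      | nil => simp; omega
      | node t₁ t₂ =>
        rw [ite_node]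
        cases testEq (node t₁ t₂) (unary 1) with
        | node _ _ =>
          simp only [ite_node, toList_append, List.length_append, List.mem_append]
          refine ⟨by omega, ?_⟩
          rintro e (he | he)
          · have := ea e he; omega
          · have := eb e he; omega
        | nil =>
          rw [ite_nil]
          cases testEq (node t₁ t₂) (unary 3) with
          | node _ _ =>
            simp only [ite_node, toList_map, List.length_map, List.mem_map]
            refine ⟨by omega, ?_⟩
            rintro _ ⟨p, hp, rfl⟩
            have h₁ := eb p hp
            have h₂ := size_left_le p
            have h₃ := size_right_le a
            simp only [size_node]
            cases hq : testEq p.right a.left with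
            | nil =>
              cases p with
              | nil => simp; omega
              | node u v => simp only [left_node, right_node, ite_nil, size_node] at h₁ ⊢; omega
            | node _ _ => simp only [ite_node]; omega
          | nil =>
            simp only [ite_nil]
            refine ⟨by omega, fun e he => ?_⟩
            have := eb e he
            omega

theorem size_labs_le (x : BinTree) : x.labs.size ≤ 1 + x.size * (1 + x.size) := by
  obtain ⟨h₁, h₂⟩ := labs_bounds x
  have := size_ofList_le h₂
  rw [ofList_toList] at this
  exact this.trans (by gcongr)

end BinTree

namespace PolyTime

@[fun_prop] theorem labs : PolyTime BinTree.labs := by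
  refine exprRec
    (val := fun x => BinTree.ite x.left .nil (BinTree.ite x.right (.node x.right .nil) .nil))
    (comb := fun x r₁ r₂ => BinTree.ite (BinTree.testEq x.left (unary 1)) (BinTree.append r₁ r₂)
        (BinTree.ite (BinTree.testEq x.left (unary 3))
          (BinTree.map (fun p => .node p.left (BinTree.ite
            (BinTree.testEq p.right x.right.left.left) x.right.left.right p.right)) r₂) r₂))
    (by fun_prop) (by fun_prop) rfl (fun t => by cases t <;> rfl) (fun a b => rfl) (fun t a b ht => ?_)
    (1 + Polynomial.X * (1 + Polynomial.X)) fun x => ?_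
  · simp only [BinTree.labs, ite_of_ne ht, left_node, right_node]
    cases BinTree.testEq t (unary 1) <;> simp
  · simpa using size_labs_le x

theorem crossPairs : PolyTime fun x =>
    BinTree.crossPairs x.left x.right.left x.right.right := by
  unfold BinTree.crossPairs
  fun_prop

@[fun_prop] theorem edges : PolyTime BinTree.edges := by
  obtain ⟨p, hp⟩ : ∃ p : Polynomial ℕ, ∀ x : BinTree, (BinTree.crossPairs (BinTree.labs x.right)
      x.left.left x.left.right).size ≤ p.eval x.size :=
    (comp₃ crossPairs (by fun_prop) (by fun_prop) (by fun_prop) :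
      PolyTime fun x => BinTree.crossPairs (BinTree.labs x.right) x.left.left x.left.right).size_le
  have hc : PolyTime fun x : BinTree => BinTree.crossPairs (BinTree.labs x.left.right.right)
      x.left.right.left.left x.left.right.left.right :=
    comp₃ crossPairs (by fun_prop) (by fun_prop) (by fun_prop)
  refine exprRec (val := fun _ => .nil)
    (comb := fun x r₁ r₂ => BinTree.ite (BinTree.testEq x.left (unary 1)) (BinTree.append r₁ r₂)
        (BinTree.ite (BinTree.testEq x.left (unary 2)) (BinTree.append
          (BinTree.crossPairs (BinTree.labs x.right.right) x.right.left.left x.right.left.right)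
            r₂) r₂))
    (by fun_prop) ?_ rfl (fun t => rfl) (fun a b => rfl) (fun t a b ht => ?_)
    (Polynomial.X * (1 + p)) fun x => ?_
  · refine ite (by fun_prop) (by fun_prop) (ite (by fun_prop) (append hc ?_) ?_) <;> fun_prop
  · simp only [BinTree.edges, ite_of_ne ht, left_node, right_node]
    cases BinTree.testEq t (unary 1) <;> simp
  · simp only [Polynomial.eval_mul, Polynomial.eval_add, Polynomial.eval_X, Polynomial.eval_one]
    have hK : ∀ y : BinTree, y.size ≤ x.size → (BinTree.crossPairs (BinTree.labs y.right)
        y.left.left y.left.right).size ≤ p.eval x.size := fun y hy =>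
      (hp y).trans (p.monotone_eval_nat hy)
    generalize p.eval x.size = K at hK
    -- One bound `K` covers the pairs contributed by every single node, so the total is at most the
    -- number of nodes times `1 + K`.
    suffices ∀ s (x : BinTree), x.size ≤ s → (∀ y : BinTree, y.size ≤ x.size →
      (BinTree.crossPairs (BinTree.labs y.right) y.left.left y.left.right).size ≤ K) →
      (BinTree.edges x).size ≤ x.size * (1 + K) from this _ x le_rfl hK
    intro s
    induction s with
    | zero => intro x hx; have := size_pos x; omega
    | succ s ih =>
      intro x hx hK
      match x with
      | .nil => simp [BinTree.edges]
      | .node t .nil => simp [BinTree.edges]; nlinarith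
      | .node t (.node a b) =>
        simp only [size_node] at hx hK
        have ha := ih a (by omega) fun y hy => hK y (by omega)
        have hb := ih b (by omega) fun y hy => hK y (by omega)
        have hab := hK (.node a b) (by simp only [size_node]; omega)
        simp only [left_node, right_node] at hab
        have h₁ := size_append_le a.edges b.edges
        have h₂ := size_append_le (BinTree.crossPairs (BinTree.labs b) a.left a.right) b.edges
        simp only [BinTree.edges, size_node]
        cases t with
        | nil => simp; nlinarith
        | node t₁ t₂ =>
          rw [ite_node]
          cases BinTree.testEq (.node t₁ t₂) (unary 1) with
          | node _ _ => simp only [ite_node, size_node]; nlinarith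
          | nil =>
            rw [ite_nil]
            cases BinTree.testEq (.node t₁ t₂) (unary 2) with
            | node _ _ => simp only [ite_node, size_node]; nlinarith
            | nil => simp only [ite_nil, size_node]; nlinarith

end PolyTime

/-! ### Correctness of the lists of labels and edges -/

namespace FuseExpr

variable {k : ℕ}

/-- The encoding of a vertex with a label. -/
def encodeLabel (v : ℕ) (c : Fin k) : BinTree := .node (binary v) (unary c)

/-- The encoding of a pair of vertices. -/
def encodePair (u w : ℕ) : BinTree := .node (binary u) (binary w)

@[simp] theorem encodeLabel_inj {v w : ℕ} {c d : Fin k} :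
    encodeLabel v c = encodeLabel w d ↔ v = w ∧ c = d := by
  simp [encodeLabel, Fin.ext_iff]

@[simp] theorem encodePair_inj {u w u' w' : ℕ} :
    encodePair u w = encodePair u' w' ↔ u = u' ∧ w = w' := by
  simp [encodePair]

theorem mem_labs (φ : FuseExpr k) (e : BinTree) :
    e ∈ φ.encode.labs.toList ↔ ∃ v c, φ.HasLab v c ∧ e = encodeLabel v c := by
  induction φ generalizing e with
  | intro v i => simp [encode, labs, HasLab, encodeLabel, unary]
  | union φ ψ h₁ h₂ =>
    simp [encode, labs, HasLab, unary, h₁, h₂, testEq, testAnd, or_and_right, exists_or, tru]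
  | join i j φ ih => simp [encode, labs, HasLab, unary, ih, testEq, testAnd, tru]
  | relabel i j φ ih =>
    have : (encode (.relabel i j φ)).labs = BinTree.map (fun p => .node p.left
      (BinTree.ite (testEq p.right (unary i)) (unary j) p.right)) φ.encode.labs := rfl
    simp only [this, toList_map, List.mem_map, HasLab, ih]
    have key : ∀ (v : ℕ) (c : Fin k), (encodeLabel v c).left.node
        (BinTree.ite (testEq (encodeLabel v c).right (unary i)) (unary j) (encodeLabel v c).right) =
        encodeLabel v (if c = i then j else c) := fun v c => by
      rw [ite_eq_of_iff (p := c = i) (by simp [encodeLabel, Fin.ext_iff])]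
      split_ifs <;> rfl
    constructor
    · rintro ⟨_, ⟨v, c, h, rfl⟩, rfl⟩
      exact ⟨v, _, ⟨c, h, rfl⟩, key v c⟩
    · rintro ⟨v, _, ⟨c, h, rfl⟩, rfl⟩
      exact ⟨_, ⟨v, c, h, rfl⟩, key v c⟩
  | fuse i φ ih => simp [encode, labs, HasLab, unary, ih, testEq, testAnd, tru]

@[simp] theorem mem_labs_iff (φ : FuseExpr k) (v : ℕ) (c : Fin k) :
    encodeLabel v c ∈ φ.encode.labs.toList ↔ φ.HasLab v c := by
  simp [mem_labs]

theorem mem_edges (φ : FuseExpr k) (e : BinTree) :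
    e ∈ φ.encode.edges.toList ↔ ∃ u w, φ.Edge u w ∧ e = encodePair u w := by
  induction φ generalizing e with
  | intro v i => simp [encode, edges, Edge, unary]
  | union φ ψ h₁ h₂ =>
    simp [encode, edges, Edge, unary, h₁, h₂, testEq, testAnd, or_and_right, exists_or, tru]
  | join i j φ ih =>
    have : (encode (.join i j φ)).edges =
      append (crossPairs φ.encode.labs (unary i) (unary j)) φ.encode.edges := rfl
    simp only [this, toList_append, List.mem_append, ih, Edge, or_and_right, exists_or]
    -- The list has the new pairs in front, whereas `Edge` puts the old edges first.
    rw [or_comm]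
    refine or_congr_right ?_
    simp only [crossPairs, toList_flatMap, List.mem_flatMap, mem_labs]
    constructor
    · rintro ⟨_, ⟨u, c, hu, rfl⟩, _, ⟨w, d, hw, rfl⟩, h⟩
      rw [ite_eq_of_iff (p := (c = i ∧ d = j) ∧ u ≠ w)
        (by simp [encodeLabel, Fin.ext_iff, and_assoc])] at h
      split_ifs at h with hc
      · obtain ⟨⟨rfl, rfl⟩, hne⟩ := hc
        simp only [toList_node, toList_nil, List.mem_cons, List.not_mem_nil, or_false] at h
        rcases h with rfl | rfl
        · exact ⟨u, w, ⟨hne, .inl ⟨hu, hw⟩⟩, rfl⟩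
        · exact ⟨w, u, ⟨hne.symm, .inr ⟨hw, hu⟩⟩, rfl⟩
      · simp at h
    · rintro ⟨u, w, ⟨hne, ⟨hu, hw⟩ | ⟨hu, hw⟩⟩, rfl⟩
      · refine ⟨_, ⟨u, i, hu, rfl⟩, _, ⟨w, j, hw, rfl⟩, ?_⟩
        rw [ite_of_ne (by simpa [encodeLabel] using hne)]
        simp [encodeLabel, encodePair]
      · refine ⟨_, ⟨w, i, hw, rfl⟩, _, ⟨u, j, hu, rfl⟩, ?_⟩
        rw [ite_of_ne (by simpa [encodeLabel] using hne.symm)]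
        simp [encodeLabel, encodePair]
  | relabel i j φ ih => simp [encode, edges, Edge, unary, ih, testEq, testAnd, tru]
  | fuse i φ ih => simp [encode, edges, Edge, unary, ih, testEq, testAnd, tru]

@[simp] theorem mem_edges_iff (φ : FuseExpr k) (u w : ℕ) :
    encodePair u w ∈ φ.encode.edges.toList ↔ φ.Edge u w := by
  simp [mem_edges]

end FuseExpr

/-! ## Realizing a part of an expression by a reduced glue-expression -/

/-- Every relabel-node merges two nonempty label classes. -/
def GlueExpr.Merging {k : ℕ} : GlueExpr k → Prop
  | intro _ _ => True
  | glue ξ χ => ξ.Merging ∧ χ.Merging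
  | join _ _ ξ => ξ.Merging
  | relabel i j ξ => ξ.Merging ∧ i ≠ j ∧
      (ξ.eval.labelClass i).Nonempty ∧ (ξ.eval.labelClass j).Nonempty

namespace FuseExpr

variable {k : ℕ}

/-- Vertices with several introduce-nodes do not share labels with other vertices as long as their
copies are separate. -/
def Good : FuseExpr k → Prop
  | intro _ _ => True
  | union φ ψ => φ.Good ∧ ψ.Good ∧ ∀ v w c, φ.HasVert v → ψ.HasVert v →
      (φ.union ψ).HasLab v c → (φ.union ψ).HasLab w c → w = v
  | join i j φ => φ.Good ∧ i ≠ j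
  | relabel i j φ => φ.Good ∧ i ≠ j ∧ ∀ v w, φ.HasLab v i → φ.HasLab v j →
      φ.HasLab w i ∨ φ.HasLab w j → w = v
  | fuse _ φ => φ.Good

/-- The vertices `X` and the edges `W` of `φ`, with the labels renamed by `m`, form a graph that can
be realized by a glue-expression. -/
structure Part (φ : FuseExpr k) (m : Fin k → Fin k) (W : ℕ → ℕ → Prop) (X : ℕ → Prop) : Prop where
  vert : ∀ v, X v → φ.HasVert v
  edge : ∀ u w, W u w → φ.Edge u w
  symm : ∀ u w, W u w → W w u
  mem : ∀ u w, W u w → X u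
  saturated : ∀ u w u' w' a b, W u w → φ.HasLab u a → φ.HasLab w b → φ.HasLab u' a →
    φ.HasLab w' b → φ.Edge u' w' → W u' w'
  lab_eq : ∀ v c d, X v → φ.HasLab v c → φ.HasLab v d → m c = m d
  lab_inj : ∀ v w c d, X v → X w → φ.HasLab v c → φ.HasLab w d → m c = m d → c = d ∨ v = w

/-- `ζ` is a reduced glue-expression of the graph with the vertices `X` and the edges `W`, and
with the labels of `φ` renamed by `m`. -/
structure Realizes (φ : FuseExpr k) (m : Fin k → Fin k) (W : ℕ → ℕ → Prop) (X : ℕ → Prop)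
    (ζ : GlueExpr k) : Prop where
  wellFormed : ζ.WellFormed
  reduced : ζ.Reduced
  merging : ζ.Merging
  verts : ∀ v, v ∈ ζ.eval.graph.verts ↔ X v
  adj : ∀ u w, ζ.eval.graph.Adj u w ↔ W u w
  lab : ∀ v c, X v → φ.HasLab v c → ζ.eval.lab v = m c

variable {φ ψ : FuseExpr k} {m : Fin k → Fin k} {W : ℕ → ℕ → Prop} {X : ℕ → Prop}

theorem Edge.ne {u w : ℕ} (h : φ.Edge u w) : u ≠ w := by
  induction φ with
  | intro => exact h.elim
  | union φ ψ h₁ h₂ => exact h.elim h₁ h₂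
  | join i j φ ih => exact h.elim ih And.left
  | relabel i j φ ih => exact ih h
  | fuse i φ ih => exact ih h

theorem Edge.symm {u w : ℕ} (h : φ.Edge u w) : φ.Edge w u := by
  induction φ with
  | intro => exact h.elim
  | union φ ψ h₁ h₂ => exact h.imp h₁ h₂
  | join i j φ ih =>
    refine h.imp ih fun ⟨h₁, h₂⟩ => ⟨h₁.symm, ?_⟩
    exact h₂.elim (fun ⟨a, b⟩ => .inr ⟨b, a⟩) fun ⟨a, b⟩ => .inl ⟨b, a⟩
  | relabel i j φ ih => exact ih h
  | fuse i φ ih => exact ih h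

theorem hasVert_relabel {i j : Fin k} {v : ℕ} : (relabel i j φ).HasVert v ↔ φ.HasVert v :=
  ⟨fun ⟨_, d, h, _⟩ => ⟨d, h⟩, fun ⟨d, h⟩ => ⟨_, d, h, rfl⟩⟩

theorem Edge.hasVert {u w : ℕ} (h : φ.Edge u w) : φ.HasVert u := by
  induction φ with
  | intro => exact h.elim
  | union φ ψ h₁ h₂ =>
    rcases h with h | h
    · obtain ⟨c, hc⟩ := h₁ h; exact ⟨c, .inl hc⟩
    · obtain ⟨c, hc⟩ := h₂ h; exact ⟨c, .inr hc⟩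
  | join i j φ ih =>
    rcases h with h | ⟨_, ⟨h, _⟩ | ⟨h, _⟩⟩
    · exact ih h
    · exact ⟨_, h⟩
    · exact ⟨_, h⟩
  | relabel i j φ ih => exact hasVert_relabel.2 (ih h)
  | fuse i φ ih => exact ih h

theorem Crosses.symm {i j : Fin k} {u w : ℕ} (h : φ.Crosses i j u w) : φ.Crosses i j w u :=
  h.elim (fun ⟨a, b⟩ => .inr ⟨b, a⟩) fun ⟨a, b⟩ => .inl ⟨b, a⟩

theorem Part.realizes_intro {v : ℕ} {i : Fin k} (h : (intro v i).Part m W X) (hX : ∃ u, X u) :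
    (intro v i).Realizes m W X (.intro v (m i)) := by
  obtain ⟨u, hu⟩ := hX
  obtain ⟨c, rfl, rfl⟩ := h.vert u hu
  refine ⟨trivial, ⟨trivial, trivial, trivial, trivial⟩, trivial, fun w => ?_, fun a b => ?_, ?_⟩
  · simp only [GlueExpr.eval, LGraph.single, SimpleGraph.singletonSubgraph_verts,
      Set.mem_singleton_iff]
    refine ⟨fun h => h ▸ hu, fun hw => ?_⟩
    obtain ⟨_, h, _⟩ := h.vert w hw
    exact h
  · simp only [GlueExpr.eval, LGraph.single, SimpleGraph.singletonSubgraph_adj]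
    exact ⟨fun h => h.elim, fun hab => (h.edge a b hab).elim⟩
  · rintro w _ _ ⟨rfl, rfl⟩
    rfl

/-! ### Join-nodes -/

/-- Two labels of a vertex are not shared with other vertices. -/
theorem Part.hasLab_of_hasLab {u v : ℕ} {a i : Fin k} (h : φ.Part m W X) (hu : X u)
    (hv : X v) (hua : φ.HasLab u a) (hva : φ.HasLab v a) (hui : φ.HasLab u i) : φ.HasLab v i := by
  by_cases hai : a = i
  · exact hai ▸ hva
  · have := h.lab_eq u a i hu hua hui
    rcases h.lab_inj v u a i hv hu hva hui this with h' | rfl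
    · exact (hai h').elim
    · exact hui

/-- Removing the crossing edges keeps the demand saturated. Suppose a remaining edge and another
edge of `φ` join the same two label classes. By `Part.hasLab_of_hasLab`, demanded vertices with a
common label have all labels in common, so both edges cross or neither does. -/
theorem Part.of_join {i j : Fin k} (h : (join i j φ).Part m W X) :
    φ.Part m (fun u w => W u w ∧ ¬ φ.Crosses i j u w) X where
  vert := h.vert
  edge u w := fun ⟨h₁, h₂⟩ => (h.edge u w h₁).resolve_right fun h => h₂ h.2
  symm u w := fun ⟨h₁, h₂⟩ => ⟨h.symm u w h₁, fun h => h₂ h.symm⟩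
  mem u w := fun ⟨h₁, _⟩ => h.mem u w h₁
  saturated u w u' w' a b := fun ⟨h₁, h₂⟩ hu hw hu' hw' he => by
    have hW := h.saturated u w u' w' a b h₁ hu hw hu' hw' (.inl he)
    refine ⟨hW, fun hc => h₂ ?_⟩
    have xu := h.mem _ _ h₁
    have xw := h.mem _ _ (h.symm _ _ h₁)
    have xu' := h.mem _ _ hW
    have xw' := h.mem _ _ (h.symm _ _ hW)
    rcases hc with ⟨c₁, c₂⟩ | ⟨c₁, c₂⟩
    · exact .inl ⟨h.hasLab_of_hasLab xu' xu hu' hu c₁, h.hasLab_of_hasLab xw' xw hw' hw c₂⟩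
    · exact .inr ⟨h.hasLab_of_hasLab xu' xu hu' hu c₁, h.hasLab_of_hasLab xw' xw hw' hw c₂⟩
  lab_eq := h.lab_eq
  lab_inj := h.lab_inj

theorem Realizes.join_of_not {i j : Fin k} {ζ : GlueExpr k}
    (hζ : φ.Realizes m (fun u w => W u w ∧ ¬ φ.Crosses i j u w) X ζ)
    (hc : ¬ ∃ u w, W u w ∧ φ.Crosses i j u w) : (join i j φ).Realizes m W X ζ :=
  ⟨hζ.wellFormed, hζ.reduced, hζ.merging, hζ.verts,
    fun u w => (hζ.adj u w).trans ⟨And.left, fun h => ⟨h, fun h' => hc ⟨u, w, h, h'⟩⟩⟩, hζ.lab⟩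

/-- The vertices with a label in a realization. -/
theorem Realizes.mem_labelClass {ζ : GlueExpr k} (hζ : φ.Realizes m W X ζ) {v : ℕ} {ℓ : Fin k}
    (hX : ∀ v, X v → φ.HasVert v) :
    v ∈ ζ.eval.labelClass ℓ ↔ X v ∧ ∃ c, φ.HasLab v c ∧ m c = ℓ := by
  simp only [LGraph.labelClass, Set.mem_ofPred_eq, hζ.verts]
  refine and_congr_right fun hv => ⟨fun h => ?_, fun ⟨c, hc, h⟩ => (hζ.lab v c hv hc).trans h⟩
  obtain ⟨c, hc⟩ := hX v hv
  exact ⟨c, hc, (hζ.lab v c hv hc).symm.trans h⟩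

/-- One demanded crossing edge makes, by saturation, every pair of distinct demanded vertices from
the two classes demanded. The join thus creates no undesired edge; no crossing edge exists before
it, because these were removed from the demand below. -/
theorem Realizes.join_of_exists {i j : Fin k} {ζ : GlueExpr k} (h : (join i j φ).Part m W X)
    (hζ : φ.Realizes m (fun u w => W u w ∧ ¬ φ.Crosses i j u w) X ζ) (hij : i ≠ j)
    (hc : ∃ u w, W u w ∧ φ.Crosses i j u w) :
    (join i j φ).Realizes m W X (.join (m i) (m j) ζ) := by
  obtain ⟨u, w, hW, hui, hwj⟩ : ∃ u w, W u w ∧ φ.HasLab u i ∧ φ.HasLab w j := by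
    obtain ⟨u, w, hW, h₁ | h₁⟩ := hc
    · exact ⟨u, w, hW, h₁⟩
    · exact ⟨w, u, h.symm _ _ hW, h₁.symm⟩
  have hu := h.mem _ _ hW
  have hw := h.mem _ _ (h.symm _ _ hW)
  have hne := (h.edge _ _ hW).ne
  have hm : m i ≠ m j := fun hm => (h.lab_inj u w i j hu hw hui hwj hm).elim hij hne
  -- As soon as label `ℓ` occurs in `X`, the class named `m ℓ` consists exactly of the demanded
  -- vertices with label `ℓ`: a vertex entering by another label would have to be `x` itself.
  have cls : ∀ {ℓ x v}, X x → φ.HasLab x ℓ → (v ∈ ζ.eval.labelClass (m ℓ) ↔ X v ∧ φ.HasLab v ℓ) := by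
    intro ℓ x v hx hxℓ
    rw [hζ.mem_labelClass h.vert]
    refine and_congr_right fun hv => ⟨fun ⟨c, hc, hm⟩ => ?_, fun hv => ⟨ℓ, hv, rfl⟩⟩
    rcases h.lab_inj v x c ℓ hv hx hc hxℓ hm with rfl | rfl
    · exact hc
    · exact hxℓ
  have full : ∀ x y, X x → X y → x ≠ y → φ.HasLab x i → φ.HasLab y j → W x y :=
    fun x y _ _ hxy hxi hyj =>
      h.saturated u w x y i j hW hui hwj hxi hyj (.inr ⟨hxy, .inl ⟨hxi, hyj⟩⟩)
  refine ⟨⟨hζ.wellFormed, hm⟩, ⟨⟨hζ.reduced.1, u, (cls hu hui).2 ⟨hu, hui⟩, w,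
    (cls hw hwj).2 ⟨hw, hwj⟩, hne, fun ha => ((hζ.adj _ _).1 ha).2 (.inl ⟨hui, hwj⟩)⟩,
    ⟨hζ.reduced.2.1, ?_⟩, hζ.reduced.2.2.1, hζ.reduced.2.2.2⟩, hζ.merging, hζ.verts, ?_, hζ.lab⟩
  · rintro x y ha ⟨hx, hy⟩
    have hx' := (cls hu hui).1 ⟨ζ.eval.graph.edge_vert ha, hx⟩
    have hy' := (cls hw hwj).1 ⟨ζ.eval.graph.edge_vert ha.symm, hy⟩
    exact ((hζ.adj _ _).1 ha).2 (.inl ⟨hx'.2, hy'.2⟩)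
  · intro x y
    simp only [GlueExpr.eval, LGraph.join, hζ.adj, cls hu hui, cls hw hwj]
    constructor
    · rintro (⟨h₁, _⟩ | ⟨hxy, ⟨⟨h₁, h₂⟩, h₃, h₄⟩ | ⟨⟨h₁, h₂⟩, h₃, h₄⟩⟩)
      · exact h₁
      · exact full x y h₁ h₃ hxy h₂ h₄
      · exact h.symm _ _ (full y x h₃ h₁ hxy.symm h₄ h₂)
    · intro hxy
      by_cases hc : φ.Crosses i j x y
      · refine .inr ⟨(h.edge _ _ hxy).ne, ?_⟩
        have hx := h.mem _ _ hxy
        have hy := h.mem _ _ (h.symm _ _ hxy)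
        exact hc.imp (fun ⟨a, b⟩ => ⟨⟨hx, a⟩, hy, b⟩) fun ⟨a, b⟩ => ⟨⟨hx, a⟩, hy, b⟩
      · exact .inl ⟨hxy, hc⟩

/-! ### Relabel-nodes -/

/-- Some vertex in `X` has label `c`. -/
def Present (φ : FuseExpr k) (X : ℕ → Prop) (c : Fin k) : Prop := ∃ v, X v ∧ φ.HasLab v c

/-- Some vertex in `X` has both labels `i` and `j`. -/
def Common (φ : FuseExpr k) (X : ℕ → Prop) (i j : Fin k) : Prop :=
  ∃ v, X v ∧ φ.HasLab v i ∧ φ.HasLab v j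

theorem HasLab.relabel {i j c : Fin k} {v : ℕ} (h : φ.HasLab v c) :
    (FuseExpr.relabel i j φ).HasLab v (if c = i then j else c) := ⟨c, h, rfl⟩

/-- The conditions on a part that concern only labels suffice at relabel-nodes. -/
theorem Part.of_relabel {i j : Fin k} {m' : Fin k → Fin k} (h : (relabel i j φ).Part m W X)
    (lab_eq : ∀ v c d, X v → φ.HasLab v c → φ.HasLab v d → m' c = m' d)
    (lab_inj : ∀ v w c d, X v → X w → φ.HasLab v c → φ.HasLab w d → m' c = m' d → c = d ∨ v = w) :
    φ.Part m' W X where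
  vert v hv := hasVert_relabel.1 (h.vert v hv)
  edge := h.edge
  symm := h.symm
  mem := h.mem
  saturated u w u' w' _ _ hW h₁ h₂ h₃ h₄ he :=
    h.saturated u w u' w' _ _ hW h₁.relabel h₂.relabel h₃.relabel h₄.relabel he
  lab_eq := lab_eq
  lab_inj := lab_inj

theorem Part.of_relabel_absent {i j : Fin k} (h : (relabel i j φ).Part m W X)
    (hi : ¬ φ.Present X i) : φ.Part m W X := by
  have key : ∀ {v c}, X v → φ.HasLab v c → (relabel i j φ).HasLab v c := fun {v c} hv hc => by
    have := hc.relabel (i := i) (j := j)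
    rwa [if_neg fun hci : c = i => hi ⟨v, hv, hci ▸ hc⟩] at this
  exact h.of_relabel (fun v c d hv hc hd => h.lab_eq v c d hv (key hv hc) (key hv hd))
    fun v w c d hv hw hc hd => h.lab_inj v w c d hv hw (key hv hc) (key hw hd)

theorem Realizes.relabel_absent {i j : Fin k} {ζ : GlueExpr k} (hi : ¬ φ.Present X i)
    (hζ : φ.Realizes m W X ζ) : (relabel i j φ).Realizes m W X ζ := by
  refine ⟨hζ.wellFormed, hζ.reduced, hζ.merging, hζ.verts, hζ.adj, ?_⟩
  rintro v _ hv ⟨d, hd, rfl⟩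
  rw [if_neg fun hdi : d = i => hi ⟨v, hv, hdi ▸ hd⟩]
  exact hζ.lab v d hv hd

theorem update_apply_eq (m : Fin k → Fin k) (i j c : Fin k) :
    Function.update m i (m j) c = m (if c = i then j else c) := by
  by_cases hc : c = i
  · subst hc; simp
  · simp [hc]

/-- No two different demanded vertices are merged here, so label `i` can receive below the node the
name that `j` has above it, and the node disappears. -/
theorem Part.of_relabel_move {i j : Fin k} (h : (relabel i j φ).Part m W X)
    (hg : (relabel i j φ).Good) (hj : ¬ φ.Present X j ∨ φ.Common X i j) :
    φ.Part (Function.update m i (m j)) W X := by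
  -- Either there is no such `w`, or by `Good` the common vertex is the only one with label `i` or
  -- `j`.
  have main : ∀ v w, X v → X w → φ.HasLab v i → φ.HasLab w j → v = w := by
    intro v w hv hw hvi hwj
    rcases hj with hj | ⟨x, hx, hxi, hxj⟩
    · exact (hj ⟨w, hw, hwj⟩).elim
    · rw [hg.2.2 x v hxi hxj (.inl hvi), hg.2.2 x w hxi hxj (.inr hwj)]
  refine h.of_relabel (fun v c d hv hc hd => ?_) fun v w c d hv hw hc hd hm => ?_
  · rw [update_apply_eq, update_apply_eq]
    exact h.lab_eq v _ _ hv hc.relabel hd.relabel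
  · rw [update_apply_eq, update_apply_eq] at hm
    refine or_iff_not_imp_left.2 fun hcd => ?_
    refine (h.lab_inj v w _ _ hv hw hc.relabel hd.relabel hm).elim (fun he => ?_) id
    split_ifs at he with h₁ h₂ h₂
    · exact (hcd (h₁.trans h₂.symm)).elim
    · exact main v w hv hw (h₁ ▸ hc) (he ▸ hd)
    · exact (main w v hw hv (h₂ ▸ hd) (he ▸ hc)).symm
    · exact (hcd he).elim

theorem Realizes.relabel_move {i j : Fin k} {ζ : GlueExpr k}
    (hζ : φ.Realizes (Function.update m i (m j)) W X ζ) : (relabel i j φ).Realizes m W X ζ := by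
  refine ⟨hζ.wellFormed, hζ.reduced, hζ.merging, hζ.verts, hζ.adj, ?_⟩
  rintro v _ hv ⟨d, hd, rfl⟩
  rw [← update_apply_eq m]
  exact hζ.lab v d hv hd

/-- The label `f` is not used by vertices in `X`, those with label `i` excepted. -/
def Free (φ : FuseExpr k) (m : Fin k → Fin k) (X : ℕ → Prop) (i f : Fin k) : Prop :=
  ∀ c, c ≠ i → φ.Present X c → m c ≠ f

/-- Pigeonhole: the labels other than `i` have at most `k - 1` names. -/
theorem exists_free (φ : FuseExpr k) (m : Fin k → Fin k) (X : ℕ → Prop) (i : Fin k) :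
    ∃ f, φ.Free m X i f := by
  classical
  by_contra! hf
  have : Finset.univ ⊆ (Finset.univ.erase i).image m := fun f _ => by
    have := hf f
    simp only [Free] at this
    push Not at this
    obtain ⟨c, hc, _, h⟩ := this
    exact Finset.mem_image.2 ⟨c, by simp [hc], h⟩
  have := (Finset.card_le_card this).trans Finset.card_image_le
  rw [Finset.card_erase_of_mem (Finset.mem_univ i)] at this
  have := Finset.card_pos.2 ⟨i, Finset.mem_univ i⟩
  omega

/-- The two classes must be kept apart below the node, so `i` needs a name of its own. Neither `i`
nor `m i` need be available, since `m` may already use them for other labels that are present. -/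
theorem Part.of_relabel_merge {i j f : Fin k} (h : (relabel i j φ).Part m W X)
    (hj : φ.Present X j) (hij : ¬ φ.Common X i j) (hne : i ≠ j) (hf : φ.Free m X i f) :
    φ.Part (Function.update m i f) W X := by
  have stay : ∀ {v c}, c ≠ i → φ.HasLab v c → (relabel i j φ).HasLab v c := fun {v c} hci hc => by
    have := hc.relabel (i := i) (j := j)
    rwa [if_neg hci] at this
  -- A demanded vertex with label `i` has no second label `d`. After relabeling it would have `j`
  -- and `d`, so `m d = m j`; compared with a vertex `y` of label `j` this forces `d = j` or `v =
  -- y`, and either way `v` would have both `i` and `j`.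
  have alone : ∀ v d, X v → φ.HasLab v i → φ.HasLab v d → d = i := by
    intro v d hv hvi hvd
    by_contra hdi
    obtain ⟨y, hy, hyj⟩ := hj
    have h₁ : (relabel i j φ).HasLab v j := by simpa using hvi.relabel (i := i) (j := j)
    have h₂ := h.lab_eq v d j hv (stay hdi hvd) h₁
    rcases h.lab_inj v y d j hv hy (stay hdi hvd) (stay hne.symm hyj) h₂ with rfl | rfl
    · exact hij ⟨v, hv, hvi, hvd⟩
    · exact hij ⟨v, hv, hvi, hyj⟩
  refine h.of_relabel (fun v c d hv hc hd => ?_) fun v w c d hv hw hc hd hm => ?_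
  · by_cases hci : c = i
    · subst hci; rw [alone v d hv hc hd]
    · have hdi : d ≠ i := fun hdi => hci (alone v c hv (hdi ▸ hd) hc)
      rw [Function.update_of_ne hci, Function.update_of_ne hdi]
      exact h.lab_eq v c d hv (stay hci hc) (stay hdi hd)
  · by_cases hci : c = i <;> by_cases hdi : d = i
    · exact .inl (hci.trans hdi.symm)
    · rw [hci, Function.update_self, Function.update_of_ne hdi] at hm
      exact (hf d hdi ⟨w, hw, hd⟩ hm.symm).elim
    · rw [hdi, Function.update_self, Function.update_of_ne hci] at hm
      exact (hf c hci ⟨v, hv, hc⟩ hm).elim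
    · rw [Function.update_of_ne hci, Function.update_of_ne hdi] at hm
      exact h.lab_inj v w c d hv hw (stay hci hc) (stay hdi hd) hm

/-- Since `j` is present and `f` is free, `f ≠ m j`. Both classes are nonempty, which gives not only
a useful node but the stronger `Merging` needed for counting. -/
theorem Realizes.relabel_merge {i j f : Fin k} {ζ : GlueExpr k} (h : (relabel i j φ).Part m W X)
    (hi : φ.Present X i) (hj : φ.Present X j) (hne : i ≠ j) (hf : φ.Free m X i f)
    (hζ : φ.Realizes (Function.update m i f) W X ζ) :
    (relabel i j φ).Realizes m W X (.relabel f (m j) ζ) := by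
  have hfj : f ≠ m j := (hf j hne.symm hj).symm
  have hX : ∀ v, X v → φ.HasVert v := fun v hv => hasVert_relabel.1 (h.vert v hv)
  obtain ⟨x, hx, hxi⟩ := hi
  obtain ⟨y, hy, hyj⟩ := hj
  have ci : (ζ.eval.labelClass f).Nonempty :=
    ⟨x, (hζ.mem_labelClass hX).2 ⟨hx, i, hxi, Function.update_self ..⟩⟩
  have cj : (ζ.eval.labelClass (m j)).Nonempty :=
    ⟨y, (hζ.mem_labelClass hX).2 ⟨hy, j, hyj, Function.update_of_ne hne.symm ..⟩⟩
  obtain ⟨r₁, r₂, r₃, r₄⟩ := hζ.reduced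
  refine ⟨⟨hζ.wellFormed, hfj⟩, ⟨⟨r₁, hfj, ci⟩, r₂, r₃, r₄⟩, ⟨hζ.merging, hfj, ci, cj⟩,
    hζ.verts, hζ.adj, ?_⟩
  rintro v _ hv ⟨d, hd, rfl⟩
  simp only [GlueExpr.eval, LGraph.relabel, hζ.lab v d hv hd]
  by_cases hdi : d = i
  · simp [hdi]
  · rw [Function.update_of_ne hdi, if_neg hdi, if_neg (hf d hdi ⟨v, hv, hd⟩)]

/-! ### Union-nodes -/

/-- The edges of `W` to be created in the left part of a union. -/
def leftEdges (φ ψ : FuseExpr k) (W : ℕ → ℕ → Prop) (u w : ℕ) : Prop :=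
  W u w ∧ φ.Edge u w ∧ ¬ ψ.Edge u w

/-- The edges of `W` to be created in the right part of a union. -/
def rightEdges (ψ : FuseExpr k) (W : ℕ → ℕ → Prop) (u w : ℕ) : Prop :=
  W u w ∧ ψ.Edge u w

/-- The vertices of `X` to be created in the left part of a union. -/
def leftVerts (φ ψ : FuseExpr k) (W : ℕ → ℕ → Prop) (X : ℕ → Prop) (v : ℕ) : Prop :=
  X v ∧ φ.HasVert v ∧ (ψ.HasVert v → ∃ w, φ.leftEdges ψ W v w)

/-- The vertices of `X` to be created in the right part of a union. -/
def rightVerts (φ ψ : FuseExpr k) (W : ℕ → ℕ → Prop) (X : ℕ → Prop) (v : ℕ) : Prop :=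
  X v ∧ ψ.HasVert v ∧ (φ.HasVert v → (∃ w, φ.leftEdges ψ W v w) → ∃ w, ψ.rightEdges W v w)

/-- Handing edges over to the right side might destroy saturation. But if an edge `u' w'` lies in
both parts, then by `Good` its ends share no label with other vertices, so any edge between the same
label classes is that edge itself and was handed over too. -/
theorem Part.of_union_left (h : (union φ ψ).Part m W X) (hg : (union φ ψ).Good) :
    φ.Part m (φ.leftEdges ψ W) (φ.leftVerts ψ W X) where
  vert _ hv := hv.2.1
  edge _ _ hW := hW.2.1
  symm u w := fun ⟨h₁, h₂, h₃⟩ => ⟨h.symm u w h₁, h₂.symm, fun h => h₃ h.symm⟩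
  mem u w hW := ⟨h.mem u w hW.1, hW.2.1.hasVert, fun _ => ⟨w, hW⟩⟩
  saturated u w u' w' a b hW h₁ h₂ h₃ h₄ he := by
    refine ⟨h.saturated u w u' w' a b hW.1 (.inl h₁) (.inl h₂) (.inl h₃) (.inl h₄) (.inl he), he,
      fun he' => hW.2.2 ?_⟩
    rw [hg.2.2 u' u a he.hasVert he'.hasVert (.inl h₃) (.inl h₁),
      hg.2.2 w' w b he.symm.hasVert he'.symm.hasVert (.inl h₄) (.inl h₂)]
    exact he'
  lab_eq v c d hv hc hd := h.lab_eq v c d hv.1 (.inl hc) (.inl hd)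
  lab_inj v w c d hv hw hc hd := h.lab_inj v w c d hv.1 hw.1 (.inl hc) (.inl hd)

theorem Part.of_union_right (h : (union φ ψ).Part m W X) :
    ψ.Part m (ψ.rightEdges W) (φ.rightVerts ψ W X) where
  vert _ hv := hv.2.1
  edge _ _ hW := hW.2
  symm u w := fun ⟨h₁, h₂⟩ => ⟨h.symm u w h₁, h₂.symm⟩
  mem u w hW := ⟨h.mem u w hW.1, hW.2.hasVert, fun _ _ => ⟨w, hW⟩⟩
  saturated u w u' w' a b hW h₁ h₂ h₃ h₄ he :=
    ⟨h.saturated u w u' w' a b hW.1 (.inr h₁) (.inr h₂) (.inr h₃) (.inr h₄) (.inr he), he⟩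
  lab_eq v c d hv hc hd := h.lab_eq v c d hv.1 (.inr hc) (.inr hd)
  lab_inj v w c d hv hw hc hd := h.lab_inj v w c d hv.1 hw.1 (.inr hc) (.inr hd)

theorem Part.edge_iff (h : (union φ ψ).Part m W X) (u w : ℕ) :
    W u w ↔ φ.leftEdges ψ W u w ∨ ψ.rightEdges W u w := by
  have := h.edge u w
  simp only [leftEdges, rightEdges]
  simp only [Edge] at this
  tauto

/-- A vertex available on both sides stays on the left only if it has a left edge; without one the
right side must take it, even if it has no edge there. -/
theorem Part.vert_iff (h : (union φ ψ).Part m W X) (v : ℕ) :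
    X v ↔ φ.leftVerts ψ W X v ∨ φ.rightVerts ψ W X v := by
  have : X v → φ.HasVert v ∨ ψ.HasVert v := fun hv => by
    obtain ⟨c, hc | hc⟩ := h.vert v hv
    · exact .inl ⟨c, hc⟩
    · exact .inr ⟨c, hc⟩
  simp only [leftVerts, rightVerts]
  tauto

/-- If nothing is demanded on the right, the left realization already serves, and no glue-node is
made. -/
theorem Realizes.union_left {ζ : GlueExpr k} (h : (union φ ψ).Part m W X)
    (hζ : φ.Realizes m (φ.leftEdges ψ W) (φ.leftVerts ψ W X) ζ)
    (hr : ¬ ∃ v, φ.rightVerts ψ W X v) : (union φ ψ).Realizes m W X ζ := by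
  have hX : ∀ v, X v ↔ φ.leftVerts ψ W X v := fun v =>
    (h.vert_iff v).trans (or_iff_left fun h => hr ⟨v, h⟩)
  have hW : ∀ u w, W u w ↔ φ.leftEdges ψ W u w := fun u w =>
    (h.edge_iff u w).trans (or_iff_left fun h' => hr ⟨u, h.of_union_right.mem u w h'⟩)
  refine ⟨hζ.wellFormed, hζ.reduced, hζ.merging, fun v => (hζ.verts v).trans (hX v).symm,
    fun u w => (hζ.adj u w).trans (hW u w).symm, fun v c hv hc => ?_⟩
  obtain ⟨d, hd⟩ := ((hX v).1 hv).2.1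
  rw [hζ.lab v d ((hX v).1 hv) hd]
  exact h.lab_eq v d c hv (.inl hd) hc

theorem Realizes.union_right {ζ : GlueExpr k} (h : (union φ ψ).Part m W X)
    (hg : (union φ ψ).Good) (hζ : ψ.Realizes m (ψ.rightEdges W) (φ.rightVerts ψ W X) ζ)
    (hl : ¬ ∃ v, φ.leftVerts ψ W X v) : (union φ ψ).Realizes m W X ζ := by
  have hX : ∀ v, X v ↔ φ.rightVerts ψ W X v := fun v =>
    (h.vert_iff v).trans (or_iff_right fun h => hl ⟨v, h⟩)
  have hW : ∀ u w, W u w ↔ ψ.rightEdges W u w := fun u w =>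
    (h.edge_iff u w).trans (or_iff_right fun h' => hl ⟨u, (h.of_union_left hg).mem u w h'⟩)
  refine ⟨hζ.wellFormed, hζ.reduced, hζ.merging, fun v => (hζ.verts v).trans (hX v).symm,
    fun u w => (hζ.adj u w).trans (hW u w).symm, fun v c hv hc => ?_⟩
  obtain ⟨d, hd⟩ := ((hX v).1 hv).2.1
  rw [hζ.lab v d ((hX v).1 hv) hd]
  exact h.lab_eq v d c hv (.inr hd) hc

/-- Edge-disjointness and incident edges at glue-vertices are built into the split of the demand.
What remains is that a glue-vertex is alone in its label class. -/
theorem Realizes.glue {ζ₁ ζ₂ : GlueExpr k} (h : (union φ ψ).Part m W X)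
    (hg : (union φ ψ).Good) (h₁ : φ.Realizes m (φ.leftEdges ψ W) (φ.leftVerts ψ W X) ζ₁)
    (h₂ : ψ.Realizes m (ψ.rightEdges W) (φ.rightVerts ψ W X) ζ₂) :
    (union φ ψ).Realizes m W X (.glue ζ₁ ζ₂) := by
  have hl := h.of_union_left hg
  have hr := h.of_union_right
  have lab₁ : ∀ v c, φ.leftVerts ψ W X v → (union φ ψ).HasLab v c → ζ₁.eval.lab v = m c := by
    intro v c hv hc
    obtain ⟨d, hd⟩ := hv.2.1
    rw [h₁.lab v d hv hd]
    exact h.lab_eq v d c hv.1 (.inl hd) hc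
  have lab₂ : ∀ v c, φ.rightVerts ψ W X v → (union φ ψ).HasLab v c → ζ₂.eval.lab v = m c := by
    intro v c hv hc
    obtain ⟨d, hd⟩ := hv.2.1
    rw [h₂.lab v d hv hd]
    exact h.lab_eq v d c hv.1 (.inr hd) hc
  -- Equal names mean the same vertex or the same original label. In the second case `Good` applies,
  -- because `v` occurs on both sides.
  have excl : ∀ v w c d, φ.leftVerts ψ W X v → φ.rightVerts ψ W X v → X w →
      (union φ ψ).HasLab v c → (union φ ψ).HasLab w d → m d = m c → w = v := by
    intro v w c d hv hv' hw hc hd hm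
    rcases h.lab_inj w v d c hw hv.1 hd hc hm with rfl | h'
    · exact hg.2.2 v w d hv.2.1 hv'.2.1 hc hd
    · exact h'
  obtain ⟨a₁, a₂, a₃, a₄⟩ := h₁.reduced
  obtain ⟨b₁, b₂, b₃, b₄⟩ := h₂.reduced
  refine ⟨⟨h₁.wellFormed, h₂.wellFormed, ?_⟩, ⟨⟨a₁, b₁⟩, ⟨a₂, b₂⟩, ⟨a₃, b₃, ?_⟩, ⟨a₄, b₄, ?_⟩⟩,
    ⟨h₁.merging, h₂.merging⟩, ?_, ?_, ?_⟩
  · rintro v ⟨hv₁, hv₂⟩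
    rw [h₁.verts] at hv₁
    rw [h₂.verts] at hv₂
    obtain ⟨c, hc⟩ := h.vert v hv₁.1
    rw [lab₁ v c hv₁ hc, lab₂ v c hv₂ hc]
    refine ⟨rfl, Set.eq_singleton_iff_unique_mem.2 ⟨⟨(h₁.verts v).2 hv₁, lab₁ v c hv₁ hc⟩, ?_⟩,
      Set.eq_singleton_iff_unique_mem.2 ⟨⟨(h₂.verts v).2 hv₂, lab₂ v c hv₂ hc⟩, ?_⟩⟩
    · rintro w ⟨hw, hl⟩
      rw [h₁.verts] at hw
      obtain ⟨d, hd⟩ := h.vert w hw.1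
      exact excl v w c d hv₁ hv₂ hw.1 hc hd ((lab₁ w d hw hd).symm.trans hl)
    · rintro w ⟨hw, hl⟩
      rw [h₂.verts] at hw
      obtain ⟨d, hd⟩ := h.vert w hw.1
      exact excl v w c d hv₁ hv₂ hw.1 hc hd ((lab₂ w d hw hd).symm.trans hl)
  · rw [Set.disjoint_left]
    intro e
    induction e using Sym2.ind with
    | _ u w =>
      simp only [SimpleGraph.Subgraph.mem_edgeSet, h₁.adj, h₂.adj]
      exact fun hu hw => hu.2.2 hw.2
  · rintro v ⟨hv₁, hv₂⟩
    rw [h₁.verts] at hv₁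
    rw [h₂.verts] at hv₂
    simp only [h₁.adj, h₂.adj]
    have := hv₁.2.2 hv₂.2.1
    exact ⟨this, hv₂.2.2 hv₁.2.1 this⟩
  · intro v
    simp only [GlueExpr.eval, LGraph.union, SimpleGraph.Subgraph.verts_sup, Set.mem_union, h₁.verts,
      h₂.verts]
    exact (h.vert_iff v).symm
  · intro u w
    simp only [GlueExpr.eval, LGraph.union, SimpleGraph.Subgraph.sup_adj, h₁.adj, h₂.adj]
    exact (h.edge_iff u w).symm
  · intro v c hv hc
    simp only [GlueExpr.eval, LGraph.union]
    split_ifs with hv₁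
    · exact lab₁ v c ((h₁.verts v).1 hv₁) hc
    · exact lab₂ v c (((h.vert_iff v).1 hv).resolve_left (mt (h₁.verts v).2 hv₁)) hc

end FuseExpr

/-! ## Renaming the introduce-nodes by the vertices they are fused into -/

namespace LGraph

variable {k : ℕ} {G : LGraph k} {i : Fin k}

theorem fuseMap_of_mem {v : ℕ} (h : v ∈ G.labelClass i) :
    G.fuseMap i v = sInf (G.labelClass i) := if_pos h

theorem fuseMap_of_notMem {v : ℕ} (h : v ∉ G.labelClass i) : G.fuseMap i v = v := if_neg h

theorem fuseMap_mem {v : ℕ} (h : v ∈ G.graph.verts) : G.fuseMap i v ∈ G.graph.verts := by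
  by_cases hv : v ∈ G.labelClass i
  · rw [fuseMap_of_mem hv]
    exact (Nat.sInf_mem ⟨v, hv⟩).1
  · rwa [fuseMap_of_notMem hv]

theorem lab_fuseMap (v : ℕ) : G.lab (G.fuseMap i v) = G.lab v := by
  by_cases hv : v ∈ G.labelClass i
  · rw [fuseMap_of_mem hv, (Nat.sInf_mem ⟨v, hv⟩).2, hv.2]
  · rw [fuseMap_of_notMem hv]

theorem fuseMap_le (v : ℕ) : G.fuseMap i v ≤ v := by
  by_cases hv : v ∈ G.labelClass i
  · rw [fuseMap_of_mem hv]
    exact Nat.sInf_le hv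
  · rw [fuseMap_of_notMem hv]

end LGraph

namespace FuseExpr

variable {k : ℕ}

theorem verts_subset_titles (φ : FuseExpr k) {v : ℕ} (h : v ∈ φ.eval.graph.verts) :
    v ∈ φ.titles := by
  induction φ generalizing v with
  | intro u i => simpa [eval, LGraph.single, titles] using h
  | union φ ψ h₁ h₂ => exact List.mem_append.2 (h.imp h₁ h₂)
  | join i j φ ih => exact ih h
  | relabel i j φ ih => exact ih h
  | fuse i φ ih =>
    obtain ⟨u, hu, rfl⟩ := h
    exact ih (LGraph.fuseMap_mem hu)

/-- The label of a vertex is that of the introduce-node with its title. -/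
theorem hasLab_lab (φ : FuseExpr k) {v : ℕ} (h : v ∈ φ.eval.graph.verts) :
    φ.HasLab v (φ.eval.lab v) := by
  induction φ generalizing v with
  | intro u i => exact ⟨by simpa [eval, LGraph.single] using h, rfl⟩
  | union φ ψ h₁ h₂ =>
    simp only [eval, LGraph.union]
    split_ifs with hv
    · exact .inl (h₁ hv)
    · exact .inr (h₂ (h.resolve_left hv))
  | join i j φ ih => exact ih h
  | relabel i j φ ih => exact ⟨_, ih h, rfl⟩
  | fuse i φ ih =>
    obtain ⟨u, hu, rfl⟩ := h
    exact ih (LGraph.fuseMap_mem hu)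

/-- Fusing replaces a vertex by the least one of its class, so labels persist and representatives
only decrease. Consequently the least vertex of a class is computable from the titles, without
evaluating the graph. -/
theorem exists_le_of_hasLab {φ : FuseExpr k} (hφ : φ.WellFormed) {v : ℕ} {c : Fin k}
    (h : φ.HasLab v c) : ∃ u ∈ φ.eval.labelClass c, u ≤ v := by
  induction φ generalizing v c with
  | intro u i =>
    obtain ⟨rfl, rfl⟩ := h
    exact ⟨v, ⟨by simp [eval, LGraph.single], rfl⟩, le_rfl⟩
  | union φ ψ h₁ h₂ =>
    rcases h with h | h
    · obtain ⟨u, ⟨hu, hl⟩, hle⟩ := h₁ hφ.1 h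
      exact ⟨u, ⟨.inl hu, by simpa [eval, LGraph.union, hu] using hl⟩, hle⟩
    · obtain ⟨u, ⟨hu, hl⟩, hle⟩ := h₂ hφ.2.1 h
      have := Set.disjoint_right.1 hφ.2.2 hu
      exact ⟨u, ⟨.inr hu, by simpa [eval, LGraph.union, this] using hl⟩, hle⟩
  | join i j φ ih => exact ih hφ.1 h
  | relabel i j φ ih =>
    obtain ⟨d, hd, rfl⟩ := h
    obtain ⟨u, ⟨hu, rfl⟩, hle⟩ := ih hφ.1 hd
    exact ⟨u, ⟨hu, rfl⟩, hle⟩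
  | fuse i φ ih =>
    obtain ⟨u, ⟨hu, hl⟩, hle⟩ := ih hφ.1 h
    exact ⟨_, ⟨⟨u, hu, rfl⟩, (LGraph.lab_fuseMap u).trans hl⟩, (LGraph.fuseMap_le u).trans hle⟩

/-- The least vertex with a label is the least title with that label. -/
theorem isLeast_sInf_labelClass {φ : FuseExpr k} (hφ : φ.WellFormed) {i : Fin k}
    (hi : (φ.eval.labelClass i).Nonempty) :
    IsLeast {v | φ.HasLab v i} (sInf (φ.eval.labelClass i)) := by
  refine ⟨?_, fun v hv => ?_⟩
  · obtain ⟨h, h'⟩ := Nat.sInf_mem hi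
    have := hasLab_lab φ h
    rwa [h'] at this
  · obtain ⟨u, hu, hle⟩ := exists_le_of_hasLab hφ hv
    exact (Nat.sInf_le hu).trans hle

/-- Give every introduce-node the title of the vertex it is fused into, where the vertices with
label `c` at the root are fused into `s c`, if that is defined. -/
noncomputable def rename : FuseExpr k → (Fin k → Option ℕ) → FuseExpr k
  | intro v i, s => intro ((s i).getD v) i
  | union φ ψ, s => union (φ.rename s) (ψ.rename s)
  | join i j φ, s => join i j (φ.rename s)
  | relabel i j φ, s => relabel i j (φ.rename (Function.update s i (s j)))
  | fuse i φ, s => fuse i (φ.rename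
      (Function.update s i (some ((s i).getD (sInf (φ.eval.labelClass i))))))

/-- The vertex that `v` is fused into, where the vertices with label `c` are fused into `s c`. -/
noncomputable def newName (φ : FuseExpr k) (s : Fin k → Option ℕ) (v : ℕ) : ℕ := (s (φ.eval.lab v)).getD v

theorem newName_relabel {φ : FuseExpr k} {i j : Fin k} (s : Fin k → Option ℕ) (v : ℕ) :
    φ.newName (Function.update s i (s j)) v = (relabel i j φ).newName s v := by
  simp only [newName, eval, LGraph.relabel]
  split_ifs with h
  · simp [h]
  · simp [h]

theorem newName_fuse {φ : FuseExpr k} {i : Fin k} (s : Fin k → Option ℕ) {v : ℕ}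
    (hv : v ∈ φ.eval.graph.verts) :
    φ.newName (Function.update s i (some ((s i).getD (sInf (φ.eval.labelClass i))))) v =
      (fuse i φ).newName s (φ.eval.fuseMap i v) := by
  simp only [newName, eval, LGraph.fuse, LGraph.lab_fuseMap]
  by_cases h : φ.eval.lab v = i
  · rw [LGraph.fuseMap_of_mem ⟨hv, h⟩, h, Function.update_self, Option.getD_some]
  · rw [LGraph.fuseMap_of_notMem fun h' => h h'.2, Function.update_of_ne h]

theorem newName_union_left {φ ψ : FuseExpr k} (s : Fin k → Option ℕ) {v : ℕ}
    (hv : v ∈ φ.eval.graph.verts) : (union φ ψ).newName s v = φ.newName s v := by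
  simp [newName, eval, LGraph.union, hv]

theorem newName_union_right {φ ψ : FuseExpr k} (s : Fin k → Option ℕ) {v : ℕ}
    (hd : Disjoint φ.eval.graph.verts ψ.eval.graph.verts)
    (hv : v ∈ ψ.eval.graph.verts) : (union φ ψ).newName s v = ψ.newName s v := by
  simp [newName, eval, LGraph.union, Set.disjoint_right.1 hd hv]

theorem hasLab_rename {φ : FuseExpr k} (hφ : φ.WellFormed) (s : Fin k → Option ℕ) (x : ℕ)
    (c : Fin k) : (φ.rename s).HasLab x c ↔
      ∃ v ∈ φ.eval.graph.verts, φ.newName s v = x ∧ φ.eval.lab v = c := by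
  induction φ generalizing s c with
  | intro u i =>
    simp only [rename, HasLab, eval, LGraph.single, newName,
      SimpleGraph.singletonSubgraph_verts, Set.mem_singleton_iff, exists_eq_left]
    exact and_congr eq_comm eq_comm
  | union φ ψ h₁ h₂ =>
    simp only [rename, HasLab, h₁ hφ.1, h₂ hφ.2.1]
    have hd := hφ.2.2
    constructor
    · rintro (⟨v, hv, rfl, rfl⟩ | ⟨v, hv, rfl, rfl⟩)
      · exact ⟨v, .inl hv, newName_union_left s hv, by simp [eval, LGraph.union, hv]⟩
      · exact ⟨v, .inr hv, newName_union_right s hd hv,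
          by simp [eval, LGraph.union, Set.disjoint_right.1 hd hv]⟩
    · rintro ⟨v, hv | hv, rfl, rfl⟩
      · exact .inl ⟨v, hv, (newName_union_left s hv).symm, by simp [eval, LGraph.union, hv]⟩
      · exact .inr ⟨v, hv, (newName_union_right s hd hv).symm,
          by simp [eval, LGraph.union, Set.disjoint_right.1 hd hv]⟩
  | join i j φ ih => exact ih hφ.1 s c
  | relabel i j φ ih =>
    simp only [rename, HasLab, ih hφ.1, newName_relabel]
    constructor
    · rintro ⟨_, ⟨v, hv, rfl, rfl⟩, rfl⟩
      exact ⟨v, hv, rfl, rfl⟩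
    · rintro ⟨v, hv, rfl, rfl⟩
      exact ⟨_, ⟨v, hv, rfl, rfl⟩, rfl⟩
  | fuse i φ ih =>
    simp only [rename, HasLab, ih hφ.1]
    constructor
    · rintro ⟨v, hv, rfl, rfl⟩
      exact ⟨_, ⟨v, hv, rfl⟩, (newName_fuse s hv).symm, LGraph.lab_fuseMap v⟩
    · rintro ⟨_, ⟨v, hv, rfl⟩, rfl, rfl⟩
      exact ⟨v, hv, newName_fuse s hv, (LGraph.lab_fuseMap v).symm⟩

/-- The condition `x ≠ y` discards edges whose ends get fused; this matches both the loop-free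
`Edge` and the definition of `LGraph.fuse`. -/
theorem edge_rename {φ : FuseExpr k} (hφ : φ.WellFormed) (s : Fin k → Option ℕ) (x y : ℕ) :
    (φ.rename s).Edge x y ↔ x ≠ y ∧
      ∃ u v, φ.eval.graph.Adj u v ∧ φ.newName s u = x ∧ φ.newName s v = y := by
  induction φ generalizing s with
  | intro u i => simp [rename, Edge, eval, LGraph.single]
  | union φ ψ h₁ h₂ =>
    simp only [rename, Edge, h₁ hφ.1, h₂ hφ.2.1]
    have hd := hφ.2.2
    constructor
    · rintro (⟨hne, u, v, h, rfl, rfl⟩ | ⟨hne, u, v, h, rfl, rfl⟩)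
      · exact ⟨hne, u, v, .inl h, newName_union_left s (φ.eval.graph.edge_vert h),
          newName_union_left s (φ.eval.graph.edge_vert h.symm)⟩
      · exact ⟨hne, u, v, .inr h, newName_union_right s hd (ψ.eval.graph.edge_vert h),
          newName_union_right s hd (ψ.eval.graph.edge_vert h.symm)⟩
    · rintro ⟨hne, u, v, h | h, rfl, rfl⟩
      · exact .inl ⟨hne, u, v, h, (newName_union_left s (φ.eval.graph.edge_vert h)).symm,
          (newName_union_left s (φ.eval.graph.edge_vert h.symm)).symm⟩
      · exact .inr ⟨hne, u, v, h, (newName_union_right s hd (ψ.eval.graph.edge_vert h)).symm,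
          (newName_union_right s hd (ψ.eval.graph.edge_vert h.symm)).symm⟩
  | join i j φ ih =>
    simp only [rename, Edge, ih hφ.1, Crosses, hasLab_rename hφ.1]
    constructor
    · rintro (⟨hne, u, v, h, rfl, rfl⟩ | ⟨hne, ⟨⟨u, hu, rfl, rfl⟩, v, hv, rfl, rfl⟩ |
        ⟨⟨u, hu, rfl, rfl⟩, v, hv, rfl, rfl⟩⟩)
      · exact ⟨hne, u, v, .inl h, rfl, rfl⟩
      · exact ⟨hne, u, v, .inr ⟨fun h => hne (h ▸ rfl), .inl ⟨⟨hu, rfl⟩, hv, rfl⟩⟩, rfl, rfl⟩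
      · exact ⟨hne, u, v, .inr ⟨fun h => hne (h ▸ rfl), .inr ⟨⟨hu, rfl⟩, hv, rfl⟩⟩, rfl, rfl⟩
    · rintro ⟨hne, u, v, h | ⟨-, ⟨⟨hu, rfl⟩, hv, rfl⟩ | ⟨⟨hu, rfl⟩, hv, rfl⟩⟩, rfl, rfl⟩
      · exact .inl ⟨hne, u, v, h, rfl, rfl⟩
      · exact .inr ⟨hne, .inl ⟨⟨u, hu, rfl, rfl⟩, v, hv, rfl, rfl⟩⟩
      · exact .inr ⟨hne, .inr ⟨⟨u, hu, rfl, rfl⟩, v, hv, rfl, rfl⟩⟩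
  | relabel i j φ ih =>
    simp only [rename, Edge, ih hφ.1, newName_relabel]
    rfl
  | fuse i φ ih =>
    simp only [rename, Edge, ih hφ.1]
    refine and_congr_right fun hne => ?_
    constructor
    · rintro ⟨u, v, h, rfl, rfl⟩
      have hu := newName_fuse (i := i) s (φ.eval.graph.edge_vert h)
      have hv := newName_fuse (i := i) s (φ.eval.graph.edge_vert h.symm)
      exact ⟨_, _, ⟨fun he => hne (by rw [hu, hv, he]), u, v, h, rfl, rfl⟩, hu.symm, hv.symm⟩
    · rintro ⟨_, _, ⟨_, u, v, h, rfl, rfl⟩, rfl, rfl⟩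
      exact ⟨u, v, h, newName_fuse s (φ.eval.graph.edge_vert h),
        newName_fuse s (φ.eval.graph.edge_vert h.symm)⟩

/-- The names in `s` do not clash with vertices of `φ` that are not fused into them. -/
def Fresh (φ : FuseExpr k) (s : Fin k → Option ℕ) : Prop :=
  ∀ y ∈ φ.titles, ∀ c, s c = some y → y ∈ φ.eval.graph.verts ∧ s (φ.eval.lab y) = some y

/-- Two different vertices can receive one name only by lying in label classes destined to be fused
into it, and then all vertices of those classes receive that name. `Fresh` prevents a clash with an
unrelated vertex that has this name as its own title. -/
theorem good_rename {φ : FuseExpr k} (hφ : φ.WellFormed) (ht : φ.titles.Nodup)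
    (s : Fin k → Option ℕ) (hs : φ.Fresh s) : (φ.rename s).Good := by
  induction φ generalizing s with
  | intro u i => trivial
  | union φ ψ h₁ h₂ =>
    have hlab : (rename (union φ ψ) s) = union (φ.rename s) (ψ.rename s) := rfl
    obtain ⟨t₁, t₂, t₃⟩ := List.nodup_append.1 ht
    have hd := hφ.2.2
    refine ⟨h₁ hφ.1 t₁ s fun y hy c hc => ?_, h₂ hφ.2.1 t₂ s fun y hy c hc => ?_, ?_⟩
    · obtain ⟨hv, hl⟩ := hs y (List.mem_append.2 (.inl hy)) c hc
      have hv := hv.resolve_right fun hv => t₃ y hy y (verts_subset_titles ψ hv) rfl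
      exact ⟨hv, by simpa [eval, LGraph.union, hv] using hl⟩
    · obtain ⟨hv, hl⟩ := hs y (List.mem_append.2 (.inr hy)) c hc
      have hv := hv.resolve_left fun hv => t₃ y (verts_subset_titles φ hv) y hy rfl
      exact ⟨hv, by simpa [eval, LGraph.union, Set.disjoint_right.1 hd hv] using hl⟩
    · rintro x y c ⟨c₁, hx₁⟩ ⟨c₂, hx₂⟩ hx hy
      rw [← hlab, hasLab_rename hφ] at hx hy
      rw [hasLab_rename hφ.1] at hx₁
      rw [hasLab_rename hφ.2.1] at hx₂
      obtain ⟨z, hz, hzx, rfl⟩ := hx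
      obtain ⟨z', hz', hzy, hl⟩ := hy
      simp only [newName, hl] at hzx hzy
      cases hc : s ((union φ ψ).eval.lab z) with
      | some n => rw [hc] at hzx hzy; exact hzy.symm.trans hzx
      | none =>
        exfalso
        rw [hc] at hzx hzy
        simp only [Option.getD_none] at hzx
        subst hzx
        have clash : ∀ c, s c ≠ some z := fun c h => by
          have := (hs z (verts_subset_titles _ hz) c h).2
          rw [hc] at this
          exact Option.some_ne_none z this.symm
        have fixed : ∀ (χ : FuseExpr k) v, χ.newName s v = z → v = z := fun χ v h => by
          unfold newName at h
          cases hv : s (χ.eval.lab v) with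
          | none => rw [hv] at h; exact h
          | some n =>
            rw [hv, Option.getD_some] at h
            exact (clash _ (h ▸ hv)).elim
        obtain ⟨u, hu, hu', -⟩ := hx₁
        obtain ⟨v, hv, hv', -⟩ := hx₂
        rw [fixed φ u hu'] at hu
        rw [fixed ψ v hv'] at hv
        exact Set.disjoint_left.1 hd hu hv
  | join i j φ ih => exact ⟨ih hφ.1 ht s hs, hφ.2⟩
  | relabel i j φ ih =>
    have hupd : ∀ c, Function.update s i (s j) c = s (if c = i then j else c) := fun c => by
      by_cases hc : c = i
      · subst hc; simp
      · simp [hc]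
    refine ⟨ih hφ.1 ht _ fun y hy c hc => ?_, hφ.2, ?_⟩
    · rw [hupd] at hc ⊢
      exact hs y hy _ hc
    · intro x y hxi hxj hy
      rw [hasLab_rename hφ.1] at hxi hxj
      obtain ⟨u, hu, hux, hui⟩ := hxi
      obtain ⟨v, hv, hvx, hvj⟩ := hxj
      simp only [newName, hui, hvj, hupd, if_true, if_neg hφ.2.symm] at hux hvx
      -- Without a name for `j`, the vertices `u` and `v` keep their titles and coincide, yet have
      -- different labels. With a name, both classes are entirely fused into it.
      cases hj : s j with
      | none =>
        rw [hj] at hux hvx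
        simp only [Option.getD_none] at hux hvx
        subst hux hvx
        exact (hφ.2 (hui.symm.trans hvj)).elim
      | some n =>
        rw [hj, Option.getD_some] at hvx
        subst hvx
        rw [hasLab_rename hφ.1, hasLab_rename hφ.1] at hy
        obtain ⟨w, -, hw, hl⟩ | ⟨w, -, hw, hl⟩ := hy <;>
          simp only [newName, hl, hupd, if_true, if_neg hφ.2.symm] at hw <;>
          rw [hj, Option.getD_some] at hw <;>
          exact hw.symm
  | fuse i φ ih =>
    refine ih hφ.1 ht _ fun y hy c hc => ?_
    have old : ∀ c, s c = some y → y ∈ φ.eval.graph.verts ∧ Function.update s i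
        (some ((s i).getD (sInf (φ.eval.labelClass i)))) (φ.eval.lab y) = some y := by
      intro c hc
      obtain ⟨⟨u, hu, hv⟩, hl⟩ := hs y hy c hc
      refine ⟨hv ▸ LGraph.fuseMap_mem hu, ?_⟩
      have hl : s (φ.eval.lab y) = some y := hl
      by_cases h : φ.eval.lab y = i
      · rw [h] at hl ⊢
        rw [Function.update_self, hl, Option.getD_some]
      · rw [Function.update_of_ne h, hl]
    by_cases hci : c = i
    · subst hci
      rw [Function.update_self, Option.some_inj] at hc
      cases hsc : s c with
      | some n =>
        rw [hsc, Option.getD_some] at hc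
        have := old c (hc ▸ hsc)
        rwa [hsc] at this
      -- The new name is the least vertex of the class, so it is a vertex of `φ` with label `c` and
      -- is sent to itself.
      | none =>
        rw [hsc, Option.getD_none] at hc
        obtain ⟨h₁, h₂⟩ := Nat.sInf_mem hφ.2
        rw [hc] at h₁ h₂
        rw [h₂, Function.update_self, Option.getD_none, hc]
        exact ⟨h₁, rfl⟩
    · rw [Function.update_of_ne hci] at hc
      exact old c hc

/-! ### The renamed expression at the root -/

variable {φ : FuseExpr k}

theorem good_rename_none (hφ : φ.WellFormed) (ht : φ.titles.Nodup) :
    (φ.rename fun _ => none).Good :=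
  good_rename hφ ht _ fun _ _ _ h => (Option.some_ne_none _ h.symm).elim

theorem hasLab_rename_none (hφ : φ.WellFormed) (x : ℕ) (c : Fin k) :
    (φ.rename fun _ => none).HasLab x c ↔ x ∈ φ.eval.graph.verts ∧ φ.eval.lab x = c := by
  simp [hasLab_rename hφ, newName]

theorem edge_rename_none (hφ : φ.WellFormed) (x y : ℕ) :
    (φ.rename fun _ => none).Edge x y ↔ φ.eval.graph.Adj x y := by
  simp only [edge_rename hφ, newName, Option.getD_none]
  exact ⟨fun ⟨_, _, _, h, h₁, h₂⟩ => h₁ ▸ h₂ ▸ h, fun h => ⟨h.ne, x, y, h, rfl, rfl⟩⟩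

/-- At the root all copies have been fused, so each vertex has one label. The initial demand is
everything, with the identity as renaming. -/
theorem part_rename_none (hφ : φ.WellFormed) :
    (φ.rename fun _ => none).Part id (φ.rename fun _ => none).Edge
      (φ.rename fun _ => none).HasVert where
  vert _ h := h
  edge _ _ h := h
  symm _ _ h := h.symm
  mem _ _ h := h.hasVert
  saturated _ _ _ _ _ _ _ _ _ _ _ h := h
  lab_eq v c d _ hc hd := by
    rw [hasLab_rename_none hφ] at hc hd
    exact hc.2.symm.trans hd.2
  lab_inj _ _ _ _ _ _ _ _ h := .inl h

theorem Realizes.equivalent {ζ : GlueExpr k} (hφ : φ.WellFormed)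
    (h : (φ.rename fun _ => none).Realizes id (φ.rename fun _ => none).Edge
      (φ.rename fun _ => none).HasVert ζ) :
    ζ.eval.graph = φ.eval.graph ∧ φ.eval.Equivalent ζ.eval := by
  have hv : ∀ v, (φ.rename fun _ => none).HasVert v ↔ v ∈ φ.eval.graph.verts := fun v => by
    simp [HasVert, hasLab_rename_none hφ]
  have hg : ζ.eval.graph = φ.eval.graph := by
    refine SimpleGraph.Subgraph.ext ?_ ?_
    · ext v
      rw [h.verts, hv]
    · ext u w
      rw [h.adj, edge_rename_none hφ]
  refine ⟨hg, ?_⟩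
  have hl : ∀ v ∈ φ.eval.graph.verts, ζ.eval.lab v = φ.eval.lab v := fun v hv' =>
    h.lab v _ ((hv v).2 hv') ((hasLab_rename_none hφ v _).2 ⟨hv', rfl⟩)
  -- The graphs are equal but the isomorphism lives on dependent types; generalizing the evaluated
  -- graph permits substitution.
  revert hg hl
  generalize ζ.eval = G
  obtain ⟨g, l⟩ := G
  intro hg hl
  simp only at hg
  subst hg
  exact ⟨SimpleGraph.Iso.refl, fun v => hl v v.2⟩

end FuseExpr

/-! ## The size of reduced glue-expressions -/

namespace GlueExpr

variable {k : ℕ}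

/-- The number of introduce-nodes with title `v`. -/
def count (v : ℕ) : GlueExpr k → ℕ
  | intro u _ => if u = v then 1 else 0
  | glue ξ χ => ξ.count v + χ.count v
  | join _ _ ξ => ξ.count v
  | relabel _ _ ξ => ξ.count v

/-- The number of introduce-nodes. -/
def leaves : GlueExpr k → ℕ
  | intro _ _ => 1
  | glue ξ χ => ξ.leaves + χ.leaves
  | join _ _ ξ => ξ.leaves
  | relabel _ _ ξ => ξ.leaves

/-- The number of join-nodes. -/
def joins : GlueExpr k → ℕ
  | intro _ _ => 0
  | glue ξ χ => ξ.joins + χ.joins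
  | join _ _ ξ => 1 + ξ.joins
  | relabel _ _ ξ => ξ.joins

/-- The number of relabel-nodes. -/
def relabels : GlueExpr k → ℕ
  | intro _ _ => 0
  | glue ξ χ => ξ.relabels + χ.relabels
  | join _ _ ξ => ξ.relabels
  | relabel _ _ ξ => 1 + ξ.relabels

theorem nodes_add_one (ξ : GlueExpr k) :
    ξ.nodes + 1 = 2 * ξ.leaves + ξ.joins + ξ.relabels := by
  induction ξ with
  | intro v i => rfl
  | glue ξ χ h₁ h₂ => simp only [nodes, leaves, joins, relabels]; omega
  | join i j ξ ih => simp only [nodes, leaves, joins, relabels]; omega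
  | relabel i j ξ ih => simp only [nodes, leaves, joins, relabels]; omega

theorem finite_verts (ξ : GlueExpr k) : ξ.eval.graph.verts.Finite := by
  induction ξ with
  | intro v i => simp [eval, LGraph.single]
  | glue ξ χ h₁ h₂ => exact h₁.union h₂
  | join i j ξ ih => exact ih
  | relabel i j ξ ih => exact ih

theorem finite_neighborSet (ξ : GlueExpr k) (v : ℕ) : (ξ.eval.graph.neighborSet v).Finite :=
  ξ.finite_verts.subset (ξ.eval.graph.neighborSet_subset_verts v)

theorem finite_edgeSet (ξ : GlueExpr k) : ξ.eval.graph.edgeSet.Finite := by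
  have := (ξ.finite_verts.prod ξ.finite_verts).image fun p : ℕ × ℕ => s(p.1, p.2)
  refine this.subset fun e => ?_
  induction e using Sym2.ind with
  | _ u w =>
    intro h
    exact ⟨(u, w), ⟨ξ.eval.graph.edge_vert h, ξ.eval.graph.edge_vert (SimpleGraph.Subgraph.Adj.symm h)⟩, rfl⟩

/-- A join-node adds at least one edge, and at a glue-node the edge counts add up exactly. -/
theorem joins_le (ξ : GlueExpr k) (h₁ : ξ.NoUseless) (h₂ : ξ.GluesEdgeDisjoint) :
    ξ.joins ≤ ξ.eval.graph.edgeSet.ncard := by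
  induction ξ with
  | intro v i => simp [joins]
  | glue ξ χ ih₁ ih₂ =>
    have : (glue ξ χ).eval.graph.edgeSet = ξ.eval.graph.edgeSet ∪ χ.eval.graph.edgeSet := by
      simp [eval, LGraph.union]
    rw [this, Set.ncard_union_eq h₂.2.2 ξ.finite_edgeSet χ.finite_edgeSet]
    exact add_le_add (ih₁ h₁.1 h₂.1) (ih₂ h₁.2 h₂.2.1)
  | join i j ξ ih =>
    obtain ⟨h₁, v, hv, w, hw, hne, hadj⟩ := h₁
    have hlt : ξ.eval.graph.edgeSet ⊂ (join i j ξ).eval.graph.edgeSet := by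
      refine (Set.ssubset_iff_of_subset ?_).2 ⟨s(v, w), ?_, hadj⟩
      · intro e
        induction e using Sym2.ind with
        | _ a b => exact fun h => Or.inl h
      · exact Or.inr ⟨hne, .inl ⟨hv, hw⟩⟩
    have := Set.ncard_lt_ncard hlt (join i j ξ).finite_edgeSet
    have := ih h₁ h₂
    simp only [joins]
    omega
  | relabel i j ξ ih => exact ih h₁.1 h₂

/-- The labels that occur. -/
def usedLabels (ξ : GlueExpr k) : Set (Fin k) := ξ.eval.lab '' ξ.eval.graph.verts

/-- A leaf contributes one used label, gluing adds at most the two numbers, and a merging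
relabel-node loses at least one. Here `NoUseless` would not suffice: it permits moving a class to an
unused label. -/
theorem relabels_le (ξ : GlueExpr k) (h : ξ.Merging) :
    ξ.relabels + ξ.usedLabels.ncard ≤ ξ.leaves := by
  induction ξ with
  | intro v i => simp [relabels, leaves, usedLabels, eval, LGraph.single]
  | glue ξ χ h₁ h₂ =>
    have hsub : (glue ξ χ).usedLabels ⊆ ξ.usedLabels ∪ χ.usedLabels := by
      rintro _ ⟨v, hv, rfl⟩
      simp only [eval, LGraph.union]
      split_ifs with hv'
      · exact .inl ⟨v, hv', rfl⟩
      · exact .inr ⟨v, hv.resolve_left hv', rfl⟩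
    have := (Set.ncard_le_ncard hsub (Set.toFinite _)).trans (Set.ncard_union_le _ _)
    have := h₁ h.1
    have := h₂ h.2
    simp only [relabels, leaves]
    omega
  | join i j ξ ih => exact ih h
  | relabel i j ξ ih =>
    obtain ⟨h, hij, ⟨v, hv, hvi⟩, w, hw, hwj⟩ := h
    have hlt : (relabel i j ξ).usedLabels ⊂ ξ.usedLabels := by
      refine (Set.ssubset_iff_of_subset ?_).2 ⟨i, ⟨v, hv, hvi⟩, ?_⟩
      · rintro _ ⟨u, hu, rfl⟩
        simp only [eval, LGraph.relabel]
        split_ifs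
        · exact ⟨w, hw, hwj⟩
        · exact ⟨u, hu, rfl⟩
      · rintro ⟨u, hu, h⟩
        simp only [eval, LGraph.relabel] at h
        split_ifs at h with h'
        · exact hij h.symm
        · exact h' h
    have := Set.ncard_lt_ncard hlt (Set.toFinite _)
    have := ih h
    simp only [relabels, leaves]
    omega

theorem count_eq_zero (ξ : GlueExpr k) {v : ℕ} (h : v ∉ ξ.eval.graph.verts) : ξ.count v = 0 := by
  induction ξ with
  | intro u i =>
    have : v ≠ u := by simpa [eval, LGraph.single] using h
    simp [count, this.symm]
  | glue ξ χ h₁ h₂ =>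
    simp only [count, h₁ fun h' => h (.inl h'), h₂ fun h' => h (.inr h')]
  | join i j ξ ih => exact ih h
  | relabel i j ξ ih => exact ih h

/-- When both sides of a glue-node contain `v`, it has positive degree in each, so the maximum with
1 plays no role there, and the degrees add up by edge-disjointness. -/
theorem count_le (ξ : GlueExpr k) (h₁ : ξ.GluesEdgeDisjoint) (h₂ : ξ.GlueVerticesIncident)
    (v : ℕ) : ξ.count v ≤ max 1 (ξ.eval.graph.neighborSet v).ncard := by
  induction ξ with
  | intro u i =>
    simp only [count]
    split_ifs <;> simp
  | glue ξ χ ih₁ ih₂ =>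
    have hn : (glue ξ χ).eval.graph.neighborSet v =
        ξ.eval.graph.neighborSet v ∪ χ.eval.graph.neighborSet v := by
      simp [eval, LGraph.union]
    have hd : Disjoint (ξ.eval.graph.neighborSet v) (χ.eval.graph.neighborSet v) :=
      Set.disjoint_left.2 fun w hw hw' =>
        (Set.disjoint_left.1 h₁.2.2 : _) (show s(v, w) ∈ ξ.eval.graph.edgeSet from hw) hw'
    rw [hn, Set.ncard_union_eq hd (ξ.finite_neighborSet v) (χ.finite_neighborSet v)]
    have i₁ := ih₁ h₁.1 h₂.1
    have i₂ := ih₂ h₁.2.1 h₂.2.1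
    simp only [count]
    by_cases hv₁ : v ∈ ξ.eval.graph.verts
    · by_cases hv₂ : v ∈ χ.eval.graph.verts
      · obtain ⟨⟨w₁, hw₁⟩, w₂, hw₂⟩ := h₂.2.2 v ⟨hv₁, hv₂⟩
        have p₁ := (Set.ncard_pos (ξ.finite_neighborSet v)).2 ⟨w₁, hw₁⟩
        have p₂ := (Set.ncard_pos (χ.finite_neighborSet v)).2 ⟨w₂, hw₂⟩
        omega
      · have := χ.count_eq_zero hv₂
        omega
    · have := ξ.count_eq_zero hv₁
      omega
  | join i j ξ ih =>
    refine (ih h₁ h₂).trans (max_le_max le_rfl (Set.ncard_le_ncard ?_ (finite_neighborSet _ v)))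
    exact fun w hw => Or.inl hw
  | relabel i j ξ ih => exact ih h₁ h₂

theorem leaves_eq (ξ : GlueExpr k) (s : Finset ℕ) (hs : ξ.eval.graph.verts ⊆ s) :
    ξ.leaves = ∑ v ∈ s, ξ.count v := by
  induction ξ with
  | intro u i =>
    have : u ∈ s := by simpa [eval, LGraph.single] using hs
    simp [leaves, count, this]
  | glue ξ χ h₁ h₂ =>
    simp only [leaves, count, Finset.sum_add_distrib]
    rw [← h₁ (Set.subset_union_left.trans hs), ← h₂ (Set.subset_union_right.trans hs)]
  | join i j ξ ih => exact ih hs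
  | relabel i j ξ ih => exact ih hs

theorem sum_ncard_neighborSet {V : Type*} [Fintype V] (H : SimpleGraph V) :
    ∑ v, (H.neighborSet v).ncard = 2 * H.edgeSet.ncard := by
  classical
  rw [Set.ncard_eq_toFinset_card' H.edgeSet]
  have := H.sum_degrees_eq_twice_card_edges
  simp only [SimpleGraph.edgeFinset] at this
  rw [← this]
  exact Finset.sum_congr rfl fun v _ => by
    rw [Set.ncard_eq_toFinset_card', ← SimpleGraph.card_neighborFinset_eq_degree]
    rfl

/-- Summing `count_le` over the vertices gives at most `n + 2 * m` leaves. With at most `m` joins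
and no more relabels than leaves, the total is at most `3 * n + 7 * m`. -/
theorem nodes_le (ξ : GlueExpr k) (h : ξ.Reduced) (hm : ξ.Merging) {V : Type*}
    (H : SimpleGraph V) (e : ξ.eval.graph.coe ≃g H) :
    ξ.nodes ≤ 7 * (H.edgeSet.ncard + Nat.card V) := by
  have hfin := ξ.finite_verts
  have : Fintype ξ.eval.graph.verts := hfin.fintype
  have hV : Nat.card V = ξ.eval.graph.verts.ncard := by
    rw [← Nat.card_congr e.toEquiv]; rfl
  have hE : H.edgeSet.ncard = ξ.eval.graph.coe.edgeSet.ncard := by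
    rw [← Nat.card_coe_set_eq, ← Nat.card_coe_set_eq]
    exact (Nat.card_congr e.mapEdgeSet).symm
  have hE' : ξ.eval.graph.edgeSet.ncard = ξ.eval.graph.coe.edgeSet.ncard := by
    rw [← SimpleGraph.Subgraph.image_coe_edgeSet_coe,
      Set.ncard_image_of_injective _ (Sym2.map.injective Subtype.val_injective)]
  have hdeg : ∀ v : ξ.eval.graph.verts,
      (ξ.eval.graph.neighborSet v).ncard = (ξ.eval.graph.coe.neighborSet v).ncard := fun v => by
    rw [← Nat.card_coe_set_eq, ← Nat.card_coe_set_eq]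
    exact (Nat.card_congr (SimpleGraph.Subgraph.coeNeighborSetEquiv v)).symm
  have hl : ξ.leaves ≤ ξ.eval.graph.verts.ncard + 2 * ξ.eval.graph.coe.edgeSet.ncard := by
    rw [ξ.leaves_eq hfin.toFinset (by simp), ← sum_ncard_neighborSet,
      Finset.sum_subtype hfin.toFinset (p := (· ∈ ξ.eval.graph.verts)) (by simp),
      ← Nat.card_coe_set_eq, Nat.card_eq_fintype_card, Fintype.card_eq_sum_ones,
      ← Finset.sum_add_distrib]
    refine Finset.sum_le_sum fun v _ => ?_
    have := ξ.count_le h.2.2.1 h.2.2.2 v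
    rw [hdeg] at this
    omega
  have h₁ := ξ.nodes_add_one
  have h₂ := ξ.joins_le h.1 h.2.2.1
  have h₃ := ξ.relabels_le hm
  omega

end GlueExpr

/-! ## Tables -/

namespace BinTree

/-- The value of a table at `c`. -/
def lookup (m c : BinTree) : BinTree := (filter (fun e => testEq e.left c) m).left.right

/-- Change the value of a table at `c` to `d`. -/
def assign (m c d : BinTree) : BinTree :=
  map (fun e => node e.left (ite (testEq e.left c) d e.right)) m

/-- The table of a function on labels. -/
def table {k : ℕ} (f : Fin k → BinTree) : BinTree :=
  ofList ((List.finRange k).map fun c : Fin k => node (unary c) (f c))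

variable {k : ℕ}

theorem mem_table {f : Fin k → BinTree} {e : BinTree} :
    e ∈ (table f).toList ↔ ∃ c : Fin k, e = node (unary c) (f c) := by
  simp [table, eq_comm]

@[simp] theorem lookup_table (f : Fin k → BinTree) (c : Fin k) :
    lookup (table f) (unary c) = f c := by
  have hne : filter (fun e => testEq e.left (unary c)) (table f) ≠ nil :=
    filter_ne.2 ⟨_, mem_table.2 ⟨c, rfl⟩, by simp⟩
  have h := left_mem_toList hne
  rw [mem_filter, mem_table] at h
  obtain ⟨⟨d, hd⟩, h⟩ := h
  rw [lookup]
  rw [hd] at h ⊢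
  simp only [left_node, testEq_ne, unary_inj, ← Fin.ext_iff] at h
  rw [h, right_node]

@[simp] theorem assign_table (f : Fin k → BinTree) (i : Fin k) (d : BinTree) :
    assign (table f) (unary i) d = table (Function.update f i d) := by
  apply toList_injective
  simp only [assign, toList_map, table, toList_ofList, List.map_map]
  refine List.map_congr_left fun c _ => ?_
  simp only [Function.comp, left_node, right_node]
  rw [ite_eq_of_iff (p := c = i) (by simp [Fin.ext_iff])]
  by_cases h : c = i
  · subst h; simp
  · simp [h]

theorem size_table_le {f : Fin k → BinTree} {K : ℕ} (h : ∀ c, (f c).size ≤ K) :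
    (table f).size ≤ 1 + k * (3 + 2 * k + K) := by
  have := size_ofList_le (l := (List.finRange k).map fun c : Fin k => node (unary c) (f c))
    (K := 2 + 2 * k + K) (by
      simp only [List.mem_map, List.mem_finRange, true_and, forall_exists_index,
        forall_apply_eq_imp_iff, size_node, size_unary]
      intro c
      have := h c
      have := c.2
      omega)
  simp only [List.length_map, List.length_finRange] at this
  rw [table]
  convert this using 3
  omega

/-- The least title with label `i` in an encoded expression. -/
def leastTitle (e i : BinTree) : BinTree :=
  (filter (fun p => testNot (filter (fun q => testNot (testLe p.left q.left))
    (filter (fun p => testEq p.right i) (labs e)))) (filter (fun p => testEq p.right i)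
      (labs e))).left.left

end BinTree

namespace PolyTime

variable {f g h : BinTree → BinTree}

@[fun_prop] theorem lookup (hf : PolyTime f) (hg : PolyTime g) :
    PolyTime fun x => BinTree.lookup (f x) (g x) := by
  unfold BinTree.lookup
  fun_prop

@[fun_prop] theorem assign (hf : PolyTime f) (hg : PolyTime g) (hh : PolyTime h) :
    PolyTime fun x => BinTree.assign (f x) (g x) (h x) := by
  unfold BinTree.assign
  fun_prop

@[fun_prop] theorem leastTitle (hf : PolyTime f) (hg : PolyTime g) :
    PolyTime fun x => BinTree.leastTitle (f x) (g x) := by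
  unfold BinTree.leastTitle
  fun_prop

end PolyTime

/-! ## The program that renames the introduce-nodes -/

/-- The recursion for `FuseExpr.rename`. An argument is a pair of an encoded expression and the
table of the names. -/
def renameScheme : Scheme where
  halt x := BinTree.ite x.left.left nil tru
  val x := node nil (node (BinTree.ite (lookup x.right x.left.right.right)
    (lookup x.right x.left.right.right).right x.left.right.left) x.left.right.right)
  fst x := BinTree.ite (testEq x.left.left (unary 1)) (node x.left.right.left x.right) nil
  snd x := node x.left.right.right
    (BinTree.ite (testEq x.left.left (unary 3))
      (assign x.right x.left.right.left.left (lookup x.right x.left.right.left.right))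
      (BinTree.ite (testEq x.left.left (unary 4))
        (assign x.right x.left.right.left
          (BinTree.ite (lookup x.right x.left.right.left) (lookup x.right x.left.right.left)
            (node nil (leastTitle x.left.right.right x.left.right.left))))
        x.right))
  comb x r₁ r₂ := node x.left.left
    (node (BinTree.ite (testEq x.left.left (unary 1)) r₁ x.left.right.left) r₂)

theorem renameScheme_efficient : renameScheme.Efficient := by
  constructor <;> simp only [renameScheme] <;> fun_prop

/-! ### Correctness of the renaming recursion -/

namespace FuseExpr

variable {k : ℕ}

/-- Repeated entries in the list of labels do no harm: only entries minimal among all titles with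
label `i` pass the test, and these are all equal. -/
theorem leastTitle_encode {φ : FuseExpr k} (hφ : φ.WellFormed) {i : Fin k}
    (hi : (φ.eval.labelClass i).Nonempty) :
    leastTitle φ.encode (unary i) = binary (sInf (φ.eval.labelClass i)) := by
  obtain ⟨h₁, h₂⟩ := isLeast_sInf_labelClass hφ hi
  set n := sInf (φ.eval.labelClass i)
  have hmem : ∀ p, p ∈ (filter (fun p => testEq p.right (unary i)) φ.encode.labs).toList ↔
      ∃ v, φ.HasLab v i ∧ p = encodeLabel v i := by
    intro p
    simp only [mem_filter, mem_labs, testEq_ne]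
    constructor
    · rintro ⟨⟨v, c, hv, rfl⟩, hc⟩
      simp only [encodeLabel, right_node, unary_inj, ← Fin.ext_iff] at hc
      subst hc
      exact ⟨v, hv, rfl⟩
    · rintro ⟨v, hv, rfl⟩
      exact ⟨⟨v, i, hv, rfl⟩, rfl⟩
  have key : ∀ p, p ∈ (filter (fun p => testNot (filter (fun q => testNot (testLe p.left q.left))
      (filter (fun p => testEq p.right (unary i)) φ.encode.labs)))
        (filter (fun p => testEq p.right (unary i)) φ.encode.labs)).toList ↔ p = encodeLabel n i := by
    intro p
    simp only [mem_filter (h := fun p => testNot _), hmem, testNot_ne, filter_eq, testNot_eq]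
    constructor
    · rintro ⟨⟨v, hv, rfl⟩, h⟩
      have := h _ ⟨n, h₁, rfl⟩
      simp only [encodeLabel, left_node, testLe_binary] at this
      rw [le_antisymm this (h₂ hv)]
    · rintro rfl
      refine ⟨⟨n, h₁, rfl⟩, ?_⟩
      rintro _ ⟨v, hv, rfl⟩
      simp only [encodeLabel, left_node, testLe_binary]
      exact h₂ hv
  have := left_mem_toList (ne_nil_iff.2 ⟨_, (key _).2 rfl⟩)
  rw [key] at this
  rw [leastTitle, this]
  rfl

/-- The encoding of an optional name. -/
def encodeName : Option ℕ → BinTree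
  | none => nil
  -- The extra `node nil` distinguishes the name 0, whose binary encoding is `nil`, from the absence
  -- of a name.
  | some n => .node nil (binary n)

theorem titles_fuse_bound {φ : FuseExpr k} {i : Fin k} (hφ : (fuse i φ).WellFormed)
    {s : Fin k → Option ℕ} {K : ℕ}
    (ht : ∀ v ∈ φ.titles, (binary v).size ≤ K) (hs : ∀ c n, s c = some n → (binary n).size ≤ K)
    (c : Fin k) (n : ℕ) (h : Function.update s i
      (some ((s i).getD (sInf (φ.eval.labelClass i)))) c = some n) : (binary n).size ≤ K := by
  by_cases hc : c = i
  · subst hc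
    rw [Function.update_self, Option.some_inj] at h
    cases hsc : s c with
    | some n' => rw [hsc, Option.getD_some] at h; exact hs c n (h ▸ hsc)
    | none =>
      rw [hsc, Option.getD_none] at h
      exact h ▸ ht _ (verts_subset_titles φ (Nat.sInf_mem hφ.2).1)
  · rw [Function.update_of_ne hc] at h
    exact hs c n h

/-- Renaming keeps the shape of the parse tree; only titles change, and every new one comes from the
old titles or the given names, hence has size at most `K`. -/
theorem size_rename_le {φ : FuseExpr k} (hφ : φ.WellFormed) {s : Fin k → Option ℕ} {K : ℕ}
    (ht : ∀ v ∈ φ.titles, (binary v).size ≤ K) (hs : ∀ c n, s c = some n → (binary n).size ≤ K) :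
    (φ.rename s).encode.size ≤ φ.encode.size * (1 + K) := by
  induction φ generalizing s with
  | intro v i =>
    have : (binary ((s i).getD v)).size ≤ K := by
      cases h : s i with
      | none => exact ht v (by simp [titles])
      | some n => exact hs i n h
    simp only [rename, encode, size_node, size_unary]
    nlinarith
  | union φ ψ h₁ h₂ =>
    have := h₁ hφ.1 (fun v hv => ht v (List.mem_append.2 (.inl hv))) hs
    have := h₂ hφ.2.1 (fun v hv => ht v (List.mem_append.2 (.inr hv))) hs
    simp only [rename, encode, size_node, size_unary]
    nlinarith
  | join i j φ ih =>
    have := ih hφ.1 ht hs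
    simp only [rename, encode, size_node, size_unary]
    nlinarith
  | relabel i j φ ih =>
    have := ih (s := Function.update s i (s j)) hφ.1 ht fun c n h => by
      by_cases hc : c = i
      · subst hc; rw [Function.update_self] at h; exact hs j n h
      · rw [Function.update_of_ne hc] at h; exact hs c n h
    simp only [rename, encode, size_node, size_unary]
    nlinarith
  | fuse i φ ih =>
    have := ih hφ.1 ht (titles_fuse_bound hφ ht hs)
    simp only [rename, encode, size_node, size_unary]
    nlinarith

theorem size_table_encodeName_le {s : Fin k → Option ℕ} {K : ℕ}
    (hs : ∀ c n, s c = some n → (binary n).size ≤ K) :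
    (table fun c => encodeName (s c)).size ≤ 1 + k * (5 + 2 * k + K) := by
  refine (size_table_le (K := 2 + K) fun c => ?_).trans (le_of_eq ?_)
  · cases h : s c with
    | none => simp [encodeName]; omega
    | some n => have := hs c n h; simp only [encodeName, size_node, size_nil]; omega
  · ring

theorem encodeName_update {s : Fin k → Option ℕ} {i : Fin k} {a : Option ℕ} :
    Function.update (fun c => encodeName (s c)) i (encodeName a) =
      fun c => encodeName (Function.update s i a c) := by
  funext c
  by_cases hc : c = i
  · subst hc; simp
  · simp [hc]

theorem eval_renameScheme {φ : FuseExpr k} (hφ : φ.WellFormed) {s : Fin k → Option ℕ} {K M : ℕ}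
    (ht : ∀ v ∈ φ.titles, (binary v).size ≤ K) (hs : ∀ c n, s c = some n → (binary n).size ≤ K)
    (hM : φ.encode.size * (1 + K) + (10 + k * (5 + 2 * k + K)) ≤ M) :
    ∃ n ≤ φ.encode.size, renameScheme.Eval M
      (.node φ.encode (table fun c => encodeName (s c))) (φ.rename s).encode n := by
  -- At nodes with one child the first call is on `nil` and yields a dummy leaf, which the
  -- combination ignores.
  have e₀ : renameScheme.Eval M nil (.node nil (.node nil nil)) 1 :=
    .halt_eq (by simp [renameScheme]) rfl (by simp; omega) (by simp; omega)
  have state : ∀ {φ : FuseExpr k} {s : Fin k → Option ℕ},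
      (∀ c n, s c = some n → (binary n).size ≤ K) →
      φ.encode.size * (1 + K) + (10 + k * (5 + 2 * k + K)) ≤ M →
      (BinTree.node φ.encode (table fun c => encodeName (s c))).size ≤ M := by
    intro φ s hs hM
    have h₁ := size_table_encodeName_le hs
    have h₂ : φ.encode.size ≤ φ.encode.size * (1 + K) := Nat.le_mul_of_pos_right _ (by omega)
    simp only [size_node]
    omega
  have mono : ∀ {a b : BinTree}, a.size ≤ b.size →
      b.size * (1 + K) + (10 + k * (5 + 2 * k + K)) ≤ M →
      a.size * (1 + K) + (10 + k * (5 + 2 * k + K)) ≤ M := fun h hM =>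
    le_trans (Nat.add_le_add_right (Nat.mul_le_mul_right _ h) _) hM
  induction φ generalizing s with
  | intro v i =>
    have hr := size_rename_le hφ ht hs
    refine ⟨1, size_pos _, .halt_eq (by simp [renameScheme, encode, unary]) ?_ (state hs hM)
      (by omega)⟩
    simp only [renameScheme, encode, left_node, right_node, lookup_table, rename]
    cases h : s i <;> simp [encodeName, unary]
  | union φ ψ h₁ h₂ =>
    have hr := size_rename_le hφ ht hs
    obtain ⟨n₁, l₁, e₁⟩ := h₁ hφ.1 (fun v hv => ht v (List.mem_append.2 (.inl hv))) hs
      (mono (by simp only [encode, size_node]; omega) hM)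
    obtain ⟨n₂, l₂, e₂⟩ := h₂ hφ.2.1 (fun v hv => ht v (List.mem_append.2 (.inr hv))) hs
      (mono (by simp only [encode, size_node]; omega) hM)
    exact ⟨1 + n₁ + n₂, by simp only [encode, size_node]; omega,
      .call_eq rfl rfl rfl rfl (state hs hM) (by omega) e₁ e₂⟩
  | join i j φ ih =>
    have hr := size_rename_le hφ ht hs
    obtain ⟨n, l, e⟩ := ih hφ.1 ht hs (mono (by simp only [encode, size_node]; omega) hM)
    exact ⟨1 + 1 + n, by simp only [encode, size_node]; omega,
      .call_eq rfl rfl rfl rfl (state hs hM) (by omega) e₀ e⟩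
  | relabel i j φ ih =>
    have hr := size_rename_le hφ ht hs
    obtain ⟨n, l, e⟩ := ih (s := Function.update s i (s j)) hφ.1 ht (fun c n h => by
        by_cases hc : c = i
        · subst hc; rw [Function.update_self] at h; exact hs j n h
        · rw [Function.update_of_ne hc] at h; exact hs c n h)
      (mono (by simp only [encode, size_node]; omega) hM)
    refine ⟨1 + 1 + n, by simp only [encode, size_node]; omega,
      .call_eq rfl rfl ?_ rfl (state hs hM) (by omega) e₀ e⟩
    rw [← encodeName_update, ← assign_table, ← lookup_table (fun c => encodeName (s c)) j]
    rfl
  | fuse i φ ih =>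
    have hr := size_rename_le hφ ht hs
    obtain ⟨n, l, e⟩ := ih hφ.1 ht (titles_fuse_bound hφ ht hs)
      (mono (by simp only [encode, size_node]; omega) hM)
    refine ⟨1 + 1 + n, by simp only [encode, size_node]; omega,
      .call_eq rfl rfl ?_ rfl (state hs hM) (by omega) e₀ e⟩
    have hname : encodeName (some ((s i).getD (sInf (φ.eval.labelClass i)))) =
        BinTree.ite (lookup (table fun c => encodeName (s c)) (unary i))
          (lookup (table fun c => encodeName (s c)) (unary i))
          (.node nil (leastTitle φ.encode (unary i))) := by
      rw [lookup_table, leastTitle_encode hφ.1 hφ.2]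
      cases s i <;> rfl
    rw [← encodeName_update, ← assign_table, hname]
    rfl

end FuseExpr

/-! ## The program that realizes a part of an expression -/

namespace BinTree

/-- Is `v` a title in the encoded expression `e`? -/
def testVert (e v : BinTree) : BinTree := filter (fun p => testEq p.left v) (labs e)

/-- Does one vertex of the pair `p` have label `i`, and the other one label `j`? -/
def testCrosses (e i j p : BinTree) : BinTree :=
  testOr (testAnd (testMem (node p.left i) (labs e)) (testMem (node p.right j) (labs e)))
    (testAnd (testMem (node p.left j) (labs e)) (testMem (node p.right i) (labs e)))

/-- Is `v` incident with a pair in the list `w`? -/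
def testIncident (w v : BinTree) : BinTree := filter (fun p => testEq p.left v) w

/-- The list for `FuseExpr.leftEdges`. -/
def leftPairs (e₁ e₂ w : BinTree) : BinTree :=
  filter (fun p => testAnd (testMem p (edges e₁)) (testNot (testMem p (edges e₂)))) w

/-- The list for `FuseExpr.rightEdges`. -/
def rightPairs (e₂ w : BinTree) : BinTree := filter (fun p => testMem p (edges e₂)) w

/-- The list for `FuseExpr.leftVerts`. -/
def leftTitles (e₁ e₂ w x : BinTree) : BinTree :=
  filter (fun v => testAnd (testVert e₁ v)
    (testOr (testNot (testVert e₂ v)) (testIncident (leftPairs e₁ e₂ w) v))) x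

/-- The list for `FuseExpr.rightVerts`. -/
def rightTitles (e₁ e₂ w x : BinTree) : BinTree :=
  filter (fun v => testAnd (testVert e₂ v)
    (testOr (testNot (testAnd (testVert e₁ v) (testIncident (leftPairs e₁ e₂ w) v)))
      (testIncident (rightPairs e₂ w) v))) x

/-- The vertices in the list `x` that have label `c`. -/
def withLab (e x c : BinTree) : BinTree := filter (fun v => testMem (node v c) (labs e)) x

/-- The vertices in the list `x` that have both labels `i` and `j`. -/
def withBoth (e x i j : BinTree) : BinTree :=
  filter (fun v => testMem (node v i) (labs e)) (withLab e x j)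

/-- Some label that is not used for the vertices in the list `x`, those with label `i` excepted. -/
def freeLabel (e m x i : BinTree) : BinTree :=
  (filter (fun d => testNot (filter (fun q => testAnd (testNot (testEq q.left i))
    (testAnd (testEq q.right d) (withLab e x q.left))) m)) (map (fun q => q.left) m)).left

/-- Does relabeling `i` to `j` merge two distinct vertices in the list `x`? -/
def testMerge (e x i j : BinTree) : BinTree :=
  testAnd (withLab e x i) (testAnd (withLab e x j) (testNot (withBoth e x i j)))

/-- The name of label `i` below a node that relabels `i` to `j`. -/
def newLabel (e m x i j : BinTree) : BinTree :=
  ite (testMerge e x i j) (freeLabel e m x i) (ite (withLab e x i) (lookup m j) (lookup m i))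

end BinTree

namespace PolyTime

variable {f g h f' g' : BinTree → BinTree}

@[fun_prop] theorem testVert (hf : PolyTime f) (hg : PolyTime g) :
    PolyTime fun x => BinTree.testVert (f x) (g x) := by
  unfold BinTree.testVert
  fun_prop

@[fun_prop] theorem testCrosses (hf : PolyTime f) (hg : PolyTime g) (hf' : PolyTime f')
    (hg' : PolyTime g') : PolyTime fun x => BinTree.testCrosses (f x) (g x) (f' x) (g' x) := by
  unfold BinTree.testCrosses
  fun_prop

@[fun_prop] theorem testIncident (hf : PolyTime f) (hg : PolyTime g) :
    PolyTime fun x => BinTree.testIncident (f x) (g x) := by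
  unfold BinTree.testIncident
  fun_prop

@[fun_prop] theorem leftPairs (hf : PolyTime f) (hg : PolyTime g) (hh : PolyTime h) :
    PolyTime fun x => BinTree.leftPairs (f x) (g x) (h x) := by
  unfold BinTree.leftPairs
  fun_prop

@[fun_prop] theorem rightPairs (hf : PolyTime f) (hg : PolyTime g) :
    PolyTime fun x => BinTree.rightPairs (f x) (g x) := by
  unfold BinTree.rightPairs
  fun_prop

@[fun_prop] theorem leftTitles (hf : PolyTime f) (hg : PolyTime g) (hf' : PolyTime f')
    (hg' : PolyTime g') : PolyTime fun x => BinTree.leftTitles (f x) (g x) (f' x) (g' x) := by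
  unfold BinTree.leftTitles
  fun_prop

@[fun_prop] theorem rightTitles (hf : PolyTime f) (hg : PolyTime g) (hf' : PolyTime f')
    (hg' : PolyTime g') : PolyTime fun x => BinTree.rightTitles (f x) (g x) (f' x) (g' x) := by
  unfold BinTree.rightTitles
  fun_prop

@[fun_prop] theorem withLab (hf : PolyTime f) (hg : PolyTime g) (hh : PolyTime h) :
    PolyTime fun x => BinTree.withLab (f x) (g x) (h x) := by
  unfold BinTree.withLab
  fun_prop

@[fun_prop] theorem withBoth (hf : PolyTime f) (hg : PolyTime g) (hf' : PolyTime f')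
    (hg' : PolyTime g') : PolyTime fun x => BinTree.withBoth (f x) (g x) (f' x) (g' x) := by
  unfold BinTree.withBoth
  fun_prop

@[fun_prop] theorem freeLabel (hf : PolyTime f) (hg : PolyTime g) (hf' : PolyTime f')
    (hg' : PolyTime g') : PolyTime fun x => BinTree.freeLabel (f x) (g x) (f' x) (g' x) := by
  unfold BinTree.freeLabel
  fun_prop

@[fun_prop] theorem testMerge (hf : PolyTime f) (hg : PolyTime g) (hf' : PolyTime f')
    (hg' : PolyTime g') : PolyTime fun x => BinTree.testMerge (f x) (g x) (f' x) (g' x) := by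
  unfold BinTree.testMerge
  fun_prop

@[fun_prop] theorem newLabel (hf : PolyTime f) (hg : PolyTime g) (hh : PolyTime h)
    (hf' : PolyTime f') (hg' : PolyTime g') :
    PolyTime fun x => BinTree.newLabel (f x) (g x) (h x) (f' x) (g' x) := by
  unfold BinTree.newLabel
  fun_prop

end PolyTime

/-- The recursion that realizes a part of an expression. An argument consists of an encoded
expression, the table of the renaming of the labels, the list of the edges and the list of the
vertices; the result is `nil` if there are no vertices. -/
def reduceScheme : Scheme where
  halt x := BinTree.ite x.right.right.right (BinTree.ite x.left.left nil tru) tru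
  val x := BinTree.ite x.right.right.right
    (node nil (node x.left.right.left (lookup x.right.left x.left.right.right))) nil
  fst x := BinTree.ite (testEq x.left.left (unary 1))
    (node x.left.right.left (node x.right.left
      (node (leftPairs x.left.right.left x.left.right.right x.right.right.left)
        (leftTitles x.left.right.left x.left.right.right x.right.right.left
          x.right.right.right)))) nil
  snd x := node x.left.right.right
    (BinTree.ite (testEq x.left.left (unary 1))
      (node x.right.left (node (rightPairs x.left.right.right x.right.right.left)
        (rightTitles x.left.right.left x.left.right.right x.right.right.left
          x.right.right.right)))
      (BinTree.ite (testEq x.left.left (unary 2))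
        (node x.right.left (node (filter (fun p => testNot (testCrosses x.left.right.right
          x.left.right.left.left x.left.right.left.right p)) x.right.right.left)
            x.right.right.right))
        (BinTree.ite (testEq x.left.left (unary 3))
          (node (assign x.right.left x.left.right.left.left (newLabel x.left.right.right
            x.right.left x.right.right.right x.left.right.left.left x.left.right.left.right))
              x.right.right)
          x.right)))
  comb x r₁ r₂ := BinTree.ite (testEq x.left.left (unary 1))
    (BinTree.ite r₁ (BinTree.ite r₂ (node (unary 1) (node r₁ r₂)) r₁) r₂)
    (BinTree.ite (testEq x.left.left (unary 2))
      (BinTree.ite (filter (fun p => testCrosses x.left.right.right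
        x.left.right.left.left x.left.right.left.right p) x.right.right.left)
          (node (unary 2) (node (node (lookup x.right.left x.left.right.left.left)
            (lookup x.right.left x.left.right.left.right)) r₂)) r₂)
      (BinTree.ite (testEq x.left.left (unary 3))
        (BinTree.ite (testMerge x.left.right.right x.right.right.right x.left.right.left.left
          x.left.right.left.right)
            (node (unary 3) (node (node (newLabel x.left.right.right x.right.left
              x.right.right.right x.left.right.left.left x.left.right.left.right)
                (lookup x.right.left x.left.right.left.right)) r₂)) r₂)
        r₂))

theorem reduceScheme_efficient : reduceScheme.Efficient := by
  constructor <;> simp only [reduceScheme] <;> fun_prop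

/-! ### Correctness of the tests on encoded parts -/

namespace FuseExpr

variable {k : ℕ}

/-- The list `t` consists of the vertices in `X`. -/
def ListsVerts (X : ℕ → Prop) (t : BinTree) : Prop :=
  ∀ a, a ∈ t.toList ↔ ∃ v, X v ∧ a = binary v

/-- The list `t` consists of the pairs in `W`. -/
def ListsPairs (W : ℕ → ℕ → Prop) (t : BinTree) : Prop :=
  ∀ a, a ∈ t.toList ↔ ∃ u w, W u w ∧ a = encodePair u w

variable {φ ψ : FuseExpr k} {m : Fin k → Fin k} {W : ℕ → ℕ → Prop} {X : ℕ → Prop} {w x : BinTree}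

theorem ListsVerts.filter (hx : ListsVerts X x) {h : BinTree → BinTree} {p : ℕ → Prop}
    (hp : ∀ v, h (binary v) ≠ nil ↔ p v) :
    ListsVerts (fun v => X v ∧ p v) (BinTree.filter h x) := by
  intro a
  rw [mem_filter, hx]
  constructor
  · rintro ⟨⟨v, hv, rfl⟩, ha⟩
    exact ⟨v, ⟨hv, (hp v).1 ha⟩, rfl⟩
  · rintro ⟨v, ⟨hv, hpv⟩, rfl⟩
    exact ⟨⟨v, hv, rfl⟩, (hp v).2 hpv⟩

theorem ListsVerts.ne_nil (hx : ListsVerts X x) : x ≠ nil ↔ ∃ v, X v := by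
  rw [ne_nil_iff]
  exact ⟨fun ⟨a, ha⟩ => by obtain ⟨v, hv, -⟩ := (hx a).1 ha; exact ⟨v, hv⟩,
    fun ⟨v, hv⟩ => ⟨_, (hx _).2 ⟨v, hv, rfl⟩⟩⟩

theorem ListsPairs.filter (hw : ListsPairs W w) {h : BinTree → BinTree} {p : ℕ → ℕ → Prop}
    (hp : ∀ u v, h (encodePair u v) ≠ nil ↔ p u v) :
    ListsPairs (fun u v => W u v ∧ p u v) (BinTree.filter h w) := by
  intro a
  rw [mem_filter, hw]
  constructor
  · rintro ⟨⟨u, v, hv, rfl⟩, ha⟩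
    exact ⟨u, v, ⟨hv, (hp u v).1 ha⟩, rfl⟩
  · rintro ⟨u, v, ⟨hv, hpv⟩, rfl⟩
    exact ⟨⟨u, v, hv, rfl⟩, (hp u v).2 hpv⟩

theorem ListsPairs.ne_nil (hw : ListsPairs W w) : w ≠ nil ↔ ∃ u v, W u v := by
  rw [ne_nil_iff]
  exact ⟨fun ⟨a, ha⟩ => by obtain ⟨u, v, hv, -⟩ := (hw a).1 ha; exact ⟨u, v, hv⟩,
    fun ⟨u, v, hv⟩ => ⟨_, (hw _).2 ⟨u, v, hv, rfl⟩⟩⟩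

theorem testVert_encode (v : ℕ) : testVert φ.encode (binary v) ≠ nil ↔ φ.HasVert v := by
  simp only [testVert, filter_ne, mem_labs, testEq_ne]
  constructor
  · rintro ⟨_, ⟨u, c, h, rfl⟩, hu⟩
    simp only [encodeLabel, left_node, binary_inj] at hu
    exact ⟨c, hu ▸ h⟩
  · rintro ⟨c, h⟩
    exact ⟨_, ⟨v, c, h, rfl⟩, rfl⟩

theorem testMem_labs (v : ℕ) (c : Fin k) :
    testMem (.node (binary v) (unary c)) φ.encode.labs ≠ nil ↔ φ.HasLab v c := by
  rw [testMem_ne]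
  exact mem_labs_iff φ v c

theorem testCrosses_encode (i j : Fin k) (u v : ℕ) :
    testCrosses φ.encode (unary i) (unary j) (encodePair u v) ≠ nil ↔ φ.Crosses i j u v := by
  simp only [testCrosses, testOr_ne, testAnd_ne, encodePair, left_node, right_node, testMem_labs,
    Crosses]

theorem ListsPairs.testIncident (hw : ListsPairs W w) (v : ℕ) :
    testIncident w (binary v) ≠ nil ↔ ∃ u, W v u := by
  simp only [BinTree.testIncident, filter_ne, testEq_ne]
  constructor
  · rintro ⟨a, ha, hv⟩
    obtain ⟨u, u', h, rfl⟩ := (hw a).1 ha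
    simp only [encodePair, left_node, binary_inj] at hv
    exact ⟨u', hv ▸ h⟩
  · rintro ⟨u, h⟩
    exact ⟨_, (hw _).2 ⟨v, u, h, rfl⟩, rfl⟩

theorem ListsPairs.leftPairs (hw : ListsPairs W w) :
    ListsPairs (φ.leftEdges ψ W) (leftPairs φ.encode ψ.encode w) :=
  hw.filter fun u v => by simp only [testAnd_ne, testMem_ne, mem_edges_iff, testNot_ne, testMem_eq]

theorem ListsPairs.rightPairs (hw : ListsPairs W w) :
    ListsPairs (ψ.rightEdges W) (rightPairs ψ.encode w) :=
  hw.filter fun u v => by simp only [testMem_ne, mem_edges_iff]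

theorem ListsVerts.leftTitles (hx : ListsVerts X x) (hw : ListsPairs W w) :
    ListsVerts (φ.leftVerts ψ W X) (leftTitles φ.encode ψ.encode w x) :=
  hx.filter fun v => by
    rw [testAnd_ne, testOr_ne, testNot_ne, testVert_encode, hw.leftPairs.testIncident,
      ← not_ne_iff, testVert_encode, ← imp_iff_not_or]

theorem ListsVerts.rightTitles (hx : ListsVerts X x) (hw : ListsPairs W w) :
    ListsVerts (φ.rightVerts ψ W X) (rightTitles φ.encode ψ.encode w x) :=
  hx.filter fun v => by
    rw [testAnd_ne, testOr_ne, testNot_ne, testVert_encode, ← not_ne_iff, testAnd_ne,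
      hw.leftPairs.testIncident, hw.rightPairs.testIncident, testVert_encode, ← imp_iff_not_or,
      and_imp]

theorem ListsVerts.withLab (hx : ListsVerts X x) (c : Fin k) :
    ListsVerts (fun v => X v ∧ φ.HasLab v c) (withLab φ.encode x (unary c)) :=
  hx.filter fun v => testMem_labs v c

theorem ListsVerts.withLab_ne (hx : ListsVerts X x) (c : Fin k) :
    BinTree.withLab φ.encode x (unary c) ≠ nil ↔ φ.Present X c := (hx.withLab c).ne_nil

theorem ListsVerts.withBoth_ne (hx : ListsVerts X x) (i j : Fin k) :
    withBoth φ.encode x (unary i) (unary j) ≠ nil ↔ φ.Common X i j := by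
  rw [withBoth, ((hx.withLab j).filter fun v => testMem_labs v i).ne_nil]
  simp only [Common, and_assoc, and_comm (a := φ.HasLab _ i)]

/-- The table of `m` lists all labels, so it supplies the candidates as well as the names in use.
The search succeeds by `exists_free`. -/
theorem ListsVerts.freeLabel (hx : ListsVerts X x) (i : Fin k) : ∃ f, φ.Free m X i f ∧
    freeLabel φ.encode (table fun c => unary (m c)) x (unary i) = unary f := by
  have key : ∀ d, d ∈ (BinTree.filter (fun d => testNot (BinTree.filter (fun q =>
      testAnd (testNot (testEq q.left (unary i))) (testAnd (testEq q.right d)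
        (BinTree.withLab φ.encode x q.left))) (table fun c => unary (m c))))
      (BinTree.map (fun q => q.left) (table fun c => unary (m c)))).toList ↔
        ∃ f : Fin k, φ.Free m X i f ∧ d = unary f := by
    intro d
    have h₁ : d ∈ (BinTree.map (fun q => q.left) (table fun c => unary (m c))).toList ↔
        ∃ f : Fin k, d = unary f := by
      simp only [toList_map, List.mem_map, mem_table]
      exact ⟨fun ⟨_, ⟨c, rfl⟩, h⟩ => ⟨c, h.symm⟩, fun ⟨c, h⟩ => ⟨_, ⟨c, rfl⟩, h.symm⟩⟩
    have h₂ : ∀ c f : Fin k, testAnd (testNot (testEq (unary c) (unary i)))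
        (testAnd (testEq (unary (m c)) (unary f)) (BinTree.withLab φ.encode x (unary c))) ≠ nil ↔
          c ≠ i ∧ m c = f ∧ φ.Present X c := fun c f => by
      rw [testAnd_ne, testAnd_ne, testNot_ne, testEq_eq, testEq_ne, hx.withLab_ne]
      simp [Fin.ext_iff]
    rw [mem_filter, h₁, testNot_ne, filter_eq]
    constructor
    · rintro ⟨⟨f, rfl⟩, h⟩
      refine ⟨f, fun c hc hp hm => ?_, rfl⟩
      have := h _ (mem_table.2 ⟨c, rfl⟩)
      exact (h₂ c f).2 ⟨hc, hm, hp⟩ this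
    · rintro ⟨f, hf, rfl⟩
      refine ⟨⟨f, rfl⟩, fun q hq => ?_⟩
      obtain ⟨c, rfl⟩ := mem_table.1 hq
      by_contra hq
      obtain ⟨hc, hm, hp⟩ := (h₂ c f).1 hq
      exact hf c hc hp hm
  obtain ⟨f, hf⟩ := exists_free φ m X i
  have := left_mem_toList (ne_nil_iff.2 ⟨_, (key _).2 ⟨f, hf, rfl⟩⟩)
  exact (key _).1 this

theorem ListsVerts.testMerge (hx : ListsVerts X x) (i j : Fin k) :
    testMerge φ.encode x (unary i) (unary j) ≠ nil ↔
      φ.Present X i ∧ φ.Present X j ∧ ¬ φ.Common X i j := by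
  rw [BinTree.testMerge, testAnd_ne, testAnd_ne, testNot_ne, hx.withLab_ne, hx.withLab_ne,
    ← hx.withBoth_ne, not_ne_iff]

end FuseExpr

/-! ### Correctness of the recursion that realizes a part -/

namespace FuseExpr

variable {k : ℕ}

/-- `r` encodes a realization, or is `nil` if there are no vertices. -/
def Result (φ : FuseExpr k) (m : Fin k → Fin k) (W : ℕ → ℕ → Prop) (X : ℕ → Prop) (r : BinTree) :
    Prop :=
  ¬ (∃ v, X v) ∧ r = nil ∨ (∃ v, X v) ∧ ∃ ζ, φ.Realizes m W X ζ ∧ r = ζ.encode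

theorem _root_.GlueExpr.encode_ne_nil (ζ : GlueExpr k) : ζ.encode ≠ nil := by
  cases ζ <;> simp [GlueExpr.encode]

variable {φ ψ : FuseExpr k} {m : Fin k → Fin k} {W : ℕ → ℕ → Prop} {X : ℕ → Prop} {w x r : BinTree}

theorem Part.of_fuse {i : Fin k} (h : (fuse i φ).Part m W X) : φ.Part m W X :=
  ⟨h.vert, h.edge, h.symm, h.mem, h.saturated, h.lab_eq, h.lab_inj⟩

theorem Result.fuse {i : Fin k} (h : φ.Result m W X r) : (fuse i φ).Result m W X r :=
  h.imp id fun ⟨hX, ζ, hζ, hr⟩ =>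
    ⟨hX, ζ, ⟨hζ.wellFormed, hζ.reduced, hζ.merging, hζ.verts, hζ.adj, hζ.lab⟩, hr⟩

theorem Result.exists (h : φ.Result m W X r) (hX : ∃ v, X v) :
    ∃ ζ, φ.Realizes m W X ζ ∧ r = ζ.encode :=
  (h.resolve_left fun h => h.1 hX).2

theorem size_unary_le (c : Fin k) : (unary c).size ≤ 2 * k := by
  have := c.2
  simp only [size_unary]
  omega

theorem update_unary {i f : Fin k} :
    Function.update (fun c => unary (m c)) i (unary f) =
      fun c => unary (Function.update m i f c : Fin k) := by
  funext c
  by_cases hc : c = i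
  · subst hc; simp
  · simp [hc]

/-- The name of label `i` below a node that relabels `i` to `j`, and the properties of it. -/
theorem exists_newLabel {i j : Fin k} (hg : (relabel i j φ).Good)
    (hp : (relabel i j φ).Part m W X) (hx : ListsVerts X x) :
    ∃ f : Fin k, newLabel φ.encode (table fun c => unary (m c)) x (unary i) (unary j) = unary f ∧
      φ.Part (Function.update m i f) W X ∧
      ∀ ζ, φ.Realizes (Function.update m i f) W X ζ →
        (testMerge φ.encode x (unary i) (unary j) ≠ nil →
          (relabel i j φ).Realizes m W X (.relabel f (m j) ζ)) ∧
        (testMerge φ.encode x (unary i) (unary j) = nil →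
          (relabel i j φ).Realizes m W X ζ) := by
  by_cases ht : testMerge φ.encode x (unary i) (unary j) = nil
  · by_cases hi : φ.Present X i
    · have hj : ¬ φ.Present X j ∨ φ.Common X i j := by
        have := mt (hx.testMerge i j).2 (not_ne_iff.2 ht)
        tauto
      refine ⟨m j, ?_, hp.of_relabel_move hg hj, fun ζ hζ => ⟨fun h => (h ht).elim, fun _ =>
        hζ.relabel_move⟩⟩
      rw [newLabel, ht, ite_nil, ite_of_ne ((hx.withLab_ne i).2 hi), lookup_table]
    · have hm : Function.update m i (m i) = m := Function.update_eq_self i m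
      refine ⟨m i, ?_, hm.symm ▸ hp.of_relabel_absent hi, fun ζ hζ => ⟨fun h => (h ht).elim,
        fun _ => ?_⟩⟩
      · rw [newLabel, ht, ite_nil, not_ne_iff.1 (mt (hx.withLab_ne i).1 hi), ite_nil, lookup_table]
      · rw [hm] at hζ
        exact hζ.relabel_absent hi
  · obtain ⟨hi, hj, hij⟩ := (hx.testMerge i j).1 ht
    obtain ⟨f, hf, hf'⟩ := hx.freeLabel (φ := φ) (m := m) i
    refine ⟨f, ?_, hp.of_relabel_merge hj hij hg.2.1 hf, fun ζ hζ =>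
      ⟨fun _ => hζ.relabel_merge hp hi hj hg.2.1 hf, fun h => (ht h).elim⟩⟩
    rw [newLabel, ite_of_ne ht, hf']

/-- The lists of demanded vertices and edges are only filtered on the way down, so they never
outgrow the initial ones. The output has at most one node for each node of the input, with labels of
size at most `2 * k`, whence the factor `10 + 4 * k`. -/
theorem eval_reduceScheme {M : ℕ} (hg : φ.Good) (hp : φ.Part m W X) (hw : ListsPairs W w)
    (hx : ListsVerts X x)
    (hM : φ.encode.size * (10 + 4 * k) + (10 + k * (3 + 4 * k) + w.size + x.size) ≤ M) :
    ∃ r n, n ≤ φ.encode.size ∧ r.size ≤ φ.encode.size * (10 + 4 * k) ∧ φ.Result m W X r ∧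
      reduceScheme.Eval M
        (.node φ.encode (.node (table fun c => unary (m c)) (.node w x))) r n := by
  have e₀ : reduceScheme.Eval M nil nil 1 :=
    .halt_eq (by simp [reduceScheme]) rfl (by simp; omega) (by simp; omega)
  have state : ∀ {φ : FuseExpr k} {m : Fin k → Fin k} {w x : BinTree},
      φ.encode.size * (10 + 4 * k) + (10 + k * (3 + 4 * k) + w.size + x.size) ≤ M →
      (BinTree.node φ.encode (.node (table fun c => unary (m c)) (.node w x))).size ≤ M := by
    intro φ m w x hM
    have h₁ := size_table_le (f := fun c => unary (m c)) (K := 2 * k) fun c => size_unary_le _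
    have h₂ : φ.encode.size ≤ φ.encode.size * (10 + 4 * k) :=
      Nat.le_mul_of_pos_right _ (by omega)
    have h₃ : 3 + 2 * k + 2 * k = 3 + 4 * k := by omega
    rw [h₃] at h₁
    simp only [size_node]
    omega
  have mono : ∀ {a b w w' x x' : BinTree}, a.size ≤ b.size → w'.size ≤ w.size →
      x'.size ≤ x.size →
      b.size * (10 + 4 * k) + (10 + k * (3 + 4 * k) + w.size + x.size) ≤ M →
      a.size * (10 + 4 * k) + (10 + k * (3 + 4 * k) + w'.size + x'.size) ≤ M := by
    intro a b w w' x x' h₁ h₂ h₃ hM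
    have := Nat.mul_le_mul_right (10 + 4 * k) h₁
    omega
  -- An empty demand stops the recursion at once with `nil`, since there is no glue-expression of
  -- the empty graph.
  have empty : ∀ {φ : FuseExpr k} {m : Fin k → Fin k} {W : ℕ → ℕ → Prop} {X : ℕ → Prop}
      {w x : BinTree}, ¬ (∃ v, X v) → ListsVerts X x →
      φ.encode.size * (10 + 4 * k) + (10 + k * (3 + 4 * k) + w.size + x.size) ≤ M →
      ∃ r n, n ≤ φ.encode.size ∧ r.size ≤ φ.encode.size * (10 + 4 * k) ∧ φ.Result m W X r ∧
      reduceScheme.Eval M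
        (.node φ.encode (.node (table fun c => unary (m c)) (.node w x))) r n := by
    intro φ m W X w x hX hx hM
    have hx := not_ne_iff.1 (mt hx.ne_nil.1 hX)
    have hpos := size_pos φ.encode
    refine ⟨nil, 1, hpos, by simp only [size_nil]; nlinarith, .inl ⟨hX, rfl⟩,
      .halt_eq (by simp [reduceScheme, hx]) (by simp [reduceScheme, hx]) (state hM) ?_⟩
    simp only [size_nil]; omega
  induction φ generalizing m W X w x with
  | intro v i =>
    by_cases hX : ∃ v, X v
    · have hne := hx.ne_nil.2 hX
      have hs : (GlueExpr.intro v (m i)).encode.size ≤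
          (intro v i).encode.size * (10 + 4 * k) := by
        have := size_unary_le (m i)
        simp only [GlueExpr.encode, encode, size_node]
        nlinarith
      refine ⟨_, 1, size_pos _, hs, .inr ⟨hX, _, hp.realizes_intro hX, rfl⟩,
        .halt_eq ?_ ?_ (state hM) (by omega)⟩
      · simp [reduceScheme, encode, unary, ite_of_ne hne]
      · simp [reduceScheme, encode, unary, ite_of_ne hne, GlueExpr.encode]
    · exact empty hX hx hM
  | union φ ψ h₁ h₂ =>
    by_cases hX : ∃ v, X v
    · have hne := hx.ne_nil.2 hX
      obtain ⟨r₁, n₁, l₁, s₁, o₁, e₁⟩ := h₁ hg.1 (hp.of_union_left hg) hw.leftPairs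
        (hx.leftTitles hw) (mono (by simp only [encode, size_node]; omega) (size_filter_le _ _)
          (size_filter_le _ _) hM)
      obtain ⟨r₂, n₂, l₂, s₂, o₂, e₂⟩ := h₂ hg.2.1 hp.of_union_right hw.rightPairs
        (hx.rightTitles hw) (mono (by simp only [encode, size_node]; omega) (size_filter_le _ _)
          (size_filter_le _ _) hM)
      have hs : (BinTree.ite r₁ (BinTree.ite r₂ (.node (unary 1) (.node r₁ r₂)) r₁) r₂).size ≤
          (union φ ψ).encode.size * (10 + 4 * k) := by
        simp only [encode, size_node, size_unary] at s₁ s₂ ⊢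
        cases r₁ with
        | nil => rw [ite_nil]; nlinarith
        | node _ _ => cases r₂ with
          | nil => rw [ite_node, ite_nil]; nlinarith
          | node _ _ => simp only [ite_node, size_node, size_unary] at s₁ s₂ ⊢; nlinarith
      refine ⟨_, 1 + n₁ + n₂, by simp only [encode, size_node]; omega, hs, .inr ⟨hX, ?_⟩,
        .call_eq ?_ rfl rfl rfl (state hM) (by omega) e₁ e₂⟩
      · rcases o₁ with ⟨hX₁, rfl⟩ | ⟨hX₁, ζ₁, hζ₁, rfl⟩
        · rcases o₂ with ⟨hX₂, rfl⟩ | ⟨hX₂, ζ₂, hζ₂, rfl⟩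
          · obtain ⟨v, hv⟩ := hX
            rcases (hp.vert_iff v).1 hv with h | h
            · exact (hX₁ ⟨v, h⟩).elim
            · exact (hX₂ ⟨v, h⟩).elim
          · exact ⟨ζ₂, hζ₂.union_right hp hg hX₁, rfl⟩
        · rw [ite_of_ne ζ₁.encode_ne_nil]
          rcases o₂ with ⟨hX₂, rfl⟩ | ⟨hX₂, ζ₂, hζ₂, rfl⟩
          · exact ⟨ζ₁, hζ₁.union_left hp hX₂, rfl⟩
          · rw [ite_of_ne ζ₂.encode_ne_nil]
            exact ⟨_, Realizes.glue hp hg hζ₁ hζ₂, rfl⟩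
      · simp [reduceScheme, encode, unary, ite_of_ne hne]
    · exact empty hX hx hM
  | join i j φ ih =>
    by_cases hX : ∃ v, X v
    · have hne := hx.ne_nil.2 hX
      have hw' : ListsPairs (fun u v => W u v ∧ ¬ φ.Crosses i j u v) (BinTree.filter (fun p =>
          testNot (testCrosses φ.encode (unary i) (unary j) p)) w) :=
        hw.filter fun u v => by rw [testNot_ne, ← not_ne_iff, testCrosses_encode]
      have hc := (hw.filter (h := fun p => testCrosses φ.encode (unary i) (unary j) p)
        fun u v => testCrosses_encode (φ := φ) i j u v).ne_nil
      obtain ⟨r, n, l, s, o, e⟩ := ih hg.1 hp.of_join hw' hx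
        (mono (by simp only [encode, size_node]; omega) (size_filter_le _ _) le_rfl hM)
      obtain ⟨ζ, hζ, rfl⟩ := o.exists hX
      have hi := size_unary_le (m i)
      have hj := size_unary_le (m j)
      set r' := BinTree.ite (BinTree.filter (fun p => testCrosses φ.encode (unary i) (unary j) p) w)
        (GlueExpr.join (m i) (m j) ζ).encode ζ.encode with hr'
      have hs : r'.size ≤ (join i j φ).encode.size * (10 + 4 * k) := by
        rw [hr']
        simp only [encode, size_node, size_unary] at s hi hj ⊢
        cases BinTree.filter (fun p => testCrosses φ.encode (unary i) (unary j) p) w with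
        | nil => rw [ite_nil]; nlinarith
        | node _ _ =>
          simp only [ite_node, GlueExpr.encode, size_node, size_unary]
          nlinarith
      refine ⟨r', 1 + 1 + n, by simp only [encode, size_node]; omega, hs, .inr ⟨hX, ?_⟩,
        .call_eq ?_ rfl rfl ?_ (state hM) (by omega) e₀ e⟩
      · by_cases hcr : ∃ u v, W u v ∧ φ.Crosses i j u v
        · exact ⟨_, Realizes.join_of_exists hp hζ hg.2 hcr, by rw [hr', ite_of_ne (hc.2 hcr)]⟩
        · exact ⟨ζ, hζ.join_of_not hcr,
            by rw [hr', not_ne_iff.1 (mt hc.1 hcr), ite_nil]⟩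
      · simp [reduceScheme, encode, unary, ite_of_ne hne]
      · rw [hr', GlueExpr.encode, ← lookup_table (fun c => unary (m c)) i,
          ← lookup_table (fun c => unary (m c)) j]
        rfl
    · exact empty hX hx hM
  | relabel i j φ ih =>
    by_cases hX : ∃ v, X v
    · have hne := hx.ne_nil.2 hX
      obtain ⟨f, hf, hp', hζ'⟩ := exists_newLabel hg hp hx
      obtain ⟨r, n, l, s, o, e⟩ := ih hg.1 hp' hw hx
        (mono (by simp only [encode, size_node]; omega) le_rfl le_rfl hM)
      obtain ⟨ζ, hζ, rfl⟩ := o.exists hX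
      have hi := size_unary_le f
      have hj := size_unary_le (m j)
      set r' := BinTree.ite (testMerge φ.encode x (unary i) (unary j))
        (GlueExpr.relabel f (m j) ζ).encode ζ.encode with hr'
      have hs : r'.size ≤ (relabel i j φ).encode.size * (10 + 4 * k) := by
        rw [hr']
        simp only [encode, size_node, size_unary] at s hi hj ⊢
        cases testMerge φ.encode x (unary i) (unary j) with
        | nil => rw [ite_nil]; nlinarith
        | node _ _ =>
          simp only [ite_node, GlueExpr.encode, size_node, size_unary]
          nlinarith
      refine ⟨r', 1 + 1 + n, by simp only [encode, size_node]; omega, hs, .inr ⟨hX, ?_⟩,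
        .call_eq ?_ rfl ?_ ?_ (state hM) (by omega) e₀ e⟩
      · by_cases ht : testMerge φ.encode x (unary i) (unary j) = nil
        · exact ⟨ζ, (hζ' ζ hζ).2 ht, by rw [hr', ht, ite_nil]⟩
        · exact ⟨_, (hζ' ζ hζ).1 ht, by rw [hr', ite_of_ne ht]⟩
      · simp [reduceScheme, encode, unary, ite_of_ne hne]
      · rw [← update_unary, ← assign_table, ← hf]
        rfl
      · rw [hr', GlueExpr.encode, ← hf, ← lookup_table (fun c => unary (m c)) j]
        rfl
    · exact empty hX hx hM
  | fuse i φ ih =>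
    by_cases hX : ∃ v, X v
    · have hne := hx.ne_nil.2 hX
      obtain ⟨r, n, l, s, o, e⟩ := ih hg hp.of_fuse hw hx
        (mono (by simp only [encode, size_node]; omega) le_rfl le_rfl hM)
      have hs : r.size ≤ (fuse i φ).encode.size * (10 + 4 * k) := by
        simp only [encode, size_node, size_unary]
        nlinarith
      refine ⟨r, 1 + 1 + n, by simp only [encode, size_node]; omega, hs, o.fuse,
        .call_eq ?_ rfl rfl rfl (state hM) (by omega) e₀ e⟩
      simp [reduceScheme, encode, unary, ite_of_ne hne]
    · exact empty hX hx hM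

end FuseExpr

/-! ## The main result -/

theorem Program.RunsIn.pair {P Q : Program} {x y z : BinTree} {s t : ℕ} (h₁ : P.RunsIn x y s)
    (h₂ : Q.RunsIn x z t) : (Program.pair P Q).RunsIn x (.node y z) (1 + x.size + s + t) := by
  obtain ⟨a, ha, h₁⟩ := h₁
  obtain ⟨b, hb, h₂⟩ := h₂
  exact ⟨_, by omega, h₁.pair h₂⟩

namespace FuseExpr

variable {k : ℕ}

theorem exists_hasLab (φ : FuseExpr k) : ∃ v c, φ.HasLab v c := by
  induction φ with
  | intro v i => exact ⟨v, i, rfl, rfl⟩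
  | union φ ψ h₁ h₂ =>
    obtain ⟨v, c, h⟩ := h₁
    exact ⟨v, c, .inl h⟩
  | join i j φ ih => exact ih
  | relabel i j φ ih =>
    obtain ⟨v, c, h⟩ := ih
    exact ⟨v, _, h.relabel⟩
  | fuse i φ ih => exact ih

theorem size_encode_le (φ : FuseExpr k) : φ.encode.size ≤ φ.size * (20 + 4 * k) := by
  induction φ with
  | intro v i =>
    have := size_binary_le v
    have := size_unary_le i
    simp only [encode, size_node, size_unary, size] at *
    nlinarith
  | union φ ψ h₁ h₂ =>
    simp only [encode, size_node, size_unary, size]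
    nlinarith
  | join i j φ ih =>
    have := size_unary_le i
    have := size_unary_le j
    simp only [encode, size_node, size_unary, size] at *
    nlinarith
  | relabel i j φ ih =>
    have := size_unary_le i
    have := size_unary_le j
    simp only [encode, size_node, size_unary, size] at *
    nlinarith
  | fuse i φ ih =>
    have := size_unary_le i
    simp only [encode, size_node, size_unary, size] at *
    nlinarith

theorem size_binary_le_encode {φ : FuseExpr k} {v : ℕ} (h : v ∈ φ.titles) :
    (binary v).size ≤ φ.encode.size := by
  induction φ with
  | intro u i =>
    have : v = u := by simpa [titles] using h
    subst this
    simp only [encode, size_node]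
    omega
  | union φ ψ h₁ h₂ =>
    simp only [encode, size_node]
    rcases List.mem_append.1 h with h | h
    · have := h₁ h; omega
    · have := h₂ h; omega
  | join i j φ ih => have := ih h; simp only [encode, size_node]; omega
  | relabel i j φ ih => have := ih h; simp only [encode, size_node]; omega
  | fuse i φ ih => have := ih h; simp only [encode, size_node]; omega

theorem map_numbersBelow (f : BinTree → BinTree) :
    BinTree.map (fun c => .node c (f c)) (numbersBelow (unary k)) =
      table fun c : Fin k => f (unary c) := by
  apply toList_injective
  simp only [toList_map, toList_numbersBelow_unary, table, toList_ofList, List.map_map]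
  rw [← List.map_coe_finRange_eq_range, List.map_map]
  rfl

theorem listsPairs_edges (φ : FuseExpr k) : ListsPairs φ.Edge φ.encode.edges :=
  fun a => mem_edges φ a

theorem listsVerts_labs (φ : FuseExpr k) :
    ListsVerts φ.HasVert (BinTree.map (fun p => p.left) φ.encode.labs) := by
  intro a
  simp only [toList_map, List.mem_map, mem_labs]
  constructor
  · rintro ⟨_, ⟨v, c, h, rfl⟩, rfl⟩
    exact ⟨v, ⟨c, h⟩, rfl⟩
  · rintro ⟨v, ⟨c, h⟩, rfl⟩
    exact ⟨_, ⟨v, c, h, rfl⟩, rfl⟩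

end FuseExpr

open FuseExpr

/-- The initial table gives no label a name. The input size bounds all titles, hence all names that
can arise. -/
theorem exists_rename_program : ∃ (P : Program) (p : Polynomial ℕ), ∀ (k : ℕ) (φ : FuseExpr k),
    φ.WellFormed → P.RunsIn (.node (unary k) φ.encode) (φ.rename fun _ => none).encode
      (p.eval (BinTree.node (unary k) φ.encode).size) := by
  obtain ⟨A, a, hA⟩ : PolyTime fun z : BinTree =>
    .node z.right (BinTree.map (fun c => .node c nil) (numbersBelow z.left)) := by fun_prop
  obtain ⟨R, q, hR⟩ := renameScheme_efficient.runs
  let M : Polynomial ℕ := Polynomial.X * (1 + Polynomial.X) +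
    (10 + Polynomial.X * (5 + 2 * Polynomial.X + Polynomial.X))
  refine ⟨.seq A R, 1 + Polynomial.X + a + q.comp (M + Polynomial.X), fun k φ hφ => ?_⟩
  set s := (BinTree.node (unary k) φ.encode).size with hs
  have hsize : 1 + (2 * k + 1) + φ.encode.size = s := by rw [hs, size_node, size_unary]
  obtain ⟨n, hn, e⟩ := eval_renameScheme (K := s) (M := M.eval s) (s := fun _ => none) hφ
    (fun v hv => (size_binary_le_encode hv).trans (by omega)) (fun _ _ h => by simp at h) (by
      simp only [M, Polynomial.eval_add, Polynomial.eval_mul, Polynomial.eval_X,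
        Polynomial.eval_one, Polynomial.eval_ofNat]
      gcongr <;> omega)
  have h₁ := hA (.node (unary k) φ.encode)
  simp only [left_node, right_node, map_numbersBelow fun _ => nil] at h₁
  refine (h₁.seq (hR _ _ _ _ e)).mono ?_
  have := q.monotone_eval_nat (show M.eval s + n ≤ M.eval s + s by omega)
  simp only [Polynomial.eval_add, Polynomial.eval_one, Polynomial.eval_X, Polynomial.eval_comp,
    ← hs] at this ⊢
  omega

theorem exists_reduce_program : ∃ (P : Program) (p : Polynomial ℕ), ∀ (k : ℕ) (φ : FuseExpr k),
    φ.Good → φ.Part id φ.Edge φ.HasVert → ∃ ζ, φ.Realizes id φ.Edge φ.HasVert ζ ∧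
      P.RunsIn (.node (unary k) φ.encode) ζ.encode
        (p.eval (BinTree.node (unary k) φ.encode).size) := by
  obtain ⟨A, a, hA⟩ : PolyTime fun z : BinTree =>
    .node z.right (.node (BinTree.map (fun c => .node c c) (numbersBelow z.left))
      (.node (edges z.right) (BinTree.map (fun p => p.left) (labs z.right)))) := by fun_prop
  obtain ⟨R, q, hR⟩ := reduceScheme_efficient.runs
  -- The summand `a`, the cost of preparing the initial state, also bounds the lists of edges and
  -- vertices in it.
  let M : Polynomial ℕ := Polynomial.X * (10 + 4 * Polynomial.X) +
    (10 + Polynomial.X * (3 + 4 * Polynomial.X) + a)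
  refine ⟨.seq A R, 1 + Polynomial.X + a + q.comp (M + Polynomial.X), fun k φ hg hp => ?_⟩
  set s := (BinTree.node (unary k) φ.encode).size with hs
  have hsize : 1 + (2 * k + 1) + φ.encode.size = s := by rw [hs, size_node, size_unary]
  have h₁ := hA (.node (unary k) φ.encode)
  simp only [left_node, right_node, map_numbersBelow fun c => c] at h₁
  have h₂ := h₁.size_le
  rw [← hs] at h₁ h₂
  simp only [size_node] at h₂
  obtain ⟨r, n, hn, -, o, e⟩ := eval_reduceScheme (M := M.eval s) hg hp φ.listsPairs_edges
    φ.listsVerts_labs (by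
      simp only [M, Polynomial.eval_add, Polynomial.eval_mul, Polynomial.eval_X,
        Polynomial.eval_ofNat]
      have b₁ : φ.encode.size * (10 + 4 * k) ≤ s * (10 + 4 * s) := by gcongr <;> omega
      have b₂ : k * (3 + 4 * k) ≤ s * (3 + 4 * s) := by gcongr <;> omega
      omega)
  -- Some vertex is demanded at the root, so the result is a genuine expression and not `nil`.
  obtain ⟨v, c, hv⟩ := φ.exists_hasLab
  obtain ⟨ζ, hζ, rfl⟩ := o.exists ⟨v, c, hv⟩
  refine ⟨ζ, hζ, (h₁.seq (hR _ _ _ _ e)).mono ?_⟩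
  have := q.monotone_eval_nat (show M.eval s + n ≤ M.eval s + s by omega)
  simp only [Polynomial.eval_add, Polynomial.eval_one, Polynomial.eval_X, Polynomial.eval_comp,
    ← hs] at this ⊢
  omega

theorem mainTheorem2 :
    ∃ (P : Program) (p : Polynomial ℕ) (C : ℕ),
      ∀ (k : ℕ) (φ : FuseExpr k) (V : Type*) (H : SimpleGraph V),
        φ.IsExprOf H → φ.titles.Nodup →
        ∃ ζ : GlueExpr k,
          (∃ t ≤ p.eval (φ.size + k), P.Runs (.node (.unary k) φ.encode) ζ.encode t) ∧
          ζ.IsExprOf H ∧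
          φ.eval.Equivalent ζ.eval ∧
          ζ.Reduced ∧
          ζ.nodes ≤ C * (k ^ 2 * (H.edgeSet.ncard + Nat.card V)) := by
  obtain ⟨A, a, hA⟩ := exists_rename_program
  obtain ⟨B, b, hB⟩ := exists_reduce_program
  obtain ⟨L, l, hL⟩ : PolyTime fun z => z.left := by fun_prop
  let total : Polynomial ℕ := 1 + Polynomial.X + (1 + Polynomial.X + l + a) +
    b.comp (1 + Polynomial.X + l + a)
  -- The encoding of `k` is passed on to the second phase. The composed polynomial bounds the size
  -- of the encoded input in terms of `φ.size + k`; labels are written in unary, which accounts for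
  -- its quadratic growth.
  refine ⟨.seq (.pair L A) B, total.comp (2 + 2 * Polynomial.X +
    Polynomial.X * (20 + 4 * Polynomial.X)), 7, fun k φ V H ⟨hφ, ⟨iso⟩⟩ ht => ?_⟩
  obtain ⟨ζ, hζ, hrun⟩ := hB k (φ.rename fun _ => none) (good_rename_none hφ ht)
    (part_rename_none hφ)
  obtain ⟨hg, heq⟩ := hζ.equivalent hφ
  have iso' : Nonempty (ζ.eval.graph.coe ≃g H) := by
    rw [hg]
    exact ⟨iso⟩
  refine ⟨ζ, ?_, ⟨hζ.wellFormed, iso'⟩, heq, hζ.reduced, ?_⟩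
  · set z := BinTree.node (unary k) φ.encode with hz
    have h₁ : (Program.pair L A).RunsIn z (.node (unary k) (φ.rename fun _ => none).encode) _ :=
      (hL z).pair (hA k φ hφ)
    have h₂ := h₁.seq hrun
    have hz' : z.size ≤ 2 + 2 * (φ.size + k) + (φ.size + k) * (20 + 4 * (φ.size + k)) := by
      have h₃ := φ.size_encode_le
      have h₄ : φ.size * (20 + 4 * k) ≤ (φ.size + k) * (20 + 4 * (φ.size + k)) := by
        gcongr <;> omega
      rw [hz, size_node, size_unary]
      omega
    refine h₂.mono ?_
    have m₁ := b.monotone_eval_nat h₁.size_le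
    have m₂ := total.monotone_eval_nat hz'
    simp only [total, Polynomial.eval_add, Polynomial.eval_one, Polynomial.eval_X,
      Polynomial.eval_comp, Polynomial.eval_mul, Polynomial.eval_ofNat] at m₁ m₂ ⊢
    refine le_trans ?_ m₂
    simp only [← hz] at m₁ ⊢
    omega
  · obtain ⟨iso'⟩ := iso'
    have hn := ζ.nodes_le hζ.reduced hζ.merging H iso'
    -- Every expression has an introduce-node and hence a label, so `k ≥ 1` and the linear bound
    -- implies the one with `k ^ 2`.
    obtain ⟨-, c, -⟩ := φ.exists_hasLab
    have hk : 1 ≤ k ^ 2 := Nat.one_le_pow _ _ c.pos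
    exact hn.trans (Nat.mul_le_mul_left 7 (Nat.le_mul_of_pos_left _ hk))
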